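/- **The scheme $\mathsf{TC}$.** Let $C\subseteq\mathbb F_2^m$ be a binary linear code with $C^\perp\subseteq C$ and $\dim C=\dim C^\perp+1$. It defines a self-dual $[[m,1,d]]$ CSS code with logical states $|b_L\rangle=|C^\perp|^{-1/2}\sum_{u\in C^\perp}|u+b\cdot 1^m\rangle$ and distance $d=\min\{\mathrm{wt}(v): v\in C\setminus C^\perp\}$. Let $d=2d_c+1$, and fix any syndrome decoder that corrects all $X$- and all $Z$-errors of weight at most $d_c$ up to stabilizers. The trap-code scheme $\mathsf{TC}$ for $n$ qubits is as follows. *Key generation.* The secret key consists of independent uniformly random $\pi\in S_{3m}$ and $x[i],z[i]\in\{0,1\}^{3m}$ for $1\le i\le n$. The evaluation key and the log are empty. *Encryption.* Each qubit $i$ is encoded in the code, tensored with $|0\rangle^{\otimes m}|+\rangle^{\otimes m}$ (the traps), permuted by $\pi$, and conjugated with $\mathsf X^{x[i]}\mathsf Z^{z[i]}$. *Circuits.* These are finite lists of CNOTs, of Paulis $\mathsf X_i,\mathsf Z_i$ (possibly controlled by a Boolean function of earlier measurement outcomes) and of computational- or Hadamard-basis measurements, with a set of output wires. No gate acts on a wire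 that is already measured. $\Phi_c$ denotes the channel implemented by the circuit $c$; measured output wires hold their outcome. *Evaluation.* CNOT is applied transversally, Paulis need no action, and a measurement measures all $3m$ qubits of the block, after transversal $\mathsf H$ for the Hadamard basis. *Verified decryption, given $c$.* The gates of $c$ are processed in order. - A Pauli $\mathsf X_i$ (resp. $\mathsf Z_i$) whose control is satisfied adds $\pi(1^m0^{2m})$ to $x[i]$ (resp. $z[i]$). - A CNOT from $i$ to $j$ replaces $(x[j],z[i])$ by $(x[i]+x[j],\,z[i]+z[j])$. - For a measurement of qubit $i$ with classical ciphertext $w$, let $w'=\pi^{-1}(x[i]+w)$ for the computational basis and $w'=\pi^{-1}(z[i]+w)$ for the Hadamard basis. Reject if the second (resp. third) group of $m$ bits of $w'$ is not all zero. Otherwise the outcome is obtained by classical decoding of the first $m$ bits. Finally, for each unmeasured qubit the one-time pad and the permutation are undone, the traps are measured (reject unless they are $|0\rangle^{\otimes m}|+\rangle^{\otimes m}$), and the first $m$ qubits are decoded; non-output wires are discarded. Upon rejection the output is a fixed state $\Omega$. **The IND-VER game.** A uniformly random hidden bit $r$ is drawn and a key is generated. $\mathcal A_1$ prepares a state on the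 plaintext register $X$ and a finite-dimensional side register $R$. If $r=0$, $X$ is encrypted; if $r=1$, $X$ is set aside and $|0^n\rangle\langle 0^n|$ is encrypted instead. $\mathcal A_2$ acts on the ciphertext and $R$ and outputs a ciphertext, a circuit $c$ and a side register $R'$. Verified decryption with $c$ is applied to the ciphertext and yields a plaintext and an accept/reject flag. If $r=1$, this plaintext is discarded and replaced by $\Phi_c$ of the set-aside register if the flag is accept, and by $\Omega$ if it is reject. $\mathcal A_3$ receives the plaintext, $c$, the flag and $R'$, and outputs a bit $r'$. The adversary $\mathcal A=(\mathcal A_1,\mathcal A_2,\mathcal A_3)$ consists of arbitrary quantum operations and wins if $r'=r$. **Theorem.** 1. $\mathsf{TC}$ is perfectly correct: for every key, circuit $c$ and plaintext, verified decryption of the honest evaluation of $c$ on the encrypted plaintext accepts with certainty and outputs $\Phi_c$ of the plaintext. 2. Every adversary, without any bound on its running time, wins the IND-VER game against $\mathsf{TC}$ with probability at most $$\frac12+\frac12\Bigl(\frac23\Bigr)^{d_c}.$$ 3. Consequently, if for each security parameter $\kappa$ such a code and decoder are chosen with $d_c\ge\kappa$ (and $n$ is any function of $\kappa$), then $\mathsf{TC}$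 is $\kappa$-IND-VER: for every family of adversaries (in particular every quantum polynomial-time one) there is a negligible function $\nu$ such that the winning probability is at most $\frac12+\nu(\kappa)$ for all $\kappa$. -/

import Mathlib

noncomputable section

namespace TrapCode

/-! ### Finite-dimensional quantum operations -/

/-- Operators on the Hilbert space with orthonormal basis `α`. -/
abbrev Mat (α : Type) := Matrix α α ℂ

section Channels

open scoped ComplexOrder

variable {α β ρ ι : Type}

/-- `Φ ⊗ id`: the map `Φ` applied to the first of two registers. -/
def onLeft (Φ : Mat α →ₗ[ℂ] Mat β) : Mat (α × ρ) →ₗ[ℂ] Mat (β × ρ) where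
  toFun M := Matrix.of fun p q => Φ (Matrix.of fun a a' => M (a, p.2) (a', q.2)) p.1 q.1
  map_add' M N := by
    ext p q
    exact congrFun (congrFun (map_add Φ (Matrix.of fun a a' => M (a, p.2) (a', q.2))
      (Matrix.of fun a a' => N (a, p.2) (a', q.2))) p.1) q.1
  map_smul' z M := by
    ext p q
    exact congrFun (congrFun (map_smul Φ z
      (Matrix.of fun a a' => M (a, p.2) (a', q.2))) p.1) q.1

variable [Fintype α] [Fintype ι]

/-- The map `M ↦ K M K†`. -/
def conj (K : Matrix β α ℂ) : Mat α →ₗ[ℂ] Mat β where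
  toFun M := K * M * K.conjTranspose
  map_add' M N := by rw [Matrix.mul_add, Matrix.add_mul]
  map_smul' a M := by simp

/-- The map `M ↦ ∑ i, K i M (K i)†`. -/
def krausMap (K : ι → Matrix β α ℂ) : Mat α →ₗ[ℂ] Mat β := ∑ i, conj (K i)

/-- Completely positive maps, in Kraus form. -/
def IsCP (Φ : Mat α →ₗ[ℂ] Mat β) : Prop :=
  ∃ (r : ℕ) (K : Fin r → Matrix β α ℂ), Φ = krausMap K

/-- Quantum channels: completely positive trace-preserving maps. -/
def IsChannel [Fintype β] (Φ : Mat α →ₗ[ℂ] Mat β) : Prop :=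
  IsCP Φ ∧ ∀ M, (Φ M).trace = M.trace

/-- Density matrices. -/
def IsState (M : Mat α) : Prop := M.PosSemidef ∧ M.trace = 1

end Channels

/-! ### Schemes for verifiable homomorphic encryption, and the verification game -/

section Schemes

open scoped ComplexOrder

/-- The data of a scheme at one value of the security parameter. `X` indexes the computational
basis of the plaintext register, `Y` that of the ciphertext register, `E` that of the evaluation
key, and `Out c` that of the output register of the circuit `c`. Flags: `true` is accept. -/
structure Scheme (Key E X Y Circ Log : Type) (Out : Circ → Type) where
  /-- The classical-quantum output of key generation: `keyGen k` is the state of the evaluation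
  key when the secret key is `k`, multiplied with the probability of `k`. -/
  keyGen : Key → Mat E
  /-- Encryption. -/
  enc : Key → Mat X →ₗ[ℂ] Mat Y
  /-- Homomorphic evaluation; one map for each value of the classical log. -/
  eval : Circ → Log → Mat (Y × E) →ₗ[ℂ] Mat Y
  /-- Verified decryption; one map for each value of the flag. -/
  verDec : Key → (c : Circ) → Log → Bool → Mat Y →ₗ[ℂ] Mat (Out c)
  /-- The channel `Φ_c` that the circuit `c` implements on plaintexts. -/
  ideal : (c : Circ) → Mat X →ₗ[ℂ] Mat (Out c)
  /-- The dummy plaintext. -/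
  dummy : Mat X
  /-- The fixed state that replaces the output upon rejection. -/
  omega : (c : Circ) → Mat (Out c)

/-- An adversary `(A₁, A₂, A₃)` in the verification game. The side registers `R`, `R'` have
arbitrary finite dimensions `r`, `r' c`. `A₁` is a channel. `A₂` is a quantum instrument whose
classical outcome is the claimed circuit and log. `A₃` is, for every value of the classical data it
sees (the circuit and the accept flag), a two-outcome measurement; its outcome is the guess. -/
structure Adversary (E X Y Circ Log : Type) (Out : Circ → Type)
    [Fintype E] [Fintype X] [Fintype Y] [∀ c, Fintype (Out c)] [∀ c, DecidableEq (Out c)] where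
  r : ℕ
  r' : Circ → ℕ
  A₁ : Mat E →ₗ[ℂ] Mat (X × Fin r)
  A₁_channel : IsChannel A₁
  A₂ : (c : Circ) → Log → Mat (Y × Fin r) →ₗ[ℂ] Mat (Y × Fin (r' c))
  A₂_cp : ∀ c l, IsCP (A₂ c l)
  A₂_tp : ∀ M, HasSum (fun cl : Circ × Log => (A₂ cl.1 cl.2 M).trace) M.trace
  A₃ : (c : Circ) → (flag : Bool) → (guess : Bool) → Mat (Out c × Fin (r' c))
  A₃_pos : ∀ c flag guess, (A₃ c flag guess).PosSemidef
  A₃_sum : ∀ c flag, A₃ c flag false + A₃ c flag true = 1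

end Schemes

section Game

variable {Key E X Y Circ Log : Type} {Out : Circ → Type}
  [Fintype Key] [Fintype E] [Fintype X] [Fintype Y] [Fintype Log]
  [∀ c, Fintype (Out c)] [∀ c, DecidableEq (Out c)]

/-- Perfect correctness: honest evaluation of `c` on an encryption of a plaintext is always
accepted, and verified decryption of the result applies `Φ_c` to the plaintext. (An identity of
linear maps, hence it persists in the presence of a reference register.) -/
def Scheme.IsCorrect (S : Scheme Key E X Y Circ Log Out) : Prop :=
  ∀ (k : Key) (c : Circ) (M : Mat X),
    (∑ l, S.verDec k c l true (S.eval c l (Matrix.kronecker (S.enc k M) (S.keyGen k))) =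
      (S.keyGen k).trace • S.ideal c M) ∧
    (∑ l, S.verDec k c l false (S.eval c l (Matrix.kronecker (S.enc k M) (S.keyGen k))) = 0)

/-- The (unnormalised) state that `A₃` receives if the hidden bit is `0`, when the secret key is
`k`, the second adversary claims `(c, l)`, and the flag is `flag`. -/
def finalState₀ (S : Scheme Key E X Y Circ Log Out) (A : Adversary E X Y Circ Log Out)
    (k : Key) (c : Circ) (l : Log) (flag : Bool) : Mat (Out c × Fin (A.r' c)) :=
  onLeft (S.verDec k c l flag) (A.A₂ c l (onLeft (S.enc k) (A.A₁ (S.keyGen k))))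

/-- The joint state of ciphertext, side register and swapped-out plaintext just before `A₂` acts,
if the hidden bit is `1`: the ciphertext encrypts the dummy plaintext. -/
def swappedState (S : Scheme Key E X Y Circ Log Out) (A : Adversary E X Y Circ Log Out)
    (k : Key) : Mat ((Y × Fin A.r) × X) :=
  Matrix.of fun p q =>
    S.enc k S.dummy p.1.1 q.1.1 * A.A₁ (S.keyGen k) (p.2, p.1.2) (q.2, q.1.2)

/-- The joint state of swapped-out plaintext and side register after `A₂` and verified decryption,
with the decrypted dummy discarded, if the hidden bit is `1`. -/
def verifiedState (S : Scheme Key E X Y Circ Log Out) (A : Adversary E X Y Circ Log Out)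
    (k : Key) (c : Circ) (l : Log) (flag : Bool) : Mat (X × Fin (A.r' c)) :=
  Matrix.of fun p q => Matrix.trace (S.verDec k c l flag (Matrix.of fun y y' =>
    onLeft (A.A₂ c l) (swappedState S A k) ((y, p.2), p.1) ((y', q.2), q.1)))

/-- The (unnormalised) state that `A₃` receives if the hidden bit is `1`: `Φ_c` is applied to the
swapped-out plaintext, and upon rejection the result is erased and replaced by the fixed state. -/
def finalState₁ (S : Scheme Key E X Y Circ Log Out) (A : Adversary E X Y Circ Log Out)
    (k : Key) (c : Circ) (l : Log) (flag : Bool) : Mat (Out c × Fin (A.r' c)) :=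
  let σ : Mat (Out c × Fin (A.r' c)) := onLeft (S.ideal c) (verifiedState S A k c l flag)
  if flag then σ
  else Matrix.of fun p q => S.omega c p.1 q.1 * ∑ o, σ (o, p.2) (o, q.2)

/-- The probability that the guess of the adversary equals the uniformly random hidden bit. -/
def winProb (S : Scheme Key E X Y Circ Log Out) (A : Adversary E X Y Circ Log Out) : ℝ :=
  ∑' cl : Circ × Log, ∑ k : Key, ∑ flag : Bool,
    ((1 / 2 : ℝ) * (Matrix.trace (A.A₃ cl.1 flag false * finalState₀ S A k cl.1 cl.2 flag)).re +
      (1 / 2 : ℝ) * (Matrix.trace (A.A₃ cl.1 flag true * finalState₁ S A k cl.1 cl.2 flag)).re)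

end Game

/-- Negligible functions of the security parameter. -/
def Negligible (ν : ℕ → ℝ) : Prop :=
  Asymptotics.SuperpolynomialDecay Filter.atTop (fun κ : ℕ => (κ : ℝ)) ν

/-- `κ`-IND-VER of a family of schemes, against all families of adversaries; there is no bound on
their running time, so this includes all quantum polynomial-time adversaries. -/
def IsIndVer {Key E X Y Circ Log : ℕ → Type} {Out : (κ : ℕ) → Circ κ → Type}
    [∀ κ, Fintype (Key κ)] [∀ κ, Fintype (E κ)] [∀ κ, Fintype (X κ)] [∀ κ, Fintype (Y κ)]
    [∀ κ c, Fintype (Out κ c)] [∀ κ c, DecidableEq (Out κ c)]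
    (S : (κ : ℕ) → Scheme (Key κ) (E κ) (X κ) (Y κ) (Circ κ) (Log κ) (Out κ)) : Prop :=
  ∀ A : (κ : ℕ) → Adversary (E κ) (X κ) (Y κ) (Circ κ) (Log κ) (Out κ),
    ∃ ν : ℕ → ℝ, Negligible ν ∧ ∀ κ, winProb (S κ) (A κ) ≤ 1 / 2 + ν κ

/-! ### Operators on registers of qubits

The computational basis of a register of qubits with positions `ι` is `ι → ZMod 2`. -/

/-- `(-1)^t`. -/
def sgn (t : ZMod 2) : ℂ := (-1) ^ t.val

section Operators

variable {ι : Type} [Fintype ι] [DecidableEq ι]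

/-- `X^x`. -/
def pauliX (x : ι → ZMod 2) : Mat (ι → ZMod 2) :=
  Matrix.of fun a b => if a = b + x then 1 else 0

/-- `Z^z`. -/
def pauliZ (z : ι → ZMod 2) : Mat (ι → ZMod 2) :=
  Matrix.diagonal fun v => sgn (z ⬝ᵥ v)

/-- The Hadamard gate on every qubit of the register. -/
def hadamard (ι : Type) [Fintype ι] : Mat (ι → ZMod 2) :=
  Matrix.of fun a b => ((Real.sqrt 2 : ℂ) ^ Fintype.card ι)⁻¹ * sgn (a ⬝ᵥ b)

/-- Moving entry `j` to position `π j`. -/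
def permuteBits (π : Equiv.Perm ι) (v : ι → ZMod 2) : ι → ZMod 2 := fun j => v (π.symm j)

/-- Moving qubit `j` to position `π j`. -/
def permuteQubits (π : Equiv.Perm ι) : Mat (ι → ZMod 2) :=
  Matrix.of fun a b => if a = permuteBits π b then 1 else 0

variable {G H : Type}

/-- The operator `M` applied to the `i`-th of `n` registers with basis `G`. -/
def applyAt {n : ℕ} [DecidableEq G] (i : Fin n) (M : Mat G) : Mat (Fin n → G) :=
  Matrix.of fun a b => if ∀ l, l ≠ i → a l = b l then M (a i) (b i) else 0

/-- Adding register `i` to register `j`; on registers of qubits this is transversal CNOT with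
control `i` and target `j`. -/
def cnot {n : ℕ} [DecidableEq G] [Add G] (i j : Fin n) : Mat (Fin n → G) :=
  Matrix.of fun a b => if a = Function.update b j (b i + b j) then 1 else 0

/-- The tensor product of the operators `K i`. -/
def tensor {n : ℕ} (K : Fin n → Matrix H G ℂ) : Matrix (Fin n → H) (Fin n → G) ℂ :=
  Matrix.of fun a b => ∏ i, K i (a i) (b i)

/-- The projection onto the basis vector `w`. -/
def proj [DecidableEq G] (w : G) : Mat G := Matrix.single w w 1

end Operators

/-! ### Circuits -/

/-- Measurement bases: computational and Hadamard. -/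
inductive MeasBasis
  | comp
  | had

/-- Gates on `n` wires. The Paulis are controlled by an arbitrary Boolean function of the earlier
measurement outcomes (wires that are not measured yet count as `0`); a constant function gives the
unconditional gates. -/
inductive Gate (n : ℕ)
  | X (b : (Fin n → ZMod 2) → Bool) (i : Fin n)
  | Z (b : (Fin n → ZMod 2) → Bool) (i : Fin n)
  | CNOT (i j : Fin n)
  | meas (basis : MeasBasis) (i : Fin n)

/-- A list of gates is well formed, given the set of wires measured before, if no gate acts on a
measured wire, and each CNOT acts on two different wires. -/
def WellFormed {n : ℕ} : Finset (Fin n) → List (Gate n) → Prop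
  | _, [] => True
  | s, Gate.X _ i :: gs => i ∉ s ∧ WellFormed s gs
  | s, Gate.Z _ i :: gs => i ∉ s ∧ WellFormed s gs
  | s, Gate.CNOT i j :: gs => i ≠ j ∧ i ∉ s ∧ j ∉ s ∧ WellFormed s gs
  | s, Gate.meas _ i :: gs => i ∉ s ∧ WellFormed (insert i s) gs

/-- Circuits on `n` qubits built from (classically controlled) Paulis, CNOTs and measurements;
`out` is the set of output wires, all others are discarded at the end. -/
structure Circuit (n : ℕ) where
  gates : List (Gate n)
  out : Finset (Fin n)
  wf : WellFormed ∅ gates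

/-- The basis of the output register of a circuit. Measurement outcomes on output wires are output
as basis states. -/
abbrev Circuit.Out {n : ℕ} (c : Circuit n) : Type := {i // i ∈ c.out} → ZMod 2

/-- Discarding all wires outside `s`. -/
def traceOut {n : ℕ} (s : Finset (Fin n)) :
    Mat (Fin n → ZMod 2) →ₗ[ℂ] Mat ({i // i ∈ s} → ZMod 2) :=
  krausMap fun t : {i // i ∉ s} → ZMod 2 => Matrix.of fun u v =>
    if (∀ i, v i.1 = u i) ∧ (∀ i, v i.1 = t i) then 1 else 0

/-- The Hadamard gate on one qubit. -/
def hadamard₁ : Mat (ZMod 2) := Matrix.of fun a b => (Real.sqrt 2 : ℂ)⁻¹ * sgn (a * b)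

/-- The Kraus operator of a measurement of wire `i` with outcome `a`; afterwards the wire holds
the basis state `a`. -/
def measKraus {n : ℕ} (basis : MeasBasis) (i : Fin n) (a : ZMod 2) : Mat (Fin n → ZMod 2) :=
  match basis with
  | MeasBasis.comp => applyAt i (proj a)
  | MeasBasis.had => applyAt i (proj a * hadamard₁)

/-- The quantum operation of a list of gates, given the outcomes of earlier measurements. -/
def runGates {n : ℕ} : List (Gate n) → (Fin n → ZMod 2) →
    (Mat (Fin n → ZMod 2) →ₗ[ℂ] Mat (Fin n → ZMod 2))
  | [], _ => LinearMap.id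
  | Gate.X b i :: gs, rec =>
      runGates gs rec ∘ₗ conj (if b rec then pauliX (Pi.single i 1) else 1)
  | Gate.Z b i :: gs, rec =>
      runGates gs rec ∘ₗ conj (if b rec then pauliZ (Pi.single i 1) else 1)
  | Gate.CNOT i j :: gs, rec => runGates gs rec ∘ₗ conj (cnot i j)
  | Gate.meas basis i :: gs, rec =>
      ∑ a : ZMod 2, runGates gs (Function.update rec i a) ∘ₗ conj (measKraus basis i a)

/-- The channel `Φ_c` implemented by a circuit. -/
def Circuit.channel {n : ℕ} (c : Circuit n) : Mat (Fin n → ZMod 2) →ₗ[ℂ] Mat c.Out :=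
  traceOut c.out ∘ₗ runGates c.gates 0

/-! ### Self-dual CSS codes -/

/-- The dual of a binary linear code. -/
def dualCode {m : ℕ} (C : Submodule (ZMod 2) (Fin m → ZMod 2)) :
    Submodule (ZMod 2) (Fin m → ZMod 2) where
  carrier := {u | ∀ v ∈ C, u ⬝ᵥ v = 0}
  add_mem' {a b} ha hb v hv := by rw [add_dotProduct, ha v hv, hb v hv, add_zero]
  zero_mem' v _ := zero_dotProduct v
  smul_mem' a u hu v hv := by rw [smul_dotProduct, hu v hv, smul_zero]

/-- A self-dual CSS code on `m` physical qubits with one logical qubit: it is given by a binary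
code `C` with `C^⊥ ⊆ C` and `dim C - dim C^⊥ = 1`; the `X`- and the `Z`-type stabilizers are both
indexed by `C^⊥`. (The all-one word then lies in `C` and not in `C^⊥`.) -/
structure CSSCode (m : ℕ) where
  C : Submodule (ZMod 2) (Fin m → ZMod 2)
  dual_le : dualCode C ≤ C
  finrank_eq : Module.finrank (ZMod 2) C = Module.finrank (ZMod 2) (dualCode C) + 1

namespace CSSCode

variable {m : ℕ} (Q : CSSCode m)

/-- The distance of the code: the least weight of a nontrivial logical `X` (or `Z`) operator. -/
def distance : ℕ := sInf {w | ∃ v ∈ Q.C, v ∉ dualCode Q.C ∧ hammingNorm v = w}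

open scoped Classical in
/-- The encoding isometry: the basis vector `b` is mapped to the uniform superposition of the coset
`b(1,…,1) + C^⊥`. -/
def encode : Matrix (Fin m → ZMod 2) (ZMod 2) ℂ :=
  Matrix.of fun v b => if (v - fun _ => b) ∈ dualCode Q.C then
    ((Real.sqrt (Nat.card (dualCode Q.C)) : ℝ) : ℂ)⁻¹ else 0

/-- A syndrome decoder: to every word it assigns an error pattern, which has the same syndrome as
the word (`corr_mem`) and depends on that syndrome only (`corr_add`). -/
structure Decoder where
  corr : (Fin m → ZMod 2) → (Fin m → ZMod 2)
  corr_mem : ∀ w, w - corr w ∈ Q.C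
  corr_add : ∀ w, ∀ v ∈ Q.C, corr (w + v) = corr w

variable {Q}

/-- The decoder corrects all `X`- and all `Z`-errors on at most `t` qubits: it finds the error up
to a stabilizer. -/
def Decoder.Corrects (δ : Q.Decoder) (t : ℕ) : Prop :=
  ∀ e, hammingNorm e ≤ t → e - δ.corr e ∈ dualCode Q.C

/-- Every code of distance `2 t + 1` has a decoder that corrects `t` errors, namely minimum-weight
decoding. -/
theorem exists_decoder_corrects (Q : CSSCode m) (t : ℕ) (hd : Q.distance = 2 * t + 1) :
    ∃ δ : Q.Decoder, δ.Corrects t := by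
  have h0 : ∀ s : (Fin m → ZMod 2) ⧸ Q.C, ∃ e, (Submodule.Quotient.mk e : _ ⧸ Q.C) = s ∧
      ∀ e', (Submodule.Quotient.mk e' : _ ⧸ Q.C) = s → hammingNorm e ≤ hammingNorm e' := by
    intro s
    obtain ⟨e, he⟩ := Submodule.Quotient.mk_surjective Q.C s
    have hne : {e | (Submodule.Quotient.mk e : _ ⧸ Q.C) = s}.Nonempty := ⟨e, he⟩
    exact ⟨Function.argminOn hammingNorm _ hne, Function.argminOn_mem hammingNorm _ hne,
      fun e' he' => Function.argminOn_le hammingNorm _ he'⟩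
  choose f hf hmin using h0
  refine ⟨⟨fun w => f (Submodule.Quotient.mk w), fun w => ?_, fun w v hv => ?_⟩, fun e he => ?_⟩
  · exact (Submodule.Quotient.eq Q.C).1 (hf _).symm
  · congr 1
    exact (Submodule.Quotient.eq Q.C).2 (by simpa using hv)
  · by_contra hcon
    have hC : e - f (Submodule.Quotient.mk e) ∈ Q.C := (Submodule.Quotient.eq Q.C).1 (hf _).symm
    have h1 : Q.distance ≤ hammingNorm (e - f (Submodule.Quotient.mk e)) :=
      Nat.sInf_le ⟨_, hC, hcon, rfl⟩
    have h2 := hmin (Submodule.Quotient.mk e) e rfl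
    have h3 := hammingDist_triangle_right e (f (Submodule.Quotient.mk e)) 0
    rw [hammingDist_zero_right, hammingDist_zero_right, hammingDist_comm,
      hammingDist_eq_hammingNorm, neg_add_eq_sub] at h3
    omega

/-- The logical measurement outcome obtained from physical outcomes `w`: the codeword `w - corr w`
lies in `b(1,…,1) + C^⊥`, where `b` is its parity. -/
def Decoder.classicalDecode (δ : Q.Decoder) (w : Fin m → ZMod 2) : ZMod 2 :=
  ∑ j, (w - δ.corr w) j

/-- The Kraus operators of quantum decoding. A measurement of the two syndromes is labelled by the
error patterns `(e, f)` that the decoder assigns to them; then `X^e Z^f` is undone, and the encoded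
qubit is extracted. -/
def Decoder.decodeKraus (δ : Q.Decoder) (s : (Fin m → ZMod 2) × (Fin m → ZMod 2)) :
    Matrix (ZMod 2) (Fin m → ZMod 2) ℂ :=
  if δ.corr s.1 = s.1 ∧ δ.corr s.2 = s.2 then
    Q.encode.conjTranspose * (pauliX s.1 * pauliZ s.2).conjTranspose
  else 0

end CSSCode

/-! ### The trap-code scheme -/

/-- The basis of a block of `3m` qubits. The positions `(0, j)` hold the encoded data, `(1, j)` the
computational traps and `(2, j)` the Hadamard traps (before permuting). -/
abbrev Block (m : ℕ) : Type := Fin 3 × Fin m → ZMod 2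

/-- Secret keys `(π, x, z)`. -/
abbrev TCKey (n m : ℕ) : Type :=
  Equiv.Perm (Fin 3 × Fin m) × (Fin n → Block m) × (Fin n → Block m)

section TC

variable {n m : ℕ} {Q : CSSCode m} (δ : Q.Decoder)

/-- Tensoring an operator into `m` data qubits with `|0^m⟩|+^m⟩`. -/
def withTraps (K : Matrix (Fin m → ZMod 2) (ZMod 2) ℂ) : Matrix (Block m) (ZMod 2) ℂ :=
  Matrix.of fun v b => K (fun j => v (0, j)) b *
    (if ∀ j, v (1, j) = 0 then 1 else 0) * ((Real.sqrt 2 : ℂ) ^ m)⁻¹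

/-- Encryption of one qubit: encode, add traps, permute, apply the quantum one-time pad. -/
def encBlock (Q : CSSCode m) (π : Equiv.Perm (Fin 3 × Fin m)) (x z : Block m) :
    Matrix (Block m) (ZMod 2) ℂ :=
  pauliX x * pauliZ z * permuteQubits π * withTraps Q.encode

/-- The Kraus operators of the accepting branch of verified decryption of one unmeasured qubit:
undo the quantum one-time pad and the permutation, project the traps on `|0^m⟩|+^m⟩`, decode. -/
def decBlock (π : Equiv.Perm (Fin 3 × Fin m)) (x z : Block m)
    (s : (Fin m → ZMod 2) × (Fin m → ZMod 2)) : Matrix (ZMod 2) (Block m) ℂ :=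
  (withTraps (δ.decodeKraus s).conjTranspose).conjTranspose * permuteQubits π⁻¹ *
    (pauliX x * pauliZ z).conjTranspose

/-- Homomorphic evaluation of one gate. Paulis need no action. -/
def evalGate : Gate n → (Mat (Fin n → Block m) →ₗ[ℂ] Mat (Fin n → Block m))
  | Gate.X _ _ => LinearMap.id
  | Gate.Z _ _ => LinearMap.id
  | Gate.CNOT i j => conj (cnot i j)
  | Gate.meas MeasBasis.comp i => krausMap fun w : Block m => applyAt i (proj w)
  | Gate.meas MeasBasis.had i =>
      krausMap fun w : Block m => applyAt i (proj w * hadamard (Fin 3 × Fin m))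

/-- Homomorphic evaluation of a list of gates. -/
def evalGates : List (Gate n) → (Mat (Fin n → Block m) →ₗ[ℂ] Mat (Fin n → Block m))
  | [] => LinearMap.id
  | g :: gs => evalGates gs ∘ₗ evalGate g

/-- The classical data of verified decryption: the current one-time pad keys, and the decoded
outcomes of the wires that are measured already. -/
structure DecState (n m : ℕ) where
  x : Fin n → Block m
  z : Fin n → Block m
  outcome : Fin n → Option (ZMod 2)

/-- The outcomes as an input for classical control. -/
def DecState.record (st : DecState n m) : Fin n → ZMod 2 := fun i => (st.outcome i).getD 0

/-- The bit string `1^m 0^{2m}`. -/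
def dataMask (m : ℕ) : Block m := fun p => if p.1 = 0 then 1 else 0

/-- Verified decryption of the physical outcomes `w` of a measured qubit: check the traps that are
relevant for the basis, then decode. `none` is reject. -/
def verDecMeasurement (π : Equiv.Perm (Fin 3 × Fin m)) (x z w : Block m) (basis : MeasBasis) :
    Option (ZMod 2) :=
  match basis with
  | MeasBasis.comp =>
      let w' := permuteBits π⁻¹ (x + w)
      if ∀ j, w' (1, j) = 0 then some (δ.classicalDecode fun j => w' (0, j)) else none
  | MeasBasis.had =>
      let w' := permuteBits π⁻¹ (z + w)
      if ∀ j, w' (2, j) = 0 then some (δ.classicalDecode fun j => w' (0, j)) else none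

/-- The classical processing of one gate in verified decryption: key updates, and verified
decryption of measurement outcomes. `w i` is the classical ciphertext of wire `i`; it is used for
measured wires only. `none` is reject. -/
def verDecGate (π : Equiv.Perm (Fin 3 × Fin m)) (w : Fin n → Block m) (st : DecState n m) :
    Gate n → Option (DecState n m)
  | Gate.X b i =>
      some (if b st.record then
        { st with x := Function.update st.x i (st.x i + permuteBits π (dataMask m)) } else st)
  | Gate.Z b i =>
      some (if b st.record then
        { st with z := Function.update st.z i (st.z i + permuteBits π (dataMask m)) } else st)
  | Gate.CNOT i j =>
      some { st with
        x := Function.update st.x j (st.x i + st.x j)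
        z := Function.update st.z i (st.z i + st.z j) }
  | Gate.meas basis i =>
      (verDecMeasurement δ π (st.x i) (st.z i) (w i) basis).map fun a =>
        { st with outcome := Function.update st.outcome i (some a) }

/-- The classical processing of a list of gates in verified decryption. -/
def verDecGates (π : Equiv.Perm (Fin 3 × Fin m)) (w : Fin n → Block m) :
    DecState n m → List (Gate n) → Option (DecState n m)
  | st, [] => some st
  | st, g :: gs => (verDecGate δ π w st g).bind fun st' => verDecGates π w st' gs

/-- The branches of verified decryption on one wire: a pair of syndromes (given by error patterns)
if the wire is unmeasured, the classical ciphertext if it is measured. -/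
abbrev Branch (m : ℕ) : Type := ((Fin m → ZMod 2) × (Fin m → ZMod 2)) ⊕ Block m

/-- The Kraus operator of one branch on one wire, given the decoded outcome of that wire (`none` if
the wire is unmeasured) and its final keys. A measured wire is read in the computational basis and
replaced by its decoded outcome. -/
def wireKraus (π : Equiv.Perm (Fin 3 × Fin m)) (x z : Block m) :
    Option (ZMod 2) → Branch m → Matrix (ZMod 2) (Block m) ℂ
  | none, Sum.inl s => decBlock δ π x z s
  | some a, Sum.inr w => Matrix.single a w 1
  | none, Sum.inr _ => 0
  | some _, Sum.inl _ => 0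

/-- The Kraus operators of the accepting branch of verified decryption, on all wires. -/
def verDecKraus (k : TCKey n m) (gs : List (Gate n)) (t : Fin n → Branch m) :
    Matrix (Fin n → ZMod 2) (Fin n → Block m) ℂ :=
  match verDecGates δ k.1 (fun i => Sum.elim (fun _ => 0) id (t i)) ⟨k.2.1, k.2.2, fun _ => none⟩ gs
  with
  | none => 0
  | some st => tensor fun i => wireKraus δ k.1 (st.x i) (st.z i) (st.outcome i) (t i)

/-- The accepting branch of verified decryption. -/
def verDecAcc (k : TCKey n m) (c : Circuit n) : Mat (Fin n → Block m) →ₗ[ℂ] Mat c.Out :=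
  traceOut c.out ∘ₗ krausMap (verDecKraus δ k c.gates)

/-- The trap-code scheme. The key is uniformly random, the evaluation key and the log are trivial.
Verified decryption accepts or rejects with total probability one, and outputs the fixed state
upon rejection. -/
def TC (n : ℕ) (δ : Q.Decoder) (Ω : (c : Circuit n) → Mat c.Out) :
    Scheme (TCKey n m) Unit (Fin n → ZMod 2) (Fin n → Block m) (Circuit n) Unit Circuit.Out where
  keyGen _ := ((Fintype.card (TCKey n m) : ℂ)⁻¹) • 1
  enc k := conj (tensor fun i => encBlock Q k.1 (k.2.1 i) (k.2.2 i))
  eval c _ := evalGates c.gates ∘ₗ conj (Matrix.of fun y p => if p.1 = y then 1 else 0)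
  verDec k c _ flag :=
    if flag then verDecAcc δ k c
    else (Matrix.traceLinearMap _ ℂ ℂ - Matrix.traceLinearMap _ ℂ ℂ ∘ₗ verDecAcc δ k c).smulRight
      (Ω c)
  ideal c := c.channel
  dummy := proj 0
  omega := Ω

end TC

end TrapCode

end

/-!
Why the trap-code scheme is perfectly correct and verifiable.

*Normal form.* All measurements and all (controlled) Paulis of a circuit can be deferred: the
circuit is a fixed Clifford operator `unitaryPart`, made of CNOTs and of Hadamard gates on the
wires that are measured in the Hadamard basis, followed by a sum over outcomes `α` of a Pauli
`frame` that depends on `α`, and of projections (`runNoisy_comp_pauli`). The accepting branch of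
verified decryption has the same shape, with blocks in place of qubits and with the same frame
(`verDecAcc_eq`). Hence it undoes a one-time pad that was propagated through the circuit
(`verDecAcc_comp_pauli`), and it does not notice that measured wires were dephased
(`verDecAcc_dephase`).

*Pauli attacks.* The code with its traps is again a CSS code (`trapPair`), and `unitaryPart` acts
transversally on it. Let a Pauli act on the ciphertext between evaluation and decryption. On each
wire, the Kraus operators of decryption become multiples of a single logical operator, with total
weight one if the Pauli is trivial on the checked traps and zero otherwise (`wireOp_attack`). So a
Pauli either is rejected with certainty, or passes and leaves the circuit with a logical Pauli
error and with shifted outcomes (`verDecAcc_attack`). These errors vanish if the Pauli has weight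
at most `d_c` on every block. The trivial attack gives correctness (`isCorrect`).

*Twirling.* In the game the adversary acts on ciphertext and side register with arbitrary Kraus
operators. Their expansion in Paulis, pulled past the one-time pad, acquires signs of commutation
that are characters of the key. Averaging over the pad therefore removes all cross terms
(`sum_twirl`), and the attack becomes a Pauli `q` together with an unnormalised state
`attackState` of plaintext and side register. This state depends neither on the secret permutation
nor on the question whether the plaintext is encrypted or kept aside (`sum_finalState₀`,
`sum_finalState₁`), and the traces of all these states add up to one (`hasSum_trace_attackState`).

*Counting.* Given the Pauli, the real and the ideal game differ only if it passes the traps and is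
heavy on some block. A group of traps occupies a third of the `3 m` positions of a block, so that
a random permutation keeps it away from an error of weight `t` with probability at most `(2/3) ^
t`; this follows by induction on `t` from double counting (`card_avoiding_le`,
`card_passesAll_le`). In all other cases the guess is right with probability `1/2`, which yields
the bound (`winProb_le`).
-/

noncomputable section

set_option linter.unusedSectionVars false

namespace TrapCode

/-! ### Signs and Pauli operators over elementary abelian 2-groups -/

theorem sgn_zero : sgn 0 = 1 := by simp [sgn]

theorem sgn_one : sgn 1 = -1 := by
  have : (1 : ZMod 2).val = 1 := rfl
  simp [sgn, this]

theorem zmod_two_cases (a : ZMod 2) : a = 0 ∨ a = 1 := by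
  revert a; decide

theorem sgn_add (a b : ZMod 2) : sgn (a + b) = sgn a * sgn b := by
  have h : (1 + 1 : ZMod 2) = 0 := rfl
  rcases zmod_two_cases a with rfl | rfl <;> rcases zmod_two_cases b with rfl | rfl <;>
    simp [sgn_zero, sgn_one, h]

theorem sgn_mul_self (a : ZMod 2) : sgn a * sgn a = 1 := by
  rcases zmod_two_cases a with rfl | rfl <;> simp [sgn_zero, sgn_one]

theorem star_sgn (a : ZMod 2) : star (sgn a) = sgn a := by
  rcases zmod_two_cases a with rfl | rfl <;> simp [sgn_zero, sgn_one]

theorem sgn_sum {ι : Type} (s : Finset ι) (f : ι → ZMod 2) :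
    sgn (∑ i ∈ s, f i) = ∏ i ∈ s, sgn (f i) := by
  classical
  induction s using Finset.induction_on with
  | empty => simp [sgn_zero]
  | insert a s ha ih => rw [Finset.sum_insert ha, Finset.prod_insert ha, sgn_add, ih]

/-- An elementary abelian 2-group with a symmetric perfect pairing `χ` into `{1, -1}`. Its elements
label the computational basis of a register; the class treats logical qubits, blocks of
qubits and tuples of blocks alike. -/
class SignPairing (G : Type) [AddCommGroup G] [Fintype G] [DecidableEq G] where
  χ : G → G → ℂ
  add_self : ∀ g : G, g + g = 0
  χ_add_left : ∀ a b c, χ (a + b) c = χ a c * χ b c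
  χ_comm : ∀ a b, χ a b = χ b a
  χ_mul_self : ∀ a b, χ a b * χ a b = 1
  star_χ : ∀ a b, star (χ a b) = χ a b
  sum_χ : ∀ a, ∑ b, χ a b = if a = 0 then (Fintype.card G : ℂ) else 0

open SignPairing

instance : SignPairing (ZMod 2) where
  χ a b := sgn (a * b)
  add_self := by decide
  χ_add_left a b c := by rw [add_mul, sgn_add]
  χ_comm a b := by rw [mul_comm]
  χ_mul_self a b := sgn_mul_self _
  star_χ a b := star_sgn _
  sum_χ a := by
    have h : (Finset.univ : Finset (ZMod 2)) = {0, 1} := rfl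
    rw [h, Finset.sum_pair zero_ne_one]
    rcases zmod_two_cases a with rfl | rfl <;> simp [sgn_zero, sgn_one]; norm_num

instance {ι : Type} [Fintype ι] [DecidableEq ι] {G : Type} [AddCommGroup G] [Fintype G]
    [DecidableEq G] [SignPairing G] : SignPairing (ι → G) where
  χ a b := ∏ i, χ (a i) (b i)
  add_self g := funext fun i => add_self (g i)
  χ_add_left a b c := by simp [χ_add_left, Finset.prod_mul_distrib]
  χ_comm a b := Finset.prod_congr rfl fun i _ => χ_comm _ _
  χ_mul_self a b := by
    rw [← Finset.prod_mul_distrib]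
    exact Finset.prod_eq_one fun i _ => χ_mul_self _ _
  star_χ a b := by
    rw [star_prod]
    exact Finset.prod_congr rfl fun i _ => star_χ _ _
  sum_χ a := by
    have h := Finset.prod_univ_sum (fun _ : ι => (Finset.univ : Finset G))
      (fun i g => χ (a i) g)
    rw [Fintype.piFinset_univ] at h
    rw [← h]
    simp only [sum_χ]
    by_cases ha : a = 0
    · subst ha; simp
    · obtain ⟨i, hi⟩ := Function.ne_iff.1 ha
      rw [if_neg ha]
      exact Finset.prod_eq_zero (Finset.mem_univ i) (if_neg hi)

theorem χ_def (a b : ZMod 2) : χ a b = sgn (a * b) := rfl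

theorem χ_pi {ι : Type} [Fintype ι] [DecidableEq ι] {G : Type} [AddCommGroup G] [Fintype G]
    [DecidableEq G] [SignPairing G] (a b : ι → G) : χ a b = ∏ i, χ (a i) (b i) := rfl

theorem χ_bits {ι : Type} [Fintype ι] [DecidableEq ι] (a b : ι → ZMod 2) :
    χ a b = sgn (a ⬝ᵥ b) := by
  rw [dotProduct, sgn_sum]; rfl

section

variable {G : Type} [AddCommGroup G] [Fintype G] [DecidableEq G] [SignPairing G]

theorem χ_add_right (a b c : G) : χ a (b + c) = χ a b * χ a c := by
  rw [χ_comm, χ_add_left, χ_comm b, χ_comm c]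

theorem χ_zero_left (a : G) : χ 0 a = 1 := by
  rw [← χ_mul_self a a, ← χ_add_left, add_self]

theorem χ_zero_right (a : G) : χ a 0 = 1 := by rw [χ_comm, χ_zero_left]

theorem χ_mul_star (a b : G) : χ a b * star (χ a b) = 1 := by rw [star_χ, χ_mul_self]

theorem add_eq_iff (a b c : G) : a + b = c ↔ a = c + b := by
  constructor
  · rintro rfl; rw [add_assoc, add_self, add_zero]
  · rintro rfl; rw [add_assoc, add_self, add_zero]

theorem eq_add_iff (a b c : G) : a = b + c ↔ b = a + c := by
  rw [eq_comm, add_eq_iff]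

theorem add_add_cancel (a b : G) : a + b + b = a := by rw [add_assoc, add_self, add_zero]

/-- The Pauli operator `X^x Z^z`. -/
def pauli (x z : G) : Mat G := Matrix.of fun u v => if u = v + x then χ z v else 0

theorem pauli_apply (x z u v : G) : pauli x z u v = if u = v + x then χ z v else 0 := rfl

theorem pauli_zero : pauli (0 : G) 0 = 1 := by
  ext u v
  simp [pauli_apply, Matrix.one_apply, χ_zero_left]

theorem pauli_mul_apply {β : Type} (x z : G) (M : Matrix G β ℂ) (u : G) (b : β) :
    (pauli x z * M) u b = χ z (u + x) * M (u + x) b := by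
  rw [Matrix.mul_apply, Finset.sum_eq_single (u + x)]
  · simp [pauli_apply, add_add_cancel]
  · intro v _ hv
    rw [pauli_apply, if_neg, zero_mul]
    rw [eq_add_iff]; exact hv
  · simp

theorem mul_pauli_apply {β : Type} (x z : G) (M : Matrix β G ℂ) (b : β) (v : G) :
    (M * pauli x z) b v = M b (v + x) * χ z v := by
  rw [Matrix.mul_apply, Finset.sum_eq_single (v + x)]
  · simp [pauli_apply]
  · intro u _ hu
    rw [pauli_apply, if_neg hu, mul_zero]
  · simp

theorem pauli_mul (x z x' z' : G) :
    pauli x z * pauli x' z' = χ z x' • pauli (x + x') (z + z') := by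
  ext u v
  rw [mul_pauli_apply, pauli_apply, Matrix.smul_apply, pauli_apply, smul_eq_mul]
  rw [add_right_comm v x' x, ← add_assoc v]
  split_ifs
  · rw [χ_add_right, χ_add_left]; ring
  · simp

theorem pauli_mul_self (x z : G) : pauli x z * pauli x z = χ z x • (1 : Mat G) := by
  rw [pauli_mul, add_self, add_self, pauli_zero]

theorem pauli_conjTranspose (x z : G) : (pauli x z).conjTranspose = χ z x • pauli x z := by
  ext u v
  rw [Matrix.conjTranspose_apply, Matrix.smul_apply, pauli_apply, pauli_apply, smul_eq_mul]
  by_cases h : v = u + x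
  · rw [if_pos h, if_pos ((eq_add_iff _ _ _).1 h), h, star_χ, χ_add_right]
    rw [mul_left_comm, χ_mul_self, mul_one]
  · rw [if_neg h, if_neg (fun h' => h ((eq_add_iff _ _ _).1 h'))]; simp

theorem pauli_isometry (x z : G) : (pauli x z).conjTranspose * pauli x z = 1 := by
  rw [pauli_conjTranspose, Matrix.smul_mul, pauli_mul_self, smul_smul, χ_mul_self, one_smul]

/-- Paulis commute up to a sign. -/
theorem pauli_mul_comm (x z x' z' : G) :
    pauli x z * pauli x' z' = (χ z x' * χ z' x) • (pauli x' z' * pauli x z) := by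
  rw [pauli_mul, pauli_mul, smul_smul, add_comm x, add_comm z, mul_assoc, χ_mul_self, mul_one]

/-- The Hadamard transform: on a register of qubits, the Hadamard gate on every qubit. -/
def had (G : Type) [AddCommGroup G] [Fintype G] [DecidableEq G] [SignPairing G] : Mat G :=
  Matrix.of fun a b => ((Real.sqrt (Fintype.card G) : ℝ) : ℂ)⁻¹ * χ a b

theorem had_apply (a b : G) : had G a b = ((Real.sqrt (Fintype.card G) : ℝ) : ℂ)⁻¹ * χ a b := rfl

theorem had_mul_pauli (x z : G) : had G * pauli x z = χ x z • (pauli z x * had G) := by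
  ext u v
  rw [mul_pauli_apply, Matrix.smul_apply, pauli_mul_apply, had_apply, had_apply, smul_eq_mul,
    χ_add_right, χ_add_left, χ_add_right, χ_comm u x]
  linear_combination (- ((Real.sqrt (Fintype.card G) : ℝ) : ℂ)⁻¹ * χ u v * χ x u * χ z v) *
    χ_mul_self x z

theorem had_conjTranspose : (had G).conjTranspose = had G := by
  ext u v
  rw [Matrix.conjTranspose_apply, had_apply, had_apply, star_mul', star_χ, χ_comm]
  congr 1
  simp

theorem sqrt_card_sq (G : Type) [Fintype G] :
    ((Real.sqrt (Fintype.card G) : ℝ) : ℂ) * ((Real.sqrt (Fintype.card G) : ℝ) : ℂ) =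
      Fintype.card G := by
  rw [← Complex.ofReal_mul, Real.mul_self_sqrt (Nat.cast_nonneg _)]; simp

theorem card_ne_zero' : (Fintype.card G : ℂ) ≠ 0 := by
  have : 0 < Fintype.card G := Fintype.card_pos_iff.2 ⟨0⟩
  exact_mod_cast this.ne'

theorem had_isometry : (had G).conjTranspose * had G = 1 := by
  rw [had_conjTranspose]
  ext u v
  rw [Matrix.mul_apply, Matrix.one_apply]
  have h : ∀ w, had G u w * had G w v = (Fintype.card G : ℂ)⁻¹ * χ (u + v) w := by
    intro w
    rw [had_apply, had_apply, ← sqrt_card_sq G, mul_inv, χ_add_left, χ_comm w v]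
    ring
  simp only [h]
  rw [← Finset.mul_sum, sum_χ]
  simp only [add_eq_iff, zero_add]
  split_ifs
  · exact inv_mul_cancel₀ card_ne_zero'
  · simp

theorem proj_mul_pauli (w x z : G) : proj w * pauli x z = pauli x z * proj (w + x) := by
  ext u v
  rw [mul_pauli_apply, pauli_mul_apply, proj, proj, Matrix.single_apply, Matrix.single_apply]
  by_cases h : w = u ∧ w = v + x
  · obtain ⟨rfl, h2⟩ := h
    rw [eq_add_iff] at h2
    simp [h2, add_add_cancel]
  · rw [if_neg h, if_neg, mul_zero, zero_mul]
    rintro ⟨h1, h2⟩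
    refine h ⟨?_, (eq_add_iff _ _ _).2 h2.symm⟩
    simpa using h1

end

/-! ### Tensor products and operators on one wire -/

section Tensor

variable {n : ℕ} {F G H : Type} 

theorem tensor_apply (K : Fin n → Matrix H G ℂ) (a : Fin n → H) (b : Fin n → G) :
    tensor K a b = ∏ i, K i (a i) (b i) := rfl

theorem tensor_mul [Fintype G] (K : Fin n → Matrix H G ℂ) (L : Fin n → Matrix G F ℂ) :
    tensor K * tensor L = tensor fun i => K i * L i := by
  ext a b
  rw [Matrix.mul_apply, tensor_apply]
  simp only [tensor_apply, Matrix.mul_apply]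
  rw [Finset.prod_univ_sum, Fintype.piFinset_univ]
  simp only [Finset.prod_mul_distrib]

theorem tensor_conjTranspose (K : Fin n → Matrix H G ℂ) :
    (tensor K).conjTranspose = tensor fun i => (K i).conjTranspose := by
  ext a b
  simp [Matrix.conjTranspose_apply, tensor_apply]

theorem tensor_smul (c : Fin n → ℂ) (K : Fin n → Matrix H G ℂ) :
    (tensor fun i => c i • K i) = (∏ i, c i) • tensor K := by
  ext a b
  simp [tensor_apply, Finset.prod_mul_distrib]

theorem tensor_one [DecidableEq G] : (tensor fun _ : Fin n => (1 : Mat G)) = 1 := by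
  ext a b
  simp only [tensor_apply, Matrix.one_apply]
  rw [Finset.prod_ite_zero]
  simp [funext_iff]

theorem tensor_eq_zero (K : Fin n → Matrix H G ℂ) (i : Fin n) (hi : K i = 0) : tensor K = 0 := by
  ext a b
  rw [tensor_apply]
  exact Finset.prod_eq_zero (Finset.mem_univ i) (by rw [hi]; rfl)

variable [DecidableEq G]

theorem applyAt_eq_tensor (i : Fin n) (M : Mat G) :
    applyAt i M = tensor (Function.update (fun _ => 1) i M) := by
  ext a b
  rw [tensor_apply, ← Finset.mul_prod_erase _ _ (Finset.mem_univ i), Function.update_self]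
  rw [Finset.prod_congr rfl (g := fun l => if a l = b l then (1 : ℂ) else 0)]
  · rw [Finset.prod_ite_zero]
    simp [applyAt]
  · intro l hl
    rw [Function.update_of_ne (Finset.ne_of_mem_erase hl), Matrix.one_apply]

theorem applyAt_one (i : Fin n) : applyAt i (1 : Mat G) = 1 := by
  rw [applyAt_eq_tensor, Function.update_eq_self, tensor_one]

theorem applyAt_sum {ι : Type} (i : Fin n) (s : Finset ι) (M : ι → Mat G) :
    applyAt i (∑ a ∈ s, M a) = ∑ a ∈ s, applyAt i (M a) := by
  ext a b
  simp only [applyAt, Matrix.sum_apply, Matrix.of_apply]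
  split_ifs <;> simp

variable [Fintype G]

theorem applyAt_mul_tensor (i : Fin n) (M : Mat G) (K : Fin n → Matrix G F ℂ) :
    applyAt i M * tensor K = tensor (Function.update K i (M * K i)) := by
  rw [applyAt_eq_tensor, tensor_mul]
  congr 1
  ext l : 1
  rcases eq_or_ne l i with rfl | h
  · simp
  · simp [h]

theorem tensor_mul_applyAt (i : Fin n) (M : Mat G) (K : Fin n → Matrix F G ℂ) :
    tensor K * applyAt i M = tensor (Function.update K i (K i * M)) := by
  rw [applyAt_eq_tensor, tensor_mul]
  congr 1
  ext l : 1
  rcases eq_or_ne l i with rfl | h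
  · simp
  · simp [h]

theorem applyAt_mul (i : Fin n) (M N : Mat G) :
    applyAt i M * applyAt i N = applyAt i (M * N) := by
  rw [applyAt_eq_tensor i N, applyAt_mul_tensor, applyAt_eq_tensor]
  simp

theorem applyAt_conjTranspose (i : Fin n) (M : Mat G) :
    (applyAt i M).conjTranspose = applyAt i M.conjTranspose := by
  rw [applyAt_eq_tensor, applyAt_eq_tensor, tensor_conjTranspose]
  congr 1
  ext l : 1
  rcases eq_or_ne l i with rfl | h
  · simp
  · simp [h]

end Tensor

/-! ### Transversal gates on tuples of registers -/

section Gates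

open SignPairing

variable {n : ℕ} {G : Type} [AddCommGroup G] [Fintype G] [DecidableEq G] [SignPairing G]

theorem tensor_pauli (x z : Fin n → G) :
    (tensor fun i => pauli (x i) (z i)) = pauli x z := by
  ext u v
  simp only [tensor_apply, pauli_apply]
  rw [Finset.prod_ite_zero, χ_pi]
  simp [funext_iff]

theorem pauli_mul_applyAt (x z : Fin n → G) (i : Fin n) (w : G) :
    applyAt i (proj w) * pauli x z = pauli x z * applyAt i (proj (w + x i)) := by
  rw [← tensor_pauli, applyAt_mul_tensor, tensor_mul_applyAt, proj_mul_pauli]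

theorem had_at_mul_pauli (x z : Fin n → G) (i : Fin n) :
    applyAt i (had G) * pauli x z = χ (x i) (z i) •
      (pauli (Function.update x i (z i)) (Function.update z i (x i)) * applyAt i (had G)) := by
  rw [← tensor_pauli, ← tensor_pauli, applyAt_mul_tensor, tensor_mul_applyAt, had_mul_pauli]
  have h : ∏ l, (Function.update (fun _ => 1) i (χ (x i) (z i)) : Fin n → ℂ) l = χ (x i) (z i) := by
    rw [Finset.prod_update_of_mem (Finset.mem_univ i)]; simp
  rw [← h, ← tensor_smul]
  congr 1
  ext l : 1
  rcases eq_or_ne l i with rfl | hl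
  · simp only [Function.update_self, h]
  · simp [hl]

/-- The action of CNOT on basis labels. -/
def addAt (i j : Fin n) (b : Fin n → G) : Fin n → G := Function.update b j (b i + b j)

theorem addAt_addAt {i j : Fin n} (h : i ≠ j) (b : Fin n → G) : addAt i j (addAt i j b) = b := by
  ext l
  rcases eq_or_ne l j with rfl | hl
  · simp [addAt, h, ← add_assoc, add_self]
  · simp [addAt, hl]

theorem addAt_eq_iff {i j : Fin n} (h : i ≠ j) (a b : Fin n → G) :
    a = addAt i j b ↔ b = addAt i j a := by
  constructor
  · rintro rfl; rw [addAt_addAt h]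
  · rintro rfl; rw [addAt_addAt h]

theorem cnot_apply (i j : Fin n) (a b : Fin n → G) :
    cnot i j a b = if a = addAt i j b then 1 else 0 := rfl

theorem cnot_mul_apply {β : Type} {i j : Fin n} (h : i ≠ j) (M : Matrix (Fin n → G) β ℂ)
    (a : Fin n → G) (b : β) : ((cnot i j : Mat (Fin n → G)) * M) a b = M (addAt i j a) b := by
  rw [Matrix.mul_apply, Finset.sum_eq_single (addAt i j a)]
  · simp [cnot_apply, addAt_addAt h]
  · intro c _ hc
    rw [cnot_apply, if_neg, zero_mul]
    rwa [addAt_eq_iff h]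
  · simp

theorem mul_cnot_apply {β : Type} (i j : Fin n) (M : Matrix β (Fin n → G) ℂ)
    (a : β) (b : Fin n → G) : (M * (cnot i j : Mat (Fin n → G))) a b = M a (addAt i j b) := by
  rw [Matrix.mul_apply, Finset.sum_eq_single (addAt i j b)]
  · simp [cnot_apply]
  · intro c _ hc
    rw [cnot_apply, if_neg hc, mul_zero]
  · simp

theorem cnot_mul_pauli {i j : Fin n} (h : i ≠ j) (x z : Fin n → G) :
    cnot i j * pauli x z = pauli (addAt i j x) (addAt j i z) * cnot i j := by
  ext a b
  rw [cnot_mul_apply h, mul_cnot_apply, pauli_apply, pauli_apply]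
  have h1 : addAt i j a = b + x ↔ a = addAt i j b + addAt i j x := by
    rw [show addAt i j b + addAt i j x = addAt i j (b + x) by
      ext l
      rcases eq_or_ne l j with rfl | hl
      · simp [addAt]; abel
      · simp [addAt, hl]]
    rw [addAt_eq_iff h, eq_comm]
  have h2 : χ z b = χ (addAt j i z) (addAt i j b) := by
    have key : ∀ (y c : Fin n → G), χ y c =
        χ (y i) (c i) * (χ (y j) (c j) * ∏ l ∈ (Finset.univ.erase i).erase j, χ (y l) (c l)) := by
      intro y c
      rw [Finset.mul_prod_erase _ (fun l => χ (y l) (c l)) (by simp [h.symm]),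
        Finset.mul_prod_erase _ (fun l => χ (y l) (c l)) (Finset.mem_univ i)]
      rfl
    rw [key z b, key]
    have h3 : ∏ l ∈ (Finset.univ.erase i).erase j, χ (addAt j i z l) (addAt i j b l) =
        ∏ l ∈ (Finset.univ.erase i).erase j, χ (z l) (b l) := by
      refine Finset.prod_congr rfl fun l hl => ?_
      simp only [Finset.mem_erase, Finset.mem_univ, and_true] at hl
      simp [addAt, hl.1, hl.2]
    rw [h3]
    simp only [addAt, Function.update_self, Function.update_of_ne h, Function.update_of_ne h.symm,
      χ_add_left, χ_add_right]
    linear_combination (-χ (z i) (b i) * χ (z j) (b j) *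
      ∏ l ∈ (Finset.univ.erase i).erase j, χ (z l) (b l)) * χ_mul_self (z j) (b i)
  simp only [h1, h2]

theorem cnot_isometry {i j : Fin n} (h : i ≠ j) :
    (cnot i j : Mat (Fin n → G)).conjTranspose * cnot i j = 1 := by
  ext a b
  rw [mul_cnot_apply, Matrix.conjTranspose_apply, cnot_apply, Matrix.one_apply]
  have : addAt i j b = addAt i j a ↔ a = b := by
    rw [addAt_eq_iff h, addAt_addAt h]
  simp only [this]
  split_ifs <;> simp

theorem cnot_mul_applyAt {i j l : Fin n} (h : i ≠ j) (hi : l ≠ i) (hj : l ≠ j) (M : Mat G) :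
    cnot i j * applyAt l M = applyAt l M * cnot i j := by
  ext a b
  rw [cnot_mul_apply h, mul_cnot_apply]
  have h1 : (∀ k, k ≠ l → addAt i j a k = b k) ↔ ∀ k, k ≠ l → a k = addAt i j b k := by
    constructor
    · intro hk k hkl
      rcases eq_or_ne k j with rfl | hkj
      · have e1 := hk k hkl
        have e2 := hk i hi.symm
        simp only [addAt, Function.update_self, Function.update_of_ne h] at e1 e2 ⊢
        rw [← e1, ← e2, ← add_assoc, add_self, zero_add]
      · have := hk k hkl
        simpa [addAt, hkj] using this
    · intro hk k hkl
      rcases eq_or_ne k j with rfl | hkj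
      · have e1 := hk k hkl
        have e2 := hk i hi.symm
        simp only [addAt, Function.update_self, Function.update_of_ne h] at e1 e2 ⊢
        rw [e1, e2, ← add_assoc, add_self, zero_add]
      · have := hk k hkl
        simpa [addAt, hkj] using this
  simp only [applyAt, Matrix.of_apply, h1]
  simp [addAt, hj]

end Gates

/-! ### Completely positive maps -/

section Maps

variable {α β γ : Type} [Fintype α] [Fintype β] [Fintype γ]

theorem conj_apply (K : Matrix β α ℂ) (M : Mat α) : conj K M = K * M * K.conjTranspose := rfl

theorem conj_mul (K : Matrix γ β ℂ) (L : Matrix β α ℂ) : conj (K * L) = conj K ∘ₗ conj L := by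
  ext M : 1
  simp [conj_apply, Matrix.conjTranspose_mul, Matrix.mul_assoc]

theorem conj_smul (c : ℂ) (K : Matrix β α ℂ) : conj (c • K) = (c * star c) • conj K := by
  ext M : 1
  simp [conj_apply, Matrix.conjTranspose_smul, smul_smul, mul_comm]

theorem conj_zero : conj (0 : Matrix β α ℂ) = 0 := by
  ext M : 1
  simp [conj_apply]

theorem conj_one [DecidableEq α] : conj (1 : Mat α) = LinearMap.id := by
  ext M : 1
  simp [conj_apply]

theorem krausMap_apply {ι : Type} [Fintype ι] (K : ι → Matrix β α ℂ) (M : Mat α) :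
    krausMap K M = ∑ i, conj (K i) M := by
  simp [krausMap]

theorem trace_conj (K : Matrix β α ℂ) (M : Mat α) :
    (conj K M).trace = (K.conjTranspose * K * M).trace := by
  rw [conj_apply, Matrix.trace_mul_comm, Matrix.mul_assoc]

theorem trace_conj_of_isometry [DecidableEq α] {K : Matrix β α ℂ} (h : K.conjTranspose * K = 1)
    (M : Mat α) : (conj K M).trace = M.trace := by
  rw [trace_conj, h, Matrix.one_mul]

end Maps

/-! ### Deferring measurements and Paulis to the end of a circuit -/

section Compile

variable {n : ℕ}

/-- The basis in which a list of gates measures each wire, `none` for unmeasured wires. -/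
def basisOf : List (Gate n) → Fin n → Option MeasBasis
  | [] => fun _ => none
  | Gate.X _ _ :: gs => basisOf gs
  | Gate.Z _ _ :: gs => basisOf gs
  | Gate.CNOT _ _ :: gs => basisOf gs
  | Gate.meas B i :: gs => Function.update (basisOf gs) i (some B)

/-- The possible lists of outcomes of a list of gates, extended by `0` to the unmeasured wires. -/
def outcomes (gs : List (Gate n)) : Finset (Fin n → ZMod 2) :=
  Fintype.piFinset fun i => if (basisOf gs i).isSome then Finset.univ else {0}

section Generic

variable (G : Type) [AddCommGroup G] [Fintype G] [DecidableEq G] [SignPairing G]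

/-- The unitary part of a list of gates: CNOTs, and Hadamard gates on the wires that are measured
in the Hadamard basis. -/
def unitaryPart : List (Gate n) → Mat (Fin n → G)
  | [] => 1
  | Gate.X _ _ :: gs => unitaryPart gs
  | Gate.Z _ _ :: gs => unitaryPart gs
  | Gate.CNOT i j :: gs => unitaryPart gs * cnot i j
  | Gate.meas MeasBasis.comp _ :: gs => unitaryPart gs
  | Gate.meas MeasBasis.had i :: gs => unitaryPart gs * applyAt i (had G)

variable {G}

/-- Exchanging the `X`- and the `Z`-part of a Pauli on wire `i`: the action of a Hadamard gate. -/
def swapAt (i : Fin n) (p : (Fin n → G) × (Fin n → G)) : (Fin n → G) × (Fin n → G) :=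
  (Function.update p.1 i (p.2 i), Function.update p.2 i (p.1 i))

/-- The action of `unitaryPart` on Paulis by conjugation. -/
def lin : List (Gate n) → (Fin n → G) × (Fin n → G) → (Fin n → G) × (Fin n → G)
  | [], p => p
  | Gate.X _ _ :: gs, p => lin gs p
  | Gate.Z _ _ :: gs, p => lin gs p
  | Gate.CNOT i j :: gs, p => lin gs (addAt i j p.1, addAt j i p.2)
  | Gate.meas MeasBasis.comp _ :: gs, p => lin gs p
  | Gate.meas MeasBasis.had i :: gs, p => lin gs (swapAt i p)

/-- The Pauli that results at the end of the circuit if the measurement outcomes are `α`, the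
initial Pauli is `p`, and the Paulis `X_i`, `Z_i` of the circuit are represented by the label `μ` on
wire `i`. -/
def frame (μ : G) (α : Fin n → ZMod 2) : List (Gate n) → (Fin n → ZMod 2) →
    (Fin n → G) × (Fin n → G) → (Fin n → G) × (Fin n → G)
  | [], _, p => p
  | Gate.X b i :: gs, r, p =>
      frame μ α gs r (p.1 + (if b r then Pi.single i μ else 0), p.2)
  | Gate.Z b i :: gs, r, p =>
      frame μ α gs r (p.1, p.2 + (if b r then Pi.single i μ else 0))
  | Gate.CNOT i j :: gs, r, p => frame μ α gs r (addAt i j p.1, addAt j i p.2)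
  | Gate.meas MeasBasis.comp i :: gs, r, p => frame μ α gs (Function.update r i (α i)) p
  | Gate.meas MeasBasis.had i :: gs, r, p =>
      frame μ α gs (Function.update r i (α i)) (swapAt i p)

theorem addAt_add (i j : Fin n) (a b : Fin n → G) :
    addAt i j (a + b) = addAt i j a + addAt i j b := by
  ext l
  rcases eq_or_ne l j with rfl | hl
  · simp [addAt]; abel
  · simp [addAt, hl]

theorem swapAt_add (i : Fin n) (p q : (Fin n → G) × (Fin n → G)) :
    swapAt i (p + q) = swapAt i p + swapAt i q := by
  simp [swapAt, Function.update_add]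

theorem swapAt_swapAt (i : Fin n) (p : (Fin n → G) × (Fin n → G)) :
    swapAt i (swapAt i p) = p := by
  simp [swapAt]

/-- The gates propagate Paulis linearly, and the Paulis of the circuit itself only add a
translation. -/
theorem frame_add (μ : G) (α : Fin n → ZMod 2) (gs : List (Gate n)) (r : Fin n → ZMod 2)
    (p q : (Fin n → G) × (Fin n → G)) :
    frame μ α gs r (p + q) = lin gs p + frame μ α gs r q := by
  induction gs generalizing r p q with
  | nil => rfl
  | cons g gs ih =>
    match g with
    | Gate.X b i =>
      rw [frame, frame, lin, ← ih]; congr 1; ext : 1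
      · exact add_assoc _ _ _
      · rfl
    | Gate.Z b i =>
      rw [frame, frame, lin, ← ih]; congr 1; ext : 1
      · rfl
      · exact add_assoc _ _ _
    | Gate.CNOT i j => rw [frame, frame, lin, ← ih]; congr 1; simp [addAt_add]
    | Gate.meas MeasBasis.comp i => rw [frame, frame, lin, ← ih]
    | Gate.meas MeasBasis.had i => rw [frame, frame, lin, ← ih, swapAt_add]

theorem lin_injective (gs : List (Gate n)) (hs : ∃ s, WellFormed s gs) :
    Function.Injective (lin (G := G) gs) := by
  obtain ⟨s, hs⟩ := hs
  induction gs generalizing s with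
  | nil => exact Function.injective_id
  | cons g gs ih =>
    match g with
    | Gate.X b i => exact ih _ hs.2
    | Gate.Z b i => exact ih _ hs.2
    | Gate.CNOT i j =>
      intro p q h
      have h1 := ih _ hs.2.2.2 h
      rw [Prod.mk.injEq] at h1
      ext1
      · rw [← addAt_addAt hs.1 p.1, h1.1, addAt_addAt hs.1]
      · rw [← addAt_addAt hs.1.symm p.2, h1.2, addAt_addAt hs.1.symm]
    | Gate.meas MeasBasis.comp i => exact ih _ hs.2
    | Gate.meas MeasBasis.had i =>
      intro p q h
      rw [← swapAt_swapAt i p, ih _ hs.2 h, swapAt_swapAt]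

/-- Frames are natural in the group of labels. -/
theorem frame_map {G' : Type} [AddCommGroup G'] [Fintype G'] [DecidableEq G'] [SignPairing G']
    (h : G →+ G') (μ : G) (α : Fin n → ZMod 2) (gs : List (Gate n)) (r : Fin n → ZMod 2)
    (p : (Fin n → G) × (Fin n → G)) :
    frame (h μ) α gs r (h ∘ p.1, h ∘ p.2) =
      (h ∘ (frame μ α gs r p).1, h ∘ (frame μ α gs r p).2) := by
  have hs : ∀ (c : Bool) (i : Fin n), (if c then Pi.single i (h μ) else 0 : Fin n → G') =
      h ∘ (if c then Pi.single i μ else 0) := by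
    intro c i
    ext l
    rcases eq_or_ne l i with rfl | hl <;> cases c <;> simp [*]
  have ha : ∀ (a b : Fin n → G), h ∘ a + h ∘ b = h ∘ (a + b) := fun a b => by
    ext l; simp
  induction gs generalizing r p with
  | nil => rfl
  | cons g gs ih =>
    match g with
    | Gate.X b i => rw [frame, frame, ← ih, hs, ha]
    | Gate.Z b i => rw [frame, frame, ← ih, hs, ha]
    | Gate.CNOT i j =>
      rw [frame, frame, ← ih]; congr 2 <;> simp [addAt, Function.comp_update]
    | Gate.meas MeasBasis.comp i => rw [frame, frame, ← ih]
    | Gate.meas MeasBasis.had i =>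
      rw [frame, frame, ← ih]; congr 1; simp [swapAt, Function.comp_update]

variable {s : Finset (Fin n)} {gs : List (Gate n)} {i : Fin n}

theorem basisOf_eq_none (hs : WellFormed s gs) (hi : i ∈ s) : basisOf gs i = none := by
  induction gs generalizing s with
  | nil => rfl
  | cons g gs ih =>
    match g with
    | Gate.X b j => exact ih hs.2 hi
    | Gate.Z b j => exact ih hs.2 hi
    | Gate.CNOT j k => exact ih hs.2.2.2 hi
    | Gate.meas B j =>
      have hj : i ≠ j := fun h => hs.1 (h ▸ hi)
      rw [basisOf, Function.update_of_ne hj]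
      exact ih hs.2 (Finset.mem_insert_of_mem hi)

/-- Later gates do not change the Pauli on a wire that is already measured. -/
theorem frame_fixed (hs : WellFormed s gs) (hi : i ∈ s) (μ : G) (α r : Fin n → ZMod 2)
    (p : (Fin n → G) × (Fin n → G)) :
    (frame μ α gs r p).1 i = p.1 i ∧ (frame μ α gs r p).2 i = p.2 i := by
  induction gs generalizing s r p with
  | nil => exact ⟨rfl, rfl⟩
  | cons g gs ih =>
    match g with
    | Gate.X b j =>
      have hj : i ≠ j := fun h => hs.1 (h ▸ hi)
      refine ⟨(ih hs.2 hi _ _).1.trans ?_, (ih hs.2 hi _ _).2⟩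
      split_ifs <;> simp [hj]
    | Gate.Z b j =>
      have hj : i ≠ j := fun h => hs.1 (h ▸ hi)
      refine ⟨(ih hs.2 hi _ _).1, (ih hs.2 hi _ _).2.trans ?_⟩
      split_ifs <;> simp [hj]
    | Gate.CNOT j k =>
      have hj : i ≠ j := fun h => hs.2.1 (h ▸ hi)
      have hk : i ≠ k := fun h => hs.2.2.1 (h ▸ hi)
      refine ⟨(ih hs.2.2.2 hi _ _).1.trans ?_, (ih hs.2.2.2 hi _ _).2.trans ?_⟩ <;>
        simp [addAt, hj, hk]
    | Gate.meas MeasBasis.comp j => exact ih hs.2 (Finset.mem_insert_of_mem hi) _ _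
    | Gate.meas MeasBasis.had j =>
      have hj : i ≠ j := fun h => hs.1 (h ▸ hi)
      have h := ih hs.2 (Finset.mem_insert_of_mem hi) (Function.update r j (α j)) (swapAt j p)
      refine ⟨h.1.trans ?_, h.2.trans ?_⟩ <;> simp [swapAt, hj]

/-- Once a wire is measured, later gates read its outcome from the record and not from `α`. -/
theorem frame_update (hs : WellFormed s gs) (hi : i ∈ s) (μ : G) (α r : Fin n → ZMod 2)
    (a : ZMod 2) (p : (Fin n → G) × (Fin n → G)) :
    frame μ (Function.update α i a) gs r p = frame μ α gs r p := by
  induction gs generalizing s r p with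
  | nil => rfl
  | cons g gs ih =>
    match g with
    | Gate.X b j => exact ih hs.2 hi _ _
    | Gate.Z b j => exact ih hs.2 hi _ _
    | Gate.CNOT j k => exact ih hs.2.2.2 hi _ _
    | Gate.meas MeasBasis.comp j =>
      have hj : j ≠ i := fun h => hs.1 (h ▸ hi)
      rw [frame, frame, Function.update_of_ne hj,
        ih hs.2 (Finset.mem_insert_of_mem hi)]
    | Gate.meas MeasBasis.had j =>
      have hj : j ≠ i := fun h => hs.1 (h ▸ hi)
      rw [frame, frame, Function.update_of_ne hj,
        ih hs.2 (Finset.mem_insert_of_mem hi)]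

/-- Operators on measured wires commute with the rest of the circuit, so that the measurement can be
deferred to the end. -/
theorem unitaryPart_mul_applyAt (hs : WellFormed s gs) (hi : i ∈ s) (M : Mat G) :
    unitaryPart G gs * applyAt i M = applyAt i M * unitaryPart G gs := by
  induction gs generalizing s with
  | nil => simp [unitaryPart]
  | cons g gs ih =>
    match g with
    | Gate.X b j => exact ih hs.2 hi
    | Gate.Z b j => exact ih hs.2 hi
    | Gate.CNOT j k =>
      have hj : i ≠ j := fun h => hs.2.1 (h ▸ hi)
      have hk : i ≠ k := fun h => hs.2.2.1 (h ▸ hi)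
      rw [unitaryPart, Matrix.mul_assoc, cnot_mul_applyAt hs.1 hj hk, ← Matrix.mul_assoc,
        ih hs.2.2.2 hi, Matrix.mul_assoc]
    | Gate.meas MeasBasis.comp j => exact ih hs.2 (Finset.mem_insert_of_mem hi)
    | Gate.meas MeasBasis.had j =>
      have hj : i ≠ j := fun h => hs.1 (h ▸ hi)
      have hc : applyAt j (had G) * applyAt i M = applyAt i M * applyAt j (had G) := by
        rw [applyAt_eq_tensor i, applyAt_mul_tensor, tensor_mul_applyAt]
        simp [hj.symm]
      rw [unitaryPart, Matrix.mul_assoc, hc, ← Matrix.mul_assoc,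
        ih hs.2 (Finset.mem_insert_of_mem hi), Matrix.mul_assoc]

theorem applyAt_had_isometry (i : Fin n) :
    (applyAt i (had G)).conjTranspose * applyAt i (had G) = 1 := by
  rw [applyAt_conjTranspose, applyAt_mul, had_isometry, applyAt_one]

theorem unitaryPart_isometry (hs : WellFormed s gs) :
    (unitaryPart G gs).conjTranspose * unitaryPart G gs = 1 := by
  have key : ∀ A B : Mat (Fin n → G), A.conjTranspose * A = 1 → B.conjTranspose * B = 1 →
      (A * B).conjTranspose * (A * B) = 1 := by
    intro A B hA hB
    rw [Matrix.conjTranspose_mul, Matrix.mul_assoc, ← Matrix.mul_assoc _ A, hA, Matrix.one_mul, hB]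
  induction gs generalizing s with
  | nil => simp [unitaryPart]
  | cons g gs ih =>
    match g with
    | Gate.X b j => exact ih hs.2
    | Gate.Z b j => exact ih hs.2
    | Gate.CNOT j k => exact key _ _ (ih hs.2.2.2) (cnot_isometry hs.1)
    | Gate.meas MeasBasis.comp j => exact ih hs.2
    | Gate.meas MeasBasis.had j => exact key _ _ (ih hs.2) (applyAt_had_isometry j)

theorem unitaryPart_mul_pauli (hs : WellFormed s gs) (p : (Fin n → G) × (Fin n → G)) :
    ∃ c : ℂ, c * star c = 1 ∧ unitaryPart G gs * pauli p.1 p.2 =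
      c • (pauli (lin gs p).1 (lin gs p).2 * unitaryPart G gs) := by
  induction gs generalizing s p with
  | nil => exact ⟨1, by simp, by simp [unitaryPart, lin]⟩
  | cons g gs ih =>
    match g with
    | Gate.X b j => exact ih hs.2 p
    | Gate.Z b j => exact ih hs.2 p
    | Gate.CNOT j k =>
      obtain ⟨c, hc, h⟩ := ih hs.2.2.2 (addAt j k p.1, addAt k j p.2)
      refine ⟨c, hc, ?_⟩
      rw [unitaryPart, Matrix.mul_assoc, cnot_mul_pauli hs.1, ← Matrix.mul_assoc, h,
        Matrix.smul_mul, Matrix.mul_assoc]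
      rfl
    | Gate.meas MeasBasis.comp j => exact ih hs.2 p
    | Gate.meas MeasBasis.had j =>
      obtain ⟨c, hc, h⟩ := ih hs.2 (swapAt j p)
      refine ⟨χ (p.1 j) (p.2 j) * c, ?_, ?_⟩
      · rw [star_mul', mul_mul_mul_comm, hc, χ_mul_star, mul_one]
      rw [unitaryPart, Matrix.mul_assoc, had_at_mul_pauli, Matrix.mul_smul, ← Matrix.mul_assoc]
      change χ (p.1 j) (p.2 j) • (unitaryPart G gs * pauli (swapAt j p).1 (swapAt j p).2 * _) = _
      rw [h, Matrix.smul_mul, Matrix.mul_assoc, smul_smul]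
      rfl

end Generic

theorem mem_outcomes (gs : List (Gate n)) (α : Fin n → ZMod 2) :
    α ∈ outcomes gs ↔ ∀ i, basisOf gs i = none → α i = 0 := by
  rw [outcomes, Fintype.mem_piFinset]
  refine forall_congr' fun i => ?_
  cases h : basisOf gs i <;> simp

theorem sum_outcomes_meas {M : Type} [AddCommMonoid M] {gs : List (Gate n)} {i : Fin n}
    (hi : basisOf gs i = none) (B : MeasBasis) (f : (Fin n → ZMod 2) → M) :
    ∑ α ∈ outcomes (Gate.meas B i :: gs), f α =
      ∑ a, ∑ α ∈ outcomes gs, f (Function.update α i a) := by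
  rw [← Finset.sum_product']
  refine Finset.sum_bij' (fun α _ => (α i, Function.update α i 0))
    (fun q _ => Function.update q.2 i q.1) ?_ ?_ ?_ ?_ ?_
  · intro α hα
    rw [mem_outcomes] at hα
    rw [Finset.mem_product, mem_outcomes]
    refine ⟨Finset.mem_univ _, fun l hl => ?_⟩
    rcases eq_or_ne l i with rfl | hli
    · simp
    · simp only [Function.update_of_ne hli]
      exact hα l (by rw [basisOf, Function.update_of_ne hli, hl])
  · intro q hq
    rw [Finset.mem_product, mem_outcomes] at hq
    rw [mem_outcomes]
    intro l hl
    rcases eq_or_ne l i with rfl | hli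
    · simp [basisOf] at hl
    · rw [basisOf, Function.update_of_ne hli] at hl
      rw [Function.update_of_ne hli]
      exact hq.2 l hl
  · intro α _; simp
  · intro q hq
    rw [Finset.mem_product, mem_outcomes] at hq
    ext1
    · simp
    · simp only [Function.update_idem]
      rw [← hq.2 i hi, Function.update_eq_self]
  · intro α _; simp

end Compile

/-! ### Circuits with faulty recording of outcomes -/

section Noisy

variable {n : ℕ}

/-- The quantum operation of a list of gates if each outcome of wire `i` is recorded with an
error `e i`. Only the classical controls of later Paulis see the recorded value. -/
def runNoisy (e : Fin n → ZMod 2) : List (Gate n) → (Fin n → ZMod 2) →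
    (Mat (Fin n → ZMod 2) →ₗ[ℂ] Mat (Fin n → ZMod 2))
  | [], _ => LinearMap.id
  | Gate.X b i :: gs, r => runNoisy e gs r ∘ₗ conj (if b r then pauliX (Pi.single i 1) else 1)
  | Gate.Z b i :: gs, r => runNoisy e gs r ∘ₗ conj (if b r then pauliZ (Pi.single i 1) else 1)
  | Gate.CNOT i j :: gs, r => runNoisy e gs r ∘ₗ conj (cnot i j)
  | Gate.meas basis i :: gs, r =>
      ∑ a : ZMod 2, runNoisy e gs (Function.update r i (a + e i)) ∘ₗ conj (measKraus basis i a)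

theorem runNoisy_zero (gs : List (Gate n)) (r : Fin n → ZMod 2) :
    runNoisy 0 gs r = runGates gs r := by
  induction gs generalizing r with
  | nil => rfl
  | cons g gs ih => cases g <;> simp [runNoisy, runGates, ih]

theorem pauliX_eq {ι : Type} [Fintype ι] [DecidableEq ι] (x : ι → ZMod 2) :
    pauliX x = pauli x 0 := by
  ext u v; simp [pauliX, pauli, χ_zero_left]

theorem pauliZ_eq {ι : Type} [Fintype ι] [DecidableEq ι] (z : ι → ZMod 2) :
    pauliZ z = pauli 0 z := by
  ext u v
  rw [pauliZ, Matrix.diagonal_apply, pauli_apply, add_zero, χ_bits]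
  split_ifs with h
  · rw [h]
  · rfl

theorem ctrl_X (b : Bool) (i : Fin n) :
    (if b then pauliX (Pi.single i 1) else 1 : Mat (Fin n → ZMod 2)) =
      pauli (if b then Pi.single i 1 else 0) 0 := by
  cases b
  · simp [pauli_zero]
  · simp [pauliX_eq]

theorem ctrl_Z (b : Bool) (i : Fin n) :
    (if b then pauliZ (Pi.single i 1) else 1 : Mat (Fin n → ZMod 2)) =
      pauli 0 (if b then Pi.single i 1 else 0) := by
  cases b
  · simp [pauli_zero]
  · simp [pauliZ_eq]

theorem hadamard₁_eq : hadamard₁ = had (ZMod 2) := by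
  ext a b
  rw [had_apply, χ_def]
  simp [hadamard₁]

theorem hadamard_eq (ι : Type) [Fintype ι] [DecidableEq ι] : hadamard ι = had (ι → ZMod 2) := by
  ext a b
  rw [had_apply, χ_bits, hadamard]
  simp only [Matrix.of_apply, Fintype.card_pi, ZMod.card, Finset.prod_const, Finset.card_univ]
  congr 2
  push_cast
  rw [Real.sqrt_eq_rpow, Real.sqrt_eq_rpow, ← Real.rpow_natCast_mul (by norm_num), mul_comm,
    Real.rpow_mul_natCast (by norm_num)]
  push_cast
  rfl

theorem sum_proj {G : Type} [Fintype G] [DecidableEq G] : ∑ a : G, (proj a : Mat G) = 1 := by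
  ext u v
  rw [Matrix.sum_apply, Matrix.one_apply, Finset.sum_eq_single u]
  · simp [proj, Matrix.single_apply]
  · intro a _ ha; simp [proj, ha]
  · simp

theorem proj_conjTranspose_mul {G : Type} [Fintype G] [DecidableEq G] (a : G) :
    (proj a : Mat G).conjTranspose * proj a = proj a := by
  simp [proj, Matrix.conjTranspose_single]

theorem sum_trace_proj {G : Type} [Fintype G] [DecidableEq G] (i : Fin n) (M : Mat (Fin n → G)) :
    ∑ a, (conj (applyAt i (proj a)) M).trace = M.trace := by
  simp only [trace_conj, applyAt_conjTranspose, applyAt_mul, proj_conjTranspose_mul]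
  rw [← Matrix.trace_sum, ← Finset.sum_mul, ← applyAt_sum, sum_proj, applyAt_one, Matrix.one_mul]

theorem measKraus_comp (i : Fin n) (a : ZMod 2) :
    measKraus MeasBasis.comp i a = applyAt i (proj a) := rfl

theorem measKraus_had (i : Fin n) (a : ZMod 2) :
    measKraus MeasBasis.had i a = applyAt i (proj a) * applyAt i (had (ZMod 2)) := by
  rw [measKraus, applyAt_mul, hadamard₁_eq]

theorem trace_runNoisy (e : Fin n → ZMod 2) {s : Finset (Fin n)} {gs : List (Gate n)}
    (hs : WellFormed s gs) (r : Fin n → ZMod 2) (M : Mat (Fin n → ZMod 2)) :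
    (runNoisy e gs r M).trace = M.trace := by
  induction gs generalizing s r M with
  | nil => rfl
  | cons g gs ih =>
    match g with
    | Gate.X b i =>
      rw [runNoisy, LinearMap.comp_apply, ih hs.2, ctrl_X, trace_conj_of_isometry]
      exact pauli_isometry _ _
    | Gate.Z b i =>
      rw [runNoisy, LinearMap.comp_apply, ih hs.2, ctrl_Z, trace_conj_of_isometry]
      exact pauli_isometry _ _
    | Gate.CNOT i j =>
      rw [runNoisy, LinearMap.comp_apply, ih hs.2.2.2, trace_conj_of_isometry]
      exact cnot_isometry hs.1
    | Gate.meas MeasBasis.comp i =>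
      rw [runNoisy, LinearMap.sum_apply, Matrix.trace_sum]
      simp only [LinearMap.comp_apply, ih hs.2, measKraus_comp]
      exact sum_trace_proj i M
    | Gate.meas MeasBasis.had i =>
      rw [runNoisy, LinearMap.sum_apply, Matrix.trace_sum]
      simp only [LinearMap.comp_apply, ih hs.2, measKraus_had, conj_mul]
      rw [sum_trace_proj i, trace_conj_of_isometry]
      exact applyAt_had_isometry i

/-- Projections of the measured wires onto basis states. -/
def projAll (bs : Fin n → Option MeasBasis) (β : Fin n → ZMod 2) : Mat (Fin n → ZMod 2) :=
  tensor fun i => if (bs i).isSome then proj (β i) else 1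

theorem projAll_mul_applyAt {bs : Fin n → Option MeasBasis} {i : Fin n} (hi : bs i = none)
    (B : MeasBasis) (β : Fin n → ZMod 2) (a : ZMod 2) (ha : β i = a) :
    projAll bs β * applyAt i (proj a) = projAll (Function.update bs i (some B)) β := by
  rw [projAll, tensor_mul_applyAt, projAll]
  congr 1
  ext l : 1
  rcases eq_or_ne l i with rfl | hl
  · simp [hi, ha]
  · simp [hl]

theorem conj_pauli_comp_pauli {G : Type} [AddCommGroup G] [Fintype G] [DecidableEq G]
    [SignPairing G] (x z x' z' : G) :
    conj (pauli x z) ∘ₗ conj (pauli x' z') = conj (pauli (x + x') (z + z')) := by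
  rw [← conj_mul, pauli_mul, conj_smul, χ_mul_star, one_smul]

theorem projAll_congr {bs : Fin n → Option MeasBasis} {i : Fin n} (hi : bs i = none)
    (β : Fin n → ZMod 2) (a : ZMod 2) : projAll bs (Function.update β i a) = projAll bs β := by
  rw [projAll, projAll]
  congr 1
  ext l : 1
  rcases eq_or_ne l i with rfl | hl
  · simp [hi]
  · simp [hl]

theorem sum_comp_left {U V W ι : Type} [AddCommMonoid U] [AddCommMonoid V] [AddCommMonoid W]
    [Module ℂ U] [Module ℂ V] [Module ℂ W] (t : Finset ι) (f : ι → V →ₗ[ℂ] W) (g : U →ₗ[ℂ] V) :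
    (∑ i ∈ t, f i) ∘ₗ g = ∑ i ∈ t, f i ∘ₗ g := by
  ext x; simp

/-- The normal form of a circuit: a sum over outcomes, where first the unitary part is applied, then
a Pauli that depends on the recorded outcomes, and finally the projections of the measured wires. -/
theorem runNoisy_comp_pauli (e : Fin n → ZMod 2) {s : Finset (Fin n)} {gs : List (Gate n)}
    (hs : WellFormed s gs) (r : Fin n → ZMod 2) (p : (Fin n → ZMod 2) × (Fin n → ZMod 2)) :
    runNoisy e gs r ∘ₗ conj (pauli p.1 p.2) = ∑ α ∈ outcomes gs,
      conj (projAll (basisOf gs) (α + e) *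
        (pauli (frame 1 α gs r p).1 (frame 1 α gs r p).2 * unitaryPart (ZMod 2) gs)) := by
  have hm : ∀ (s : Finset (Fin n)) (gs : List (Gate n)) (i : Fin n) (B : MeasBasis) (r : Fin n →
      ZMod 2)
      (q : (Fin n → ZMod 2) × (Fin n → ZMod 2)),
      i ∉ s → WellFormed (insert i s) gs →
      (∀ r', runNoisy e gs r' ∘ₗ conj (pauli q.1 q.2) = ∑ α ∈ outcomes gs,
        conj (projAll (basisOf gs) (α + e) *
          (pauli (frame 1 α gs r' q).1 (frame 1 α gs r' q).2 * unitaryPart (ZMod 2) gs))) →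
      ∑ a : ZMod 2, runNoisy e gs (Function.update r i (a + e i)) ∘ₗ
          conj (applyAt i (proj a) * pauli q.1 q.2) =
        ∑ α ∈ outcomes (Gate.meas B i :: gs),
          conj (projAll (basisOf (Gate.meas B i :: gs)) (α + e) *
            (pauli (frame 1 α gs (Function.update r i (α i)) q).1
              (frame 1 α gs (Function.update r i (α i)) q).2 * unitaryPart (ZMod 2) gs)) := by
    intro s gs i B r q hi hw ih
    have hb := basisOf_eq_none hw (Finset.mem_insert_self i s)
    rw [sum_outcomes_meas hb]
    refine Fintype.sum_equiv (Equiv.addRight (e i)) _ _ fun a => ?_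
    simp only [Equiv.coe_addRight, Function.update_self]
    rw [pauli_mul_applyAt, conj_mul, ← LinearMap.comp_assoc, ih, sum_comp_left]
    refine Finset.sum_congr rfl fun α _ => ?_
    rw [← conj_mul, frame_update hw (Finset.mem_insert_self i s)]
    have hf := (frame_fixed hw (Finset.mem_insert_self i s) 1 α
      (Function.update r i (a + e i)) q).1
    congr 1
    simp only [Matrix.mul_assoc]
    rw [unitaryPart_mul_applyAt hw (Finset.mem_insert_self i s),
      ← Matrix.mul_assoc (pauli _ _) (applyAt i _)]
    rw [show a + q.1 i = a + (frame 1 α gs (Function.update r i (a + e i)) q).1 i by rw [hf],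
      ← pauli_mul_applyAt, Matrix.mul_assoc, ← Matrix.mul_assoc, basisOf]
    congr 1
    rw [← projAll_mul_applyAt hb B (Function.update α i (a + e i) + e) a
      (by simp [add_add_cancel])]
    congr 1
    have : Function.update α i (a + e i) + e = Function.update (α + e) i a := by
      ext l
      rcases eq_or_ne l i with rfl | hl
      · simp [add_add_cancel]
      · simp [hl]
    rw [this, projAll_congr hb]
  induction gs generalizing s r p with
  | nil =>
    have h : outcomes ([] : List (Gate n)) = {0} := by
      ext α; rw [mem_outcomes]; simp [basisOf, funext_iff]
    rw [h, Finset.sum_singleton]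
    simp [runNoisy, unitaryPart, frame, projAll, basisOf, tensor_one]
  | cons g gs ih =>
    match g with
    | Gate.X b i =>
      rw [runNoisy, ctrl_X, LinearMap.comp_assoc, conj_pauli_comp_pauli, zero_add, add_comm]
      exact ih hs.2 r (p.1 + _, p.2)
    | Gate.Z b i =>
      rw [runNoisy, ctrl_Z, LinearMap.comp_assoc, conj_pauli_comp_pauli, zero_add, add_comm]
      exact ih hs.2 r (p.1, p.2 + _)
    | Gate.CNOT i j =>
      rw [runNoisy, LinearMap.comp_assoc, ← conj_mul, cnot_mul_pauli hs.1, conj_mul,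
        ← LinearMap.comp_assoc, ih hs.2.2.2 r (addAt i j p.1, addAt j i p.2), sum_comp_left]
      refine Finset.sum_congr rfl fun α _ => ?_
      rw [← conj_mul, unitaryPart]
      simp only [Matrix.mul_assoc]
      rfl
    | Gate.meas MeasBasis.comp i =>
      rw [runNoisy, sum_comp_left]
      simp only [LinearMap.comp_assoc, measKraus_comp, ← conj_mul]
      exact hm _ gs i _ r p hs.1 hs.2 fun r' => ih hs.2 r' p
    | Gate.meas MeasBasis.had i =>
      rw [runNoisy, sum_comp_left]
      have h1 : ∀ a : ZMod 2, conj (measKraus MeasBasis.had i a) ∘ₗ conj (pauli p.1 p.2) =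
          conj (applyAt i (proj a) * pauli (swapAt i p).1 (swapAt i p).2) ∘ₗ
            conj (applyAt i (had (ZMod 2))) := by
        intro a
        rw [measKraus_had, ← conj_mul, Matrix.mul_assoc, had_at_mul_pauli, Matrix.mul_smul,
          conj_smul, χ_mul_star, one_smul, ← Matrix.mul_assoc, conj_mul]
        rfl
      simp only [LinearMap.comp_assoc, h1]
      simp only [← LinearMap.comp_assoc]
      rw [← sum_comp_left]
      have h2 := hm _ gs i MeasBasis.had r (swapAt i p) hs.1 hs.2 fun r' => ih hs.2 r' (swapAt i p)
      rw [h2, sum_comp_left]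
      refine Finset.sum_congr rfl fun α _ => ?_
      rw [← conj_mul, unitaryPart]
      simp only [Matrix.mul_assoc]
      rfl

end Noisy

theorem comp_sum_right {U V W ι : Type} [AddCommMonoid U] [AddCommMonoid V] [AddCommMonoid W]
    [Module ℂ U] [Module ℂ V] [Module ℂ W] (t : Finset ι) (f : ι → U →ₗ[ℂ] V) (g : V →ₗ[ℂ] W) :
    g ∘ₗ (∑ i ∈ t, f i) = ∑ i ∈ t, g ∘ₗ f i := by
  ext x; simp

/-! ### The normal form of verified decryption -/

section VerDec

variable {n m : ℕ} {Q : CSSCode m} (δ : Q.Decoder)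

/-- The group of traps that is checked when a wire is measured. -/
def trapGroup : MeasBasis → Fin 3
  | MeasBasis.comp => 1
  | MeasBasis.had => 2

/-- Checking the traps of group `g` and decoding, for a classical ciphertext `w` with key `k`. -/
def decodeAt (g : Fin 3) (π : Equiv.Perm (Fin 3 × Fin m)) (k w : Block m) : Option (ZMod 2) :=
  if ∀ j, (k + w) (π (g, j)) = 0 then
    some (δ.classicalDecode fun j => (k + w) (π (0, j))) else none

theorem verDecMeasurement_eq (π : Equiv.Perm (Fin 3 × Fin m)) (x z w : Block m) (B : MeasBasis) :
    verDecMeasurement δ π x z w B =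
      decodeAt δ (trapGroup B) π (match B with | .comp => x | .had => z) w := by
  cases B <;> rfl

/-- The classical ciphertext of a branch. -/
def ciphertext (τ : Branch m) : Block m := Sum.elim (fun _ => 0) id τ

/-- The Kraus operator of verified decryption on one wire that is measured in the basis `B` (if
any) with recorded outcome `a`, when the final one-time pad is `X^x Z^z` and `o` is the outcome of
an earlier measurement. -/
def wireOp (π : Equiv.Perm (Fin 3 × Fin m)) (B : Option MeasBasis) (x z : Block m)
    (o : Option (ZMod 2)) (a : ZMod 2) (τ : Branch m) : Matrix (ZMod 2) (Block m) ℂ :=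
  match B with
  | none => wireKraus δ π x z o τ
  | some B =>
    if decodeAt δ (trapGroup B) π x (ciphertext τ) = some a then wireKraus δ π x z (some a) τ
    else 0

/-- The Kraus operators of the accepting branch of verified decryption, starting from the classical
data `st`. -/
def decKraus (π : Equiv.Perm (Fin 3 × Fin m)) (st : DecState n m) (gs : List (Gate n))
    (t : Fin n → Branch m) : Matrix (Fin n → ZMod 2) (Fin n → Block m) ℂ :=
  match verDecGates δ π (fun i => ciphertext (t i)) st gs with
  | none => 0
  | some st => tensor fun i => wireKraus δ π (st.x i) (st.z i) (st.outcome i) (t i)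

theorem wireKraus_some (π : Equiv.Perm (Fin 3 × Fin m)) (x z x' z' : Block m) (a : ZMod 2)
    (τ : Branch m) : wireKraus δ π x z (some a) τ = wireKraus δ π x' z' (some a) τ := by
  cases τ <;> rfl

theorem decKraus_cons (π : Equiv.Perm (Fin 3 × Fin m)) (st st' : DecState n m) (g : Gate n)
    (gs : List (Gate n)) (t : Fin n → Branch m)
    (h : verDecGate δ π (fun i => ciphertext (t i)) st g = some st') :
    decKraus δ π st (g :: gs) t = decKraus δ π st' gs t := by
  rw [decKraus, verDecGates, h]; rfl

theorem decKraus_cons_none (π : Equiv.Perm (Fin 3 × Fin m)) (st : DecState n m) (g : Gate n)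
    (gs : List (Gate n)) (t : Fin n → Branch m)
    (h : verDecGate δ π (fun i => ciphertext (t i)) st g = none) :
    decKraus δ π st (g :: gs) t = 0 := by
  rw [decKraus, verDecGates, h]; rfl

theorem conj_decKraus (π : Equiv.Perm (Fin 3 × Fin m)) {s : Finset (Fin n)} {gs : List (Gate n)}
    (hs : WellFormed s gs) (st : DecState n m) (p : (Fin n → Block m) × (Fin n → Block m))
    (hp : ∀ i, i ∉ s → st.outcome i = none ∧ st.x i = p.1 i ∧ st.z i = p.2 i)
    (ho : ∀ i ∈ s, ∃ a, st.outcome i = some a) (t : Fin n → Branch m) :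
    conj (decKraus δ π st gs t) = ∑ α ∈ outcomes gs,
      conj (tensor fun i => wireOp δ π (basisOf gs i)
        ((frame (permuteBits π (dataMask m)) α gs st.record p).1 i)
        ((frame (permuteBits π (dataMask m)) α gs st.record p).2 i)
        (st.outcome i) (α i) (t i)) := by
  -- The case of a measurement, where `q` is the frame just after it.
  have hm : ∀ (s : Finset (Fin n)) (gs : List (Gate n)) (i : Fin n) (B : MeasBasis)
      (st : DecState n m) (q : (Fin n → Block m) × (Fin n → Block m)),
      i ∉ s → WellFormed (insert i s) gs → st.outcome i = none →
      (match B with | .comp => st.x i | .had => st.z i) = q.1 i →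
      (∀ a, conj (decKraus δ π { st with outcome := Function.update st.outcome i (some a) } gs t) =
        ∑ α ∈ outcomes gs, conj (tensor fun l => wireOp δ π (basisOf gs l)
        ((frame (permuteBits π (dataMask m)) α gs (Function.update st.record i a) q).1 l)
        ((frame (permuteBits π (dataMask m)) α gs (Function.update st.record i a) q).2 l)
        (Function.update st.outcome i (some a) l) (α l) (t l))) →
      conj (decKraus δ π st (Gate.meas B i :: gs) t) = ∑ α ∈ outcomes (Gate.meas B i :: gs),
        conj (tensor fun l => wireOp δ π (basisOf (Gate.meas B i :: gs) l)
        ((frame (permuteBits π (dataMask m)) α gs (Function.update st.record i (α i)) q).1 l)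
        ((frame (permuteBits π (dataMask m)) α gs (Function.update st.record i (α i)) q).2 l)
        (st.outcome l) (α l) (t l)) := by
    intro s gs i B st q hi hw hoi hq ih
    have hb := basisOf_eq_none hw (Finset.mem_insert_self i s)
    rw [sum_outcomes_meas hb]
    have hzero : ∀ a α, decodeAt δ (trapGroup B) π (q.1 i) (ciphertext (t i)) ≠ some a →
        (tensor fun l => wireOp δ π (basisOf (Gate.meas B i :: gs) l)
        ((frame (permuteBits π (dataMask m)) (Function.update α i a) gs
          (Function.update st.record i (Function.update α i a i)) q).1 l)
        ((frame (permuteBits π (dataMask m)) (Function.update α i a) gs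
          (Function.update st.record i (Function.update α i a i)) q).2 l)
        (st.outcome l) (Function.update α i a l) (t l)) = 0 := by
      intro a α hne
      refine tensor_eq_zero _ i ?_
      rw [(frame_fixed hw (Finset.mem_insert_self i s) _ _ _ _).1]
      simp only [basisOf, Function.update_self, wireOp]
      rw [if_neg hne]
    have hg : verDecGate δ π (fun i => ciphertext (t i)) st (Gate.meas B i) =
        (decodeAt δ (trapGroup B) π (q.1 i) (ciphertext (t i))).map fun a =>
          { st with outcome := Function.update st.outcome i (some a) } := by
      rw [verDecGate, verDecMeasurement_eq, hq]
    rcases hd : decodeAt δ (trapGroup B) π (q.1 i) (ciphertext (t i)) with _ | a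
    · rw [decKraus_cons_none δ π st _ gs t (by rw [hg, hd]; rfl), conj_zero]
      refine (Finset.sum_eq_zero fun a _ => Finset.sum_eq_zero fun α _ => ?_).symm
      rw [hzero a α (by rw [hd]; simp), conj_zero]
    · rw [decKraus_cons δ π st _ _ gs t (by rw [hg, hd]; rfl), Finset.sum_eq_single a]
      · rw [ih]
        refine Finset.sum_congr rfl fun α _ => ?_
        refine congrArg conj (congrArg tensor (funext fun l => ?_))
        rw [Function.update_self, frame_update hw (Finset.mem_insert_self i s)]
        rcases eq_or_ne l i with rfl | hl
        · simp only [basisOf, hb, Function.update_self, wireOp]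
          rw [(frame_fixed hw (Finset.mem_insert_self l s) _ _ _ _).1, if_pos hd]
        · simp [basisOf, hl]
      · intro a' _ ha'
        refine Finset.sum_eq_zero fun α _ => ?_
        rw [hzero a' α (by rw [hd]; simpa using ha'.symm), conj_zero]
      · simp
  have hrec : ∀ (st : DecState n m) (i : Fin n) (a : ZMod 2),
      ({ st with outcome := Function.update st.outcome i (some a) } : DecState n m).record =
        Function.update st.record i a := by
    intro st i a
    ext l
    rcases eq_or_ne l i with rfl | hl
    · simp [DecState.record]
    · simp [DecState.record, hl]
  induction gs generalizing s st p with
  | nil =>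
    have h : outcomes ([] : List (Gate n)) = {0} := by
      ext α; rw [mem_outcomes]; simp [basisOf, funext_iff]
    rw [h, Finset.sum_singleton]
    change conj (tensor fun i => wireKraus δ π (st.x i) (st.z i) (st.outcome i) (t i)) = _
    refine congrArg conj (congrArg tensor (funext fun i => ?_))
    change _ = wireKraus δ π (p.1 i) (p.2 i) (st.outcome i) (t i)
    by_cases hi : i ∈ s
    · obtain ⟨a, ha⟩ := ho i hi
      rw [ha]; exact wireKraus_some δ π _ _ _ _ _ _
    · rw [(hp i hi).2.1, (hp i hi).2.2]
  | cons g gs ih =>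
    match g with
    | Gate.X b i =>
      have hstep : verDecGate δ π (fun i => ciphertext (t i)) st (Gate.X b i) = some
          { st with x := st.x + (if b st.record then Pi.single i (permuteBits π (dataMask m))
            else 0) } := by
        rw [verDecGate]
        congr 1
        split_ifs
        · congr 1
          ext l : 1
          rcases eq_or_ne l i with rfl | hl
          · simp
          · simp [hl]
        · simp
      rw [decKraus_cons δ π st _ _ gs t hstep,
        show outcomes (Gate.X b i :: gs) = outcomes gs from rfl]
      simp only [basisOf, frame]
      refine ih hs.2 { st with x := _ } (_, p.2) (fun l hl => ⟨(hp l hl).1, ?_, (hp l hl).2.2⟩) ho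
      simp only [Pi.add_apply, (hp l hl).2.1]
    | Gate.Z b i =>
      have hstep : verDecGate δ π (fun i => ciphertext (t i)) st (Gate.Z b i) = some
          { st with z := st.z + (if b st.record then Pi.single i (permuteBits π (dataMask m))
            else 0) } := by
        rw [verDecGate]
        congr 1
        split_ifs
        · congr 1
          ext l : 1
          rcases eq_or_ne l i with rfl | hl
          · simp
          · simp [hl]
        · simp
      rw [decKraus_cons δ π st _ _ gs t hstep,
        show outcomes (Gate.Z b i :: gs) = outcomes gs from rfl]
      simp only [basisOf, frame]
      refine ih hs.2 { st with z := _ } (p.1, _) (fun l hl => ⟨(hp l hl).1, (hp l hl).2.1, ?_⟩) ho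
      simp only [Pi.add_apply, (hp l hl).2.2]
    | Gate.CNOT i j =>
      have hstep : verDecGate δ π (fun i => ciphertext (t i)) st (Gate.CNOT i j) = some
          { st with x := addAt i j st.x, z := addAt j i st.z } := by
        rw [verDecGate, addAt, addAt, add_comm (st.z i)]
      rw [decKraus_cons δ π st _ _ gs t hstep,
        show outcomes (Gate.CNOT i j :: gs) = outcomes gs from rfl]
      simp only [basisOf, frame]
      refine ih hs.2.2.2 { st with x := _, z := _ } (_, _)
        (fun l hl => ⟨(hp l hl).1, ?_, ?_⟩) ho
      · simp only [addAt, Function.update_apply, (hp l hl).2.1, (hp i hs.2.1).2.1,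
          (hp j hs.2.2.1).2.1]
      · simp only [addAt, Function.update_apply, (hp l hl).2.2, (hp i hs.2.1).2.2,
          (hp j hs.2.2.1).2.2]
    | Gate.meas B i =>
      have hout : ∀ a, ∀ l ∈ insert i s, ∃ a',
          Function.update st.outcome i (some a) l = some a' := by
        intro a l hl
        rcases eq_or_ne l i with rfl | hli
        · exact ⟨a, by simp⟩
        · rw [Function.update_of_ne hli]
          exact ho l (Finset.mem_of_mem_insert_of_ne hl hli)
      cases B with
      | comp =>
        refine hm s gs i _ st p hs.1 hs.2 (hp i hs.1).1 (hp i hs.1).2.1 fun a => ?_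
        rw [ih hs.2 _ p ?_ (hout a), hrec]
        intro l hl
        rw [Finset.mem_insert, not_or] at hl
        refine ⟨?_, (hp l hl.2).2⟩
        simp [hl.1, (hp l hl.2).1]
      | had =>
        refine hm s gs i _ st (swapAt i p) hs.1 hs.2 (hp i hs.1).1 ?_ fun a => ?_
        · simpa [swapAt] using (hp i hs.1).2.2
        rw [ih hs.2 _ (swapAt i p) ?_ (hout a), hrec]
        intro l hl
        rw [Finset.mem_insert, not_or] at hl
        refine ⟨?_, ?_⟩
        · simp [hl.1, (hp l hl.2).1]
        · simpa [swapAt, hl.1] using (hp l hl.2).2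

/-- The normal form of the accepting branch of verified decryption: a sum over the recorded
outcomes, in each of which all wires are decrypted independently with their final keys. -/
theorem verDecAcc_eq (k : TCKey n m) (c : Circuit n) :
    verDecAcc δ k c = traceOut c.out ∘ₗ ∑ α ∈ outcomes c.gates, ∑ t : Fin n → Branch m,
      conj (tensor fun i => wireOp δ k.1 (basisOf c.gates i)
        ((frame (permuteBits k.1 (dataMask m)) α c.gates 0 k.2).1 i)
        ((frame (permuteBits k.1 (dataMask m)) α c.gates 0 k.2).2 i)
        none (α i) (t i)) := by
  rw [verDecAcc, krausMap, Finset.sum_comm]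
  refine congrArg (fun F => traceOut c.out ∘ₗ F) ?_
  refine Finset.sum_congr rfl fun t _ => ?_
  exact conj_decKraus δ k.1 c.wf ⟨k.2.1, k.2.2, fun _ => none⟩ k.2
    (fun i _ => ⟨rfl, rfl, rfl⟩) (by simp) t

/-! ### Shifting the one-time pad, and dephasing of measured wires -/

/-- Translation of the classical ciphertext. -/
def shiftBranch (dx : Block m) : Branch m ≃ Branch m :=
  Equiv.sumCongr (Equiv.refl _) (Equiv.addRight dx)

theorem single_mul_pauli {G : Type} [AddCommGroup G] [Fintype G] [DecidableEq G] [SignPairing G]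
    {β : Type} [DecidableEq β] (a : β) (w x z : G) :
    Matrix.single a w (1 : ℂ) * pauli x z = χ z (w + x) • Matrix.single a (w + x) 1 := by
  ext u v
  rw [mul_pauli_apply, Matrix.smul_apply, Matrix.single_apply, Matrix.single_apply, smul_eq_mul]
  by_cases h : a = u ∧ w = v + x
  · rw [if_pos h, if_pos ⟨h.1, ((eq_add_iff _ _ _).1 h.2).symm⟩, h.2, add_add_cancel]; ring
  · rw [if_neg h, if_neg]
    · simp
    · rintro ⟨h1, h2⟩
      exact h ⟨h1, (eq_add_iff _ _ _).2 h2.symm⟩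

theorem pauli_add_conjTranspose_mul {G : Type} [AddCommGroup G] [Fintype G] [DecidableEq G]
    [SignPairing G] (x z dx dz : G) :
    (pauli (x + dx) (z + dz)).conjTranspose * pauli dx dz =
      χ dz x • (pauli x z).conjTranspose := by
  have h : pauli (x + dx) (z + dz) = χ dz x • (pauli dx dz * pauli x z) := by
    rw [pauli_mul, smul_smul, χ_mul_self, one_smul, add_comm x, add_comm z]
  rw [h, Matrix.conjTranspose_smul, star_χ, Matrix.conjTranspose_mul, Matrix.smul_mul,
    Matrix.mul_assoc, pauli_isometry, Matrix.mul_one]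

theorem pauliX_mul_pauliZ {ι : Type} [Fintype ι] [DecidableEq ι] (x z : ι → ZMod 2) :
    pauliX x * pauliZ z = pauli x z := by
  rw [pauliX_eq, pauliZ_eq, pauli_mul, χ_zero_left, one_smul, add_zero, zero_add]

theorem wireOp_shift (π : Equiv.Perm (Fin 3 × Fin m)) (B : Option MeasBasis) (x z dx dz : Block m)
    (a : ZMod 2) (τ : Branch m) : ∃ c : ℂ, c * star c = 1 ∧
      wireOp δ π B (x + dx) (z + dz) none a τ * pauli dx dz =
        c • wireOp δ π B x z none a (shiftBranch dx τ) := by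
  match B, τ with
  | none, Sum.inl s =>
    refine ⟨χ dz x, χ_mul_star _ _, ?_⟩
    change decBlock δ π (x + dx) (z + dz) s * _ = _ • decBlock δ π x z s
    rw [decBlock, decBlock, pauliX_mul_pauliZ, pauliX_mul_pauliZ, Matrix.mul_assoc,
      pauli_add_conjTranspose_mul, Matrix.mul_smul]
  | none, Sum.inr w =>
    refine ⟨1, by simp, ?_⟩
    change 0 * _ = _ • 0
    simp
  | some B, Sum.inl s =>
    refine ⟨1, by simp, ?_⟩
    have h : ∀ x z, wireOp δ π (some B) x z none a (Sum.inl s) = 0 := by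
      intro x z
      simp only [wireOp]
      split_ifs <;> rfl
    have h' : shiftBranch dx (Sum.inl s) = Sum.inl s := rfl
    rw [h', h, h]
    simp
  | some B, Sum.inr w =>
    refine ⟨χ dz (w + dx), χ_mul_star _ _, ?_⟩
    have h : ∀ x z w, wireOp δ π (some B) x z none a (Sum.inr w) =
        if decodeAt δ (trapGroup B) π x w = some a then Matrix.single a w 1 else 0 := by
      intro x z w
      rfl
    rw [shiftBranch, Equiv.sumCongr_apply, Sum.map_inr, h, h, Equiv.coe_addRight]
    have hd : decodeAt δ (trapGroup B) π (x + dx) w = decodeAt δ (trapGroup B) π x (w + dx) := by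
      rw [decodeAt, decodeAt, add_assoc, add_comm dx]
    rw [hd]
    split_ifs
    · exact single_mul_pauli _ _ _ _
    · simp

/-- Verified decryption removes a one-time pad with the updated key. -/
theorem verDecAcc_comp_pauli (π : Equiv.Perm (Fin 3 × Fin m))
    (p : (Fin n → Block m) × (Fin n → Block m)) (c : Circuit n) :
    verDecAcc δ (π, p) c ∘ₗ conj (pauli (lin c.gates p).1 (lin c.gates p).2) =
      verDecAcc δ (π, 0) c := by
  rw [verDecAcc_eq, verDecAcc_eq, LinearMap.comp_assoc, sum_comp_left]
  refine congrArg (fun F => traceOut c.out ∘ₗ F) ?_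
  refine Finset.sum_congr rfl fun α _ => ?_
  rw [sum_comp_left]
  have hf : frame (permuteBits π (dataMask m)) α c.gates 0 p =
      frame (permuteBits π (dataMask m)) α c.gates 0 0 + lin c.gates p := by
    rw [← add_zero p, frame_add, add_zero, add_comm]
  refine Fintype.sum_equiv (Equiv.piCongrRight fun i => shiftBranch ((lin c.gates p).1 i)) _ _
    fun t => ?_
  rw [← conj_mul, ← tensor_pauli, tensor_mul, hf]
  choose ph hph hw using fun i => wireOp_shift δ π (basisOf c.gates i)
    ((frame (permuteBits π (dataMask m)) α c.gates 0 0).1 i)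
    ((frame (permuteBits π (dataMask m)) α c.gates 0 0).2 i)
    ((lin c.gates p).1 i) ((lin c.gates p).2 i) (α i) (t i)
  rw [show (fun i => wireOp δ π (basisOf c.gates i)
      ((frame (permuteBits π (dataMask m)) α c.gates 0 0 + lin c.gates p).1 i)
      ((frame (permuteBits π (dataMask m)) α c.gates 0 0 + lin c.gates p).2 i) none (α i) (t i) *
        pauli ((lin c.gates p).1 i) ((lin c.gates p).2 i)) = _ from funext hw, tensor_smul,
    conj_smul, star_prod, ← Finset.prod_mul_distrib, Finset.prod_eq_one fun i _ => hph i, one_smul]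
  rfl

theorem wireOp_mul_proj (π : Equiv.Perm (Fin 3 × Fin m)) (B : MeasBasis) (x z : Block m)
    (a : ZMod 2) (τ : Branch m) (w : Block m) :
    wireOp δ π (some B) x z none a τ * proj w =
      if τ = Sum.inr w then wireOp δ π (some B) x z none a τ else 0 := by
  rcases τ with s | w'
  · have h : wireOp δ π (some B) x z none a (Sum.inl s) = 0 := by
      simp only [wireOp]
      split_ifs <;> rfl
    simp [h]
  · have h : wireOp δ π (some B) x z none a (Sum.inr w') =
        if decodeAt δ (trapGroup B) π x w' = some a then Matrix.single a w' 1 else 0 := rfl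
    rw [h, proj]
    by_cases hw : w' = w
    · subst hw
      split_ifs <;> simp_all
    · rw [if_neg (fun h => hw (Sum.inr_injective h))]
      split_ifs <;> simp [hw]

/-- Measured wires are read in the computational basis, so that dephasing them has no effect. -/
theorem verDecAcc_dephase (k : TCKey n m) (c : Circuit n) (i : Fin n)
    (hi : basisOf c.gates i ≠ none) :
    verDecAcc δ k c ∘ₗ (krausMap fun w : Block m => applyAt i (proj w)) = verDecAcc δ k c := by
  obtain ⟨B, hB⟩ := Option.ne_none_iff_exists'.1 hi
  rw [verDecAcc_eq, LinearMap.comp_assoc, sum_comp_left]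
  refine congrArg (fun F => traceOut c.out ∘ₗ F) ?_
  refine Finset.sum_congr rfl fun α _ => ?_
  rw [sum_comp_left]
  refine Finset.sum_congr rfl fun t _ => ?_
  rw [krausMap, comp_sum_right]
  simp only [← conj_mul, tensor_mul_applyAt]
  set K : Fin n → Matrix (ZMod 2) (Block m) ℂ := fun l => wireOp δ k.1 (basisOf c.gates l)
        ((frame (permuteBits k.1 (dataMask m)) α c.gates 0 k.2).1 l)
        ((frame (permuteBits k.1 (dataMask m)) α c.gates 0 k.2).2 l)
        none (α l) (t l) with hK
  have hKi : ∀ w, K i * proj w = if t i = Sum.inr w then K i else 0 := by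
    intro w
    simp only [hK]
    rw [hB]
    exact wireOp_mul_proj δ _ _ _ _ _ _ _
  have hcases : (∃ s, t i = Sum.inl s) ∨ ∃ w, t i = Sum.inr w := by
    rcases t i with s | w
    · exact Or.inl ⟨s, rfl⟩
    · exact Or.inr ⟨w, rfl⟩
  rcases hcases with ⟨s, ht⟩ | ⟨w, ht⟩
  · have h0 : tensor K = 0 := by
      refine tensor_eq_zero _ i ?_
      simp only [hK, hB, ht, wireOp]
      split_ifs <;> rfl
    rw [h0, conj_zero]
    refine Finset.sum_eq_zero fun w _ => ?_
    rw [tensor_eq_zero _ i (by rw [Function.update_self, hKi, ht, if_neg (by simp)]), conj_zero]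
  · rw [Finset.sum_eq_single w]
    · rw [hKi, ht, if_pos rfl, Function.update_eq_self]
    · intro w' _ hw'
      rw [tensor_eq_zero _ i (by
        rw [Function.update_self, hKi, ht, if_neg (by simpa using hw'.symm)]), conj_zero]
    · simp

theorem evalGates_eq_unitaryPart {W : Type} [AddCommMonoid W] [Module ℂ W]
    (D : Mat (Fin n → Block m) →ₗ[ℂ] W) {s : Finset (Fin n)} {gs : List (Gate n)}
    (hs : WellFormed s gs) (hD : ∀ i, basisOf gs i ≠ none →
      D ∘ₗ (krausMap fun w : Block m => applyAt i (proj w)) = D) :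
    D ∘ₗ evalGates gs = D ∘ₗ conj (unitaryPart (Block m) gs) := by
  have hstep : ∀ (s : Finset (Fin n)) (gs : List (Gate n)) (B : MeasBasis) (i : Fin n), i ∉ s →
      WellFormed (insert i s) gs → (∀ l, basisOf (Gate.meas B i :: gs) l ≠ none →
      D ∘ₗ (krausMap fun w : Block m => applyAt l (proj w)) = D) →
      (∀ l, basisOf gs l ≠ none → D ∘ₗ (krausMap fun w : Block m => applyAt l (proj w)) = D) ∧
      D ∘ₗ conj (unitaryPart (Block m) gs) ∘ₗ (krausMap fun w : Block m => applyAt i (proj w)) =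
        D ∘ₗ conj (unitaryPart (Block m) gs) := by
    intro s gs B i hi hw hD
    refine ⟨fun l hl => ?_, ?_⟩
    · refine hD l ?_
      rw [basisOf]
      rcases eq_or_ne l i with rfl | hli
      · simp
      · rwa [Function.update_of_ne hli]
    · have h1 : conj (unitaryPart (Block m) gs) ∘ₗ
          (krausMap fun w : Block m => applyAt i (proj w)) =
          (krausMap fun w : Block m => applyAt i (proj w)) ∘ₗ conj (unitaryPart (Block m) gs) := by
        rw [krausMap, comp_sum_right, sum_comp_left]
        refine Finset.sum_congr rfl fun w _ => ?_
        rw [← conj_mul, ← conj_mul, unitaryPart_mul_applyAt hw (Finset.mem_insert_self i s)]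
      rw [h1, ← LinearMap.comp_assoc, hD i (by simp [basisOf])]
  induction gs generalizing s with
  | nil => simp [evalGates, unitaryPart, conj_one]
  | cons g gs ih =>
    match g with
    | Gate.X b j => exact ih hs.2 hD
    | Gate.Z b j => exact ih hs.2 hD
    | Gate.CNOT j k =>
      rw [evalGates, evalGate, ← LinearMap.comp_assoc, ih hs.2.2.2 hD, unitaryPart, conj_mul]
      rfl
    | Gate.meas MeasBasis.comp i =>
      obtain ⟨h1, h2⟩ := hstep s gs _ i hs.1 hs.2 hD
      rw [evalGates, evalGate, ← LinearMap.comp_assoc, ih hs.2 h1, LinearMap.comp_assoc, h2]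
      rfl
    | Gate.meas MeasBasis.had i =>
      obtain ⟨h1, h2⟩ := hstep s gs _ i hs.1 hs.2 hD
      have h3 : (krausMap fun w : Block m => applyAt i (proj w * hadamard (Fin 3 × Fin m))) =
          (krausMap fun w : Block m => applyAt i (proj w)) ∘ₗ conj (applyAt i (had (Block m))) := by
        rw [krausMap, krausMap, sum_comp_left]
        refine Finset.sum_congr rfl fun w _ => ?_
        rw [← conj_mul, applyAt_mul, hadamard_eq]
      rw [evalGates, evalGate, ← LinearMap.comp_assoc, ih hs.2 h1, h3, unitaryPart, conj_mul,
        ← LinearMap.comp_assoc, ← LinearMap.comp_assoc, LinearMap.comp_assoc _ _ D, h2]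

end VerDec

/-! ### Orthogonality of binary codes -/

section Orthogonality

variable {ι : Type} [Fintype ι] [DecidableEq ι]

open scoped Classical in
theorem sum_χ_subspace (A : Submodule (ZMod 2) (ι → ZMod 2)) (u : ι → ZMod 2) :
    (∑ v, if v ∈ A then χ u v else 0) =
      if ∀ v ∈ A, u ⬝ᵥ v = 0 then (Nat.card A : ℂ) else 0 := by
  split_ifs with h
  · rw [Finset.sum_congr rfl (g := fun v => if v ∈ A then (1 : ℂ) else 0)]
    · rw [Finset.sum_boole, Nat.card_eq_fintype_card, Fintype.card_subtype]
    · intro v _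
      split_ifs with hv
      · rw [χ_bits, h v hv, sgn_zero]
      · rfl
  · push Not at h
    obtain ⟨v₀, hv₀, hne⟩ := h
    have h1 : χ u v₀ = -1 := by
      rw [χ_bits, (zmod_two_cases (u ⬝ᵥ v₀)).resolve_left hne, sgn_one]
    have h2 : (∑ v, if v ∈ A then χ u v else 0) = -∑ v, if v ∈ A then χ u v else 0 := by
      rw [← Finset.sum_neg_distrib]
      refine Fintype.sum_equiv (Equiv.addRight v₀) _ _ fun v => ?_
      rw [Equiv.coe_addRight, A.add_mem_iff_left hv₀, χ_add_right, h1]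
      split_ifs <;> simp
    exact self_eq_neg.1 h2

theorem card_mul_card_orthogonal (A B : Submodule (ZMod 2) (ι → ZMod 2))
    (hB : ∀ u, u ∈ B ↔ ∀ v ∈ A, u ⬝ᵥ v = 0) :
    Nat.card A * Nat.card B = 2 ^ Fintype.card ι := by
  classical
  have h1 : ∑ u : ι → ZMod 2, (∑ v, if v ∈ A then χ u v else 0) =
      (Nat.card A : ℂ) * Nat.card B := by
    simp only [sum_χ_subspace, ← hB]
    rw [← Finset.sum_filter, Finset.sum_const, nsmul_eq_mul, mul_comm,
      Nat.card_eq_fintype_card (α := B),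
      Fintype.card_subtype]
  have h2 : ∑ u : ι → ZMod 2, (∑ v, if v ∈ A then χ u v else 0) = (2 : ℂ) ^ Fintype.card ι := by
    rw [Finset.sum_comm, Finset.sum_eq_single 0]
    · simp [A.zero_mem, χ_zero_right]
    · intro v _ hv
      split_ifs
      · simp only [χ_comm _ v, sum_χ, if_neg hv]
      · simp
    · simp
  have h3 := h1.symm.trans h2
  exact_mod_cast h3

theorem orthogonal_orthogonal (A B : Submodule (ZMod 2) (ι → ZMod 2))
    (hB : ∀ u, u ∈ B ↔ ∀ v ∈ A, u ⬝ᵥ v = 0) (u : ι → ZMod 2) :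
    u ∈ A ↔ ∀ v ∈ B, u ⬝ᵥ v = 0 := by
  let A' : Submodule (ZMod 2) (ι → ZMod 2) :=
    { carrier := {u | ∀ v ∈ B, u ⬝ᵥ v = 0}
      add_mem' := fun {a b} ha hb v hv => by rw [add_dotProduct, ha v hv, hb v hv, add_zero]
      zero_mem' := fun v _ => zero_dotProduct v
      smul_mem' := fun a u hu v hv => by rw [smul_dotProduct, hu v hv, smul_zero] }
  have hle : A ≤ A' := fun u hu v hv => by rw [dotProduct_comm]; exact (hB v).1 hv u hu
  have h1 := card_mul_card_orthogonal A B hB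
  have h2 := card_mul_card_orthogonal B A' fun u => Iff.rfl
  have hpos : 0 < Nat.card B := Nat.card_pos
  have hcard : Nat.card A = Nat.card A' := by
    rw [mul_comm] at h2
    exact Nat.eq_of_mul_eq_mul_right hpos (h1.trans h2.symm)
  have heq : A = A' := by
    refine SetLike.coe_injective (Set.eq_of_subset_of_ncard_le hle ?_ (Set.toFinite _))
    change Nat.card A' ≤ Nat.card A
    rw [hcard]
  conv_lhs => rw [heq]
  rfl

end Orthogonality

namespace CSSCode

variable {m : ℕ} (Q : CSSCode m)

theorem mem_C_iff (u : Fin m → ZMod 2) : u ∈ Q.C ↔ ∀ v ∈ dualCode Q.C, u ⬝ᵥ v = 0 :=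
  orthogonal_orthogonal Q.C (dualCode Q.C) (fun _ => Iff.rfl) u

theorem card_C : Nat.card Q.C = 2 * Nat.card (dualCode Q.C) := by
  rw [Module.natCard_eq_pow_finrank (K := ZMod 2) (V := Q.C),
    Module.natCard_eq_pow_finrank (K := ZMod 2) (V := dualCode Q.C),
    Q.finrank_eq, Nat.card_zmod, pow_succ, mul_comm]

theorem self_dotProduct (u : Fin m → ZMod 2) : u ⬝ᵥ u = ∑ j, u j := by
  refine Finset.sum_congr rfl fun j _ => ?_
  rcases zmod_two_cases (u j) with h | h <;> rw [h] <;> rfl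

theorem parity_dual {u : Fin m → ZMod 2} (hu : u ∈ dualCode Q.C) : ∑ j, u j = 0 := by
  rw [← self_dotProduct]
  exact hu u (Q.dual_le hu)

theorem one_mem : (fun _ => 1 : Fin m → ZMod 2) ∈ Q.C := by
  rw [mem_C_iff]
  intro v hv
  simpa [dotProduct] using Q.parity_dual hv

theorem length_odd (Q : CSSCode m) : (m : ZMod 2) = 1 := by
  have h1 := card_mul_card_orthogonal Q.C (dualCode Q.C) fun _ => Iff.rfl
  rw [card_C, Module.natCard_eq_pow_finrank (K := ZMod 2) (V := dualCode Q.C), Nat.card_zmod,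
    Fintype.card_fin] at h1
  have h2 : 2 ^ (2 * Module.finrank (ZMod 2) (dualCode Q.C) + 1) = 2 ^ m := by
    rw [← h1]; ring
  rw [← Nat.pow_right_injective le_rfl h2]
  push_cast
  rw [show (2 : ZMod 2) = 0 from rfl]
  simp

/-- A word of `C` is a stabilizer if and only if it is even. -/
theorem mem_dual_iff (u : Fin m → ZMod 2) : u ∈ dualCode Q.C ↔ u ∈ Q.C ∧ ∑ j, u j = 0 := by
  refine ⟨fun h => ⟨Q.dual_le h, Q.parity_dual h⟩, fun ⟨h1, h2⟩ => ?_⟩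
  -- `C^⊥` and the even words of `C` are nested subspaces of index two in `C`.
  let f : Q.C →ₗ[ZMod 2] ZMod 2 :=
    { toFun := fun v => ∑ j, v.1 j
      map_add' := fun a b => by simp [Finset.sum_add_distrib]
      map_smul' := fun a b => by simp [Finset.mul_sum] }
  have hf : LinearMap.range f = ⊤ := by
    rw [LinearMap.range_eq_top]
    intro a
    refine ⟨a • ⟨_, Q.one_mem⟩, ?_⟩
    rw [map_smul]
    change a • ∑ j : Fin m, (1 : ZMod 2) = a
    simp [length_odd Q]
  have hk := LinearMap.finrank_range_add_finrank_ker f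
  rw [hf, finrank_top, Module.finrank_self, Q.finrank_eq] at hk
  have hle : (dualCode Q.C).comap Q.C.subtype ≤ LinearMap.ker f := fun v hv =>
    Q.parity_dual hv
  have hd : Module.finrank (ZMod 2) ((dualCode Q.C).comap Q.C.subtype) =
      Module.finrank (ZMod 2) (dualCode Q.C) :=
    (Submodule.comapSubtypeEquivOfLe Q.dual_le).finrank_eq
  have heq := Submodule.eq_of_le_of_finrank_eq hle (by omega)
  have : (⟨u, h1⟩ : Q.C) ∈ LinearMap.ker f := h2
  rw [← heq] at this
  exact this

variable {Q}

theorem Decoder.classicalDecode_add (δ : Q.Decoder) (w : Fin m → ZMod 2) {v : Fin m → ZMod 2}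
    (hv : v ∈ Q.C) : δ.classicalDecode (w + v) = δ.classicalDecode w + ∑ j, v j := by
  rw [classicalDecode, classicalDecode, δ.corr_add w v hv, ← Finset.sum_add_distrib]
  refine Finset.sum_congr rfl fun j _ => ?_
  simp only [Pi.sub_apply, Pi.add_apply]
  ring

theorem Decoder.corr_eq_of_add_mem (δ : Q.Decoder) {w s : Fin m → ZMod 2}
    (h : w + s ∈ Q.C) : δ.corr w = δ.corr s := by
  have := δ.corr_add s _ h
  rwa [add_comm w, ← add_assoc, add_self, zero_add] at this

theorem sub_eq_add' {ι : Type} [Fintype ι] [DecidableEq ι] (a b : ι → ZMod 2) :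
    a - b = a + b := by
  rw [sub_eq_iff_eq_add, add_add_cancel]

theorem Decoder.add_corr_mem (δ : Q.Decoder) (w : Fin m → ZMod 2) : w + δ.corr w ∈ Q.C := by
  rw [← sub_eq_add']; exact δ.corr_mem w

theorem Decoder.corr_corr (δ : Q.Decoder) (w : Fin m → ZMod 2) :
    δ.corr (δ.corr w) = δ.corr w :=
  (δ.corr_eq_of_add_mem (δ.add_corr_mem w)).symm

theorem Decoder.Corrects.classicalDecode_eq_zero {δ : Q.Decoder} {t : ℕ} (h : δ.Corrects t)
    {e : Fin m → ZMod 2} (he : hammingNorm e ≤ t) : δ.classicalDecode e = 0 :=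
  Q.parity_dual (h e he)

end CSSCode

/-! ### CSS codes with one logical qubit -/

section CSSPair

variable {ι : Type} [Fintype ι] [DecidableEq ι]

/-- A CSS code with one logical qubit: `A` indexes the `X`-stabilizers, `B` the `Z`-stabilizers, and
`ℓ` is the support of both the logical `X` and the logical `Z`. -/
structure CSSPair (ι : Type) [Fintype ι] where
  A : Submodule (ZMod 2) (ι → ZMod 2)
  B : Submodule (ZMod 2) (ι → ZMod 2)
  ℓ : ι → ZMod 2
  ℓ_self : ℓ ⬝ᵥ ℓ = 1
  mem_A : ∀ u, u ∈ A ↔ (∀ v ∈ B, u ⬝ᵥ v = 0) ∧ u ⬝ᵥ ℓ = 0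
  mem_B : ∀ u, u ∈ B ↔ (∀ v ∈ A, u ⬝ᵥ v = 0) ∧ u ⬝ᵥ ℓ = 0

namespace CSSPair

variable (P : CSSPair ι)

/-- The code with the roles of `X` and `Z` exchanged. -/
def swap : CSSPair ι := ⟨P.B, P.A, P.ℓ, P.ℓ_self, P.mem_B, P.mem_A⟩

open scoped Classical in
/-- The encoding isometry: the basis vector `b` is mapped to the uniform superposition of
`b ℓ + A`. -/
def enc : Matrix (ι → ZMod 2) (ZMod 2) ℂ :=
  Matrix.of fun u b => if u + b • P.ℓ ∈ P.A then ((Real.sqrt (Nat.card P.A) : ℝ) : ℂ)⁻¹ else 0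

open scoped Classical in
theorem enc_apply (u : ι → ZMod 2) (b : ZMod 2) :
    P.enc u b = if u + b • P.ℓ ∈ P.A then ((Real.sqrt (Nat.card P.A) : ℝ) : ℂ)⁻¹ else 0 := rfl

theorem star_enc (u : ι → ZMod 2) (b : ZMod 2) : star (P.enc u b) = P.enc u b := by
  rw [enc_apply]
  split_ifs <;> simp

theorem ℓ_dot {v : ι → ZMod 2} (hv : v ∈ P.A) : P.ℓ ⬝ᵥ v = 0 := by
  rw [dotProduct_comm]; exact ((P.mem_A v).1 hv).2

theorem ℓ_dot' {v : ι → ZMod 2} (hv : v ∈ P.B) : P.ℓ ⬝ᵥ v = 0 := P.swap.ℓ_dot hv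

theorem add_smul_mem (a : ι → ZMod 2) (t : ZMod 2) :
    a + t • P.ℓ ∈ P.A ↔ (∀ v ∈ P.B, a ⬝ᵥ v = 0) ∧ a ⬝ᵥ P.ℓ = t := by
  rw [P.mem_A]
  refine and_congr (forall₂_congr fun v hv => ?_) ?_
  · rw [add_dotProduct, smul_dotProduct, P.ℓ_dot' hv, smul_zero, add_zero]
  · rw [add_dotProduct, smul_dotProduct, P.ℓ_self, smul_eq_mul, mul_one, add_eq_iff, zero_add]

theorem card_pos : 0 < Nat.card P.A := Nat.card_pos

theorem sqrt_mul_sqrt : ((Real.sqrt (Nat.card P.A) : ℝ) : ℂ)⁻¹ *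
    ((Real.sqrt (Nat.card P.A) : ℝ) : ℂ)⁻¹ = (Nat.card P.A : ℂ)⁻¹ := by
  rw [← mul_inv, ← Complex.ofReal_mul, Real.mul_self_sqrt (Nat.cast_nonneg _)]; simp

theorem card_mul_card : 2 * Nat.card P.A * Nat.card P.B = 2 ^ Fintype.card ι := by
  -- The orthogonal space of `A` is the union of `B` and `ℓ + B`.
  classical
  let D : Submodule (ZMod 2) (ι → ZMod 2) :=
    { carrier := {u | ∀ v ∈ P.A, u ⬝ᵥ v = 0}
      add_mem' := fun {a b} ha hb v hv => by rw [add_dotProduct, ha v hv, hb v hv, add_zero]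
      zero_mem' := fun v _ => zero_dotProduct v
      smul_mem' := fun a u hu v hv => by rw [smul_dotProduct, hu v hv, smul_zero] }
  rw [← card_mul_card_orthogonal P.A D fun _ => Iff.rfl]
  have e : ZMod 2 × P.B ≃ D :=
    { toFun := fun q => ⟨q.2.1 + q.1 • P.ℓ, fun v hv => by
        rw [add_dotProduct, smul_dotProduct, P.ℓ_dot hv, ((P.mem_B _).1 q.2.2).1 v hv]; simp⟩
      invFun := fun u => ⟨u.1 ⬝ᵥ P.ℓ, ⟨u.1 + (u.1 ⬝ᵥ P.ℓ) • P.ℓ,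
        (P.swap.add_smul_mem u.1 _).2 ⟨u.2, rfl⟩⟩⟩
      left_inv := fun q => by
        have h : (q.2.1 + q.1 • P.ℓ) ⬝ᵥ P.ℓ = q.1 := by
          rw [add_dotProduct, smul_dotProduct, P.ℓ_self, ((P.mem_B _).1 q.2.2).2]; simp
        ext1
        · exact h
        · apply Subtype.ext
          change q.2.1 + q.1 • P.ℓ + ((q.2.1 + q.1 • P.ℓ) ⬝ᵥ P.ℓ) • P.ℓ = q.2.1
          rw [h, add_add_cancel]
      right_inv := fun u => by
        apply Subtype.ext
        change u.1 + (u.1 ⬝ᵥ P.ℓ) • P.ℓ + (u.1 ⬝ᵥ P.ℓ) • P.ℓ = u.1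
        rw [add_add_cancel] }
  rw [← Nat.card_congr e, Nat.card_prod, Nat.card_zmod]
  ring

/-- The Hadamard gate on all physical qubits acts as a logical Hadamard gate, and exchanges the
stabilizers. -/
theorem had_mul_enc : had (ι → ZMod 2) * P.enc = P.swap.enc * had (ZMod 2) := by
  classical
  ext u b
  have hL : (had (ι → ZMod 2) * P.enc) u b =
      ((Real.sqrt (2 ^ Fintype.card ι : ℝ) : ℝ) : ℂ)⁻¹ * ((Real.sqrt (Nat.card P.A) : ℝ) : ℂ)⁻¹ *
        (χ u (b • P.ℓ) * if ∀ v ∈ P.A, u ⬝ᵥ v = 0 then (Nat.card P.A : ℂ) else 0) := by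
    rw [Matrix.mul_apply, ← sum_χ_subspace, Finset.mul_sum, Finset.mul_sum]
    refine Fintype.sum_equiv (Equiv.addRight (b • P.ℓ)) _ _ fun v => ?_
    rw [had_apply, enc_apply, Equiv.coe_addRight, Fintype.card_pi]
    simp only [ZMod.card, Finset.prod_const, Finset.card_univ, Nat.cast_pow, Nat.cast_ofNat]
    split_ifs
    · rw [χ_add_right]
      linear_combination (-((Real.sqrt (2 ^ Fintype.card ι : ℝ) : ℝ) : ℂ)⁻¹ *
        ((Real.sqrt (Nat.card P.A) : ℝ) : ℂ)⁻¹ * χ u v) * χ_mul_self u (b • P.ℓ)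
    · simp
  have hR : (P.swap.enc * had (ZMod 2)) u b =
      ((Real.sqrt 2 : ℝ) : ℂ)⁻¹ * ((Real.sqrt (Nat.card P.B) : ℝ) : ℂ)⁻¹ *
        (χ u (b • P.ℓ) * if ∀ v ∈ P.A, u ⬝ᵥ v = 0 then 1 else 0) := by
    rw [Matrix.mul_apply, Finset.sum_eq_single (u ⬝ᵥ P.ℓ)]
    · rw [enc_apply, had_apply, χ_bits, χ_def, dotProduct_smul, smul_eq_mul, mul_comm b]
      have : (u + (u ⬝ᵥ P.ℓ) • P.swap.ℓ ∈ P.swap.A) ↔ ∀ v ∈ P.A, u ⬝ᵥ v = 0 := by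
        rw [P.swap.add_smul_mem]
        exact and_iff_left rfl
      simp only [this, ZMod.card]
      split_ifs
      · change ((Real.sqrt (Nat.card P.B) : ℝ) : ℂ)⁻¹ * _ = _
        push_cast; ring
      · simp
    · intro t _ ht
      rw [enc_apply, if_neg, zero_mul]
      rw [P.swap.add_smul_mem]
      exact fun h => ht h.2.symm
    · simp
  rw [hL, hR]
  split_ifs
  · have h0 : ((Real.sqrt (2 ^ Fintype.card ι : ℝ) : ℝ) : ℂ) = ((Real.sqrt 2 : ℝ) : ℂ) *
        ((Real.sqrt (Nat.card P.A) : ℝ) : ℂ) * ((Real.sqrt (Nat.card P.B) : ℝ) : ℂ) := by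
      rw [← Complex.ofReal_mul, ← Complex.ofReal_mul, ← Real.sqrt_mul (by norm_num),
        ← Real.sqrt_mul (by positivity)]
      congr 2
      exact_mod_cast P.card_mul_card.symm
    have h1 : ((Nat.card P.A : ℕ) : ℂ) = ((Real.sqrt (Nat.card P.A) : ℝ) : ℂ) *
        ((Real.sqrt (Nat.card P.A) : ℝ) : ℂ) := by
      rw [← Complex.ofReal_mul, Real.mul_self_sqrt (Nat.cast_nonneg _)]; simp
    have h2 : ((Real.sqrt (Nat.card P.A) : ℝ) : ℂ) ≠ 0 := by
      rw [Complex.ofReal_ne_zero, Real.sqrt_ne_zero']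
      exact_mod_cast P.card_pos
    rw [h0, h1, mul_one]
    field_simp
  · simp

theorem enc_isometry : P.enc.conjTranspose * P.enc = 1 := by
  classical
  ext b' b
  rw [Matrix.mul_apply, Matrix.one_apply]
  simp only [Matrix.conjTranspose_apply, star_enc]
  split_ifs with h
  · subst h
    have h1 : ∀ u, P.enc u b' * P.enc u b' =
        (Nat.card P.A : ℂ)⁻¹ * if u + b' • P.ℓ ∈ P.A then 1 else 0 := by
      intro u
      rw [enc_apply]
      split_ifs
      · rw [sqrt_mul_sqrt, mul_one]
      · simp
    simp only [h1]
    have h2 : (∑ u, if u + b' • P.ℓ ∈ P.A then (1 : ℂ) else 0) = ∑ u, if u ∈ P.A then 1 else 0 :=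
      Fintype.sum_equiv (Equiv.addRight (b' • P.ℓ)) _ _ fun u => rfl
    rw [← Finset.mul_sum, h2, Finset.sum_boole, ← Fintype.card_subtype, ← Nat.card_eq_fintype_card]
    exact inv_mul_cancel₀ (Nat.cast_ne_zero.2 P.card_pos.ne')
  · refine Finset.sum_eq_zero fun u _ => ?_
    rw [enc_apply, enc_apply]
    by_cases h1 : u + b' • P.ℓ ∈ P.A
    · have h2 : u + b • P.ℓ ∉ P.A := fun h2 => by
        rw [P.add_smul_mem] at h1 h2
        exact h (h1.2.symm.trans h2.2)
      rw [if_neg h2, mul_zero]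
    · rw [if_neg h1, zero_mul]

theorem sum_star_enc (a : ι → ZMod 2) (b : ZMod 2) :
    ∑ w, P.enc (w + a) b * star (P.enc (w + a) b) = 1 := by
  have h := congrFun (congrFun P.enc_isometry b) b
  rw [Matrix.mul_apply, Matrix.one_apply, if_pos rfl] at h
  rw [← h]
  refine Fintype.sum_equiv (Equiv.addRight a) _ _ fun w => ?_
  rw [Matrix.conjTranspose_apply, mul_comm]
  rfl

/-- Paulis that preserve the code space act as logical Paulis. -/
theorem pauli_mul_enc {a b : ι → ZMod 2} (ha : ∀ v ∈ P.B, a ⬝ᵥ v = 0)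
    (hb : ∀ v ∈ P.A, b ⬝ᵥ v = 0) :
    pauli a b * P.enc = P.enc * pauli (a ⬝ᵥ P.ℓ) (b ⬝ᵥ P.ℓ) := by
  classical
  ext u β
  rw [pauli_mul_apply, mul_pauli_apply, enc_apply, enc_apply]
  have h1 : u + a + β • P.ℓ ∈ P.A ↔ u + (β + a ⬝ᵥ P.ℓ) • P.ℓ ∈ P.A := by
    rw [← P.A.add_mem_iff_left ((P.add_smul_mem a _).2 ⟨ha, rfl⟩) (x := u + (β + a ⬝ᵥ P.ℓ) • P.ℓ)]
    have : u + (β + a ⬝ᵥ P.ℓ) • P.ℓ + (a + (a ⬝ᵥ P.ℓ) • P.ℓ) =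
        u + a + β • P.ℓ + ((a ⬝ᵥ P.ℓ) • P.ℓ + (a ⬝ᵥ P.ℓ) • P.ℓ) := by
      rw [add_smul]; abel
    rw [this, add_self, add_zero]
  by_cases h : u + a + β • P.ℓ ∈ P.A
  · rw [if_pos h, if_pos (h1.1 h), mul_comm]
    congr 1
    have h2 := hb _ h
    rw [dotProduct_add, dotProduct_smul, add_eq_iff, zero_add] at h2
    rw [χ_bits, h2, χ_def, smul_eq_mul, mul_comm]
  · rw [if_neg h, if_neg (fun h' => h (h1.2 h'))]; simp

theorem enc_conj_pauli_enc {a b : ι → ZMod 2} (ha : ∀ v ∈ P.B, a ⬝ᵥ v = 0)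
    (hb : ∀ v ∈ P.A, b ⬝ᵥ v = 0) :
    P.enc.conjTranspose * (pauli a b * P.enc) = pauli (a ⬝ᵥ P.ℓ) (b ⬝ᵥ P.ℓ) := by
  rw [P.pauli_mul_enc ha hb, ← Matrix.mul_assoc, P.enc_isometry, Matrix.one_mul]

theorem eq_zero_of_anticommute {a b a' b' : ι → ZMod 2}
    (h1 : pauli a' b' * P.enc = P.enc) (h : χ b a' * χ b' a = -1) :
    P.enc.conjTranspose * (pauli a b * P.enc) = 0 := by
  have h2 : P.enc.conjTranspose * pauli a' b' = χ b' a' • P.enc.conjTranspose := by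
    conv_rhs => rw [← h1]
    rw [Matrix.conjTranspose_mul, pauli_conjTranspose, Matrix.mul_smul, smul_smul, χ_mul_self,
      one_smul]
  have h2' : P.enc.conjTranspose * pauli a' b' = P.enc.conjTranspose := by
    have h3 : χ b' a' • (1 : Mat (ZMod 2)) = 1 := by
      rw [← P.enc_isometry, ← Matrix.smul_mul, ← h2, Matrix.mul_assoc, h1]
    have h4 := congrFun (congrFun h3 0) 0
    rw [h2, show χ b' a' = 1 by simpa using h4, one_smul]
  have h3 : P.enc.conjTranspose * (pauli a b * P.enc) =
      -(P.enc.conjTranspose * (pauli a b * P.enc)) := by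
    have h5 : pauli a b * P.enc = -(pauli a' b' * (pauli a b * P.enc)) := by
      conv_lhs => rw [← h1, ← Matrix.mul_assoc (pauli a b), pauli_mul_comm, h]
      rw [neg_smul, one_smul, Matrix.neg_mul, Matrix.mul_assoc]
    conv_lhs => rw [h5, Matrix.mul_neg, ← Matrix.mul_assoc, h2']
  ext u v
  have h6 := congrFun (congrFun h3 u) v
  rw [Matrix.neg_apply] at h6
  exact self_eq_neg.1 h6

/-- A Pauli that anticommutes with a stabilizer has no matrix elements between code words. -/
theorem enc_conj_pauli_enc_eq_zero {a b : ι → ZMod 2}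
    (h : ¬((∀ v ∈ P.B, a ⬝ᵥ v = 0) ∧ ∀ v ∈ P.A, b ⬝ᵥ v = 0)) :
    P.enc.conjTranspose * (pauli a b * P.enc) = 0 := by
  rw [not_and_or] at h
  push Not at h
  rcases h with ⟨v, hv, hne⟩ | ⟨v, hv, hne⟩
  · refine P.eq_zero_of_anticommute (a' := 0) (b' := v) ?_ ?_
    · rw [P.pauli_mul_enc (by simp) ((P.mem_B v).1 hv).1, ((P.mem_B v).1 hv).2, zero_dotProduct,
        pauli_zero, Matrix.mul_one]
    · rw [χ_zero_right, χ_bits, dotProduct_comm, (zmod_two_cases (a ⬝ᵥ v)).resolve_left hne,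
        sgn_one, one_mul]
  · refine P.eq_zero_of_anticommute (a' := v) (b' := 0) ?_ ?_
    · rw [P.pauli_mul_enc ((P.mem_A v).1 hv).1 (by simp), ((P.mem_A v).1 hv).2, zero_dotProduct,
        pauli_zero, Matrix.mul_one]
    · rw [χ_zero_left, χ_bits, (zmod_two_cases (b ⬝ᵥ v)).resolve_left hne, sgn_one, mul_one]

theorem enc_mul_enc (u v : ι → ZMod 2) (b c : ZMod 2) :
    P.enc u b * P.enc (u + v) c = P.enc u b * P.enc v (b + c) := by
  classical
  simp only [enc_apply]
  by_cases h : u + b • P.ℓ ∈ P.A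
  · congr 2
    rw [← P.A.add_mem_iff_right h (y := v + (b + c) • P.ℓ)]
    have : u + b • P.ℓ + (v + (b + c) • P.ℓ) = u + v + c • P.ℓ + (b • P.ℓ + b • P.ℓ) := by
      rw [add_smul]; abel
    rw [this, add_self, add_zero]
  · rw [if_neg h]; simp

/-- Transversal CNOT acts as a logical CNOT. -/
theorem cnot_mul_tensor_enc {n : ℕ} {i j : Fin n} (h : i ≠ j)
    {e : Fin n → Matrix (ι → ZMod 2) (ZMod 2) ℂ} (hi : e i = P.enc) (hj : e j = P.enc) :
    (cnot i j : Mat (Fin n → ι → ZMod 2)) * tensor e =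
      tensor e * (cnot i j : Mat (Fin n → ZMod 2)) := by
  ext u b
  refine (cnot_mul_apply h (tensor e) u b).trans (Eq.trans ?_ (mul_cnot_apply i j _ u b).symm)
  rw [tensor_apply, tensor_apply]
  have key : ∀ f : Fin n → ℂ, ∏ l, f l =
      f i * f j * ∏ l ∈ (Finset.univ.erase i).erase j, f l := by
    intro f
    rw [mul_assoc, Finset.mul_prod_erase _ f (by simp [h.symm]),
      Finset.mul_prod_erase _ f (Finset.mem_univ i)]
  rw [key, key (fun l => e l (u l) _)]
  congr 1
  · simp only [addAt, Function.update_self, Function.update_of_ne h, hi, hj]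
    exact P.enc_mul_enc _ _ _ _
  · refine Finset.prod_congr rfl fun l hl => ?_
    simp only [Finset.mem_erase, Finset.mem_univ, and_true] at hl
    simp [addAt, hl.1]

end CSSPair

end CSSPair

/-! ### The code with traps -/

section Traps

variable {m : ℕ} (Q : CSSCode m) (π : Equiv.Perm (Fin 3 × Fin m))

/-- The data part of a permuted block. -/
def dataPart (u : Block m) : Fin m → ZMod 2 := fun j => u (π (0, j))

/-- The words of a permuted block that vanish on the traps of group `g` and whose data part lies
in `C^⊥`. -/
def trapSub (g : Fin 3) : Submodule (ZMod 2) (Block m) where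
  carrier := {u | (∀ j, u (π (g, j)) = 0) ∧ dataPart π u ∈ dualCode Q.C}
  add_mem' {a b} ha hb := by
    refine ⟨fun j => ?_, (dualCode Q.C).add_mem ha.2 hb.2⟩
    rw [Pi.add_apply, ha.1 j, hb.1 j, add_zero]
  zero_mem' := ⟨fun _ => rfl, (dualCode Q.C).zero_mem⟩
  smul_mem' a u hu := by
    refine ⟨fun j => ?_, (dualCode Q.C).smul_mem a hu.2⟩
    rw [Pi.smul_apply, hu.1 j, smul_zero]

theorem mem_trapSub (g : Fin 3) (u : Block m) : u ∈ trapSub Q π g ↔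
    (∀ j, u (π (g, j)) = 0) ∧ dataPart π u ∈ dualCode Q.C := Iff.rfl

/-- The support of the logical Paulis in a permuted block. -/
def mask : Block m := permuteBits π (dataMask m)

theorem mask_apply (p : Fin 3 × Fin m) : mask π (π p) = if p.1 = 0 then 1 else 0 := by
  simp [mask, permuteBits, dataMask]

theorem dataPart_mask : dataPart π (mask π) = fun _ => 1 := by
  ext j; rw [dataPart, mask_apply]; simp

/-- A word `s` on the data positions of a permuted block. -/
def embedData (s : Fin m → ZMod 2) : Block m :=
  fun p => if (π.symm p).1 = 0 then s (π.symm p).2 else 0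

theorem embedData_apply (s : Fin m → ZMod 2) (p : Fin 3 × Fin m) :
    embedData π s (π p) = if p.1 = 0 then s p.2 else 0 := by
  simp [embedData]

theorem dataPart_embedData (s : Fin m → ZMod 2) : dataPart π (embedData π s) = s := by
  ext j; rw [dataPart, embedData_apply]; simp

theorem dot_block (u v : Block m) : u ⬝ᵥ v = dataPart π u ⬝ᵥ dataPart π v +
    (∑ j, u (π (1, j)) * v (π (1, j))) + ∑ j, u (π (2, j)) * v (π (2, j)) := by
  rw [dotProduct, ← Equiv.sum_comp π, Fintype.sum_prod_type, Fin.sum_univ_three]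
  rfl

/-- The other measurement basis. -/
def MeasBasis.other : MeasBasis → MeasBasis
  | .comp => .had
  | .had => .comp

theorem trapGroup_ne_zero (B : MeasBasis) : trapGroup B ≠ 0 := by
  cases B <;> decide

theorem perp_trapSub (B : MeasBasis) (u : Block m) :
    (∀ v ∈ trapSub Q π (trapGroup B.other), u ⬝ᵥ v = 0) ↔
      (∀ j, u (π (trapGroup B, j)) = 0) ∧ dataPart π u ∈ Q.C := by
  constructor
  · intro h
    constructor
    · intro j
      have hv : Pi.single (π (trapGroup B, j)) 1 ∈ trapSub Q π (trapGroup B.other) := by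
        rw [mem_trapSub]
        constructor
        · intro l
          rw [Pi.single_eq_of_ne]
          rw [π.injective.ne_iff, Ne, Prod.mk.injEq]
          cases B <;> simp [trapGroup, MeasBasis.other]
        · have : dataPart π (Pi.single (π (trapGroup B, j)) 1) = 0 := by
            ext l
            rw [dataPart, Pi.single_eq_of_ne]
            · rfl
            rw [π.injective.ne_iff, Ne, Prod.mk.injEq]
            exact fun h => trapGroup_ne_zero B h.1.symm
          rw [this]
          exact (dualCode Q.C).zero_mem
      simpa using h _ hv
    · rw [Q.mem_C_iff]
      intro c hc
      have hv : embedData π c ∈ trapSub Q π (trapGroup B.other) := by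
        rw [mem_trapSub, dataPart_embedData]
        refine ⟨fun l => ?_, hc⟩
        rw [embedData_apply, if_neg (trapGroup_ne_zero _)]
      have h1 := h _ hv
      rw [dot_block π, dataPart_embedData] at h1
      simpa [embedData_apply] using h1
  · rintro ⟨h1, h2⟩ v ⟨hv1, hv2⟩
    rw [dot_block π, (Q.mem_C_iff _).1 h2 _ hv2]
    cases B <;> simp_all [trapGroup, MeasBasis.other]

theorem dot_mask (u : Block m) : u ⬝ᵥ mask π = ∑ j, dataPart π u j := by
  rw [dot_block π, dataPart_mask]
  simp [mask_apply, dotProduct]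

theorem mem_trapSub_iff_perp (B : MeasBasis) (u : Block m) : u ∈ trapSub Q π (trapGroup B) ↔
    (∀ v ∈ trapSub Q π (trapGroup B.other), u ⬝ᵥ v = 0) ∧ u ⬝ᵥ mask π = 0 := by
  rw [perp_trapSub, dot_mask, mem_trapSub, Q.mem_dual_iff, and_assoc]

/-- The code with traps is a CSS code: the computational traps contribute `Z`-stabilizers and the
Hadamard traps `X`-stabilizers. A transversal Hadamard gate exchanges them, whence a version of the
code for either basis. -/
def trapPair (B : MeasBasis) : CSSPair (Fin 3 × Fin m) where
  A := trapSub Q π (trapGroup B)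
  B := trapSub Q π (trapGroup B.other)
  ℓ := mask π
  ℓ_self := by
    rw [dot_mask, dataPart_mask]
    simpa using Q.length_odd
  mem_A := mem_trapSub_iff_perp Q π B
  mem_B u := by
    have h := mem_trapSub_iff_perp Q π B.other u
    cases B <;> exact h

theorem trapPair_swap : (trapPair Q π .comp).swap = trapPair Q π .had := rfl

theorem card_trapSub : Nat.card (trapSub Q π 1) = Nat.card (dualCode Q.C) * 2 ^ m := by
  have e : trapSub Q π 1 ≃ dualCode Q.C × (Fin m → ZMod 2) :=
    { toFun := fun u => (⟨dataPart π u.1, u.2.2⟩, fun j => u.1 (π (2, j)))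
      invFun := fun q => ⟨fun p => if (π.symm p).1 = 0 then q.1.1 (π.symm p).2 else
        if (π.symm p).1 = 1 then 0 else q.2 (π.symm p).2, by
          rw [mem_trapSub]
          refine ⟨fun j => by simp, ?_⟩
          convert q.1.2 using 1
          ext j
          simp [dataPart]⟩
      left_inv := fun u => by
        apply Subtype.ext
        funext p
        obtain ⟨⟨g, j⟩, rfl⟩ := π.surjective p
        have h := u.2.1 j
        fin_cases g <;> simp_all [dataPart]
      right_inv := fun q => by
        ext1
        · apply Subtype.ext
          funext j
          simp [dataPart]
        · funext j
          simp }
  rw [Nat.card_congr e, Nat.card_prod]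
  simp

theorem permuteQubits_mul_apply {β : Type} (M : Matrix (Block m) β ℂ) (u : Block m) (b : β) :
    (permuteQubits π * M) u b = M (fun p => u (π p)) b := by
  rw [Matrix.mul_apply, Finset.sum_eq_single (fun p => u (π p))]
  · rw [permuteQubits, Matrix.of_apply, if_pos, one_mul]
    ext p; simp [permuteBits]
  · intro v _ hv
    rw [permuteQubits, Matrix.of_apply, if_neg, zero_mul]
    rintro rfl
    exact hv (by ext p; simp [permuteBits])
  · simp

theorem permuteQubits_inv : permuteQubits π⁻¹ = (permuteQubits π).conjTranspose := by
  ext u v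
  rw [Matrix.conjTranspose_apply, permuteQubits, permuteQubits, Matrix.of_apply, Matrix.of_apply]
  have h : u = permuteBits π⁻¹ v ↔ v = permuteBits π u := by
    constructor
    · rintro rfl; ext p
      change v p = v (π (π.symm p))
      rw [Equiv.apply_symm_apply]
    · rintro rfl; ext p
      change u p = u (π.symm (π p))
      rw [Equiv.symm_apply_apply]
  simp only [h]
  split_ifs <;> simp

/-- Encoding after an error `X^{s₁} Z^{s₂}` on the data. -/
theorem permuteQubits_mul_withTraps (s₁ s₂ : Fin m → ZMod 2) :
    permuteQubits π * withTraps (pauli s₁ s₂ * Q.encode) =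
      pauli (embedData π s₁) (embedData π s₂) * (trapPair Q π .comp).enc := by
  classical
  ext u b
  rw [permuteQubits_mul_apply, pauli_mul_apply, withTraps, Matrix.of_apply, CSSPair.enc_apply]
  rw [show (pauli s₁ s₂ * Q.encode) (fun j => u (π (0, j))) b = _ from
    pauli_mul_apply s₁ s₂ Q.encode (dataPart π u) b]
  have h1 : χ s₂ (dataPart π u + s₁) = χ (embedData π s₂) (u + embedData π s₁) := by
    rw [χ_bits, χ_bits, dot_block π, dataPart_embedData]
    have h2 : dataPart π (u + embedData π s₁) = dataPart π u + s₁ := by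
      conv_rhs => rw [← dataPart_embedData π s₁]
      rfl
    rw [h2]
    simp [embedData_apply]
  have h2 : u + embedData π s₁ + b • (trapPair Q π .comp).ℓ ∈ (trapPair Q π .comp).A ↔
      (∀ j, u (π (1, j)) = 0) ∧ (dataPart π u + s₁ - fun _ => b) ∈ dualCode Q.C := by
    refine and_congr (forall_congr' fun j => ?_) ?_
    · change u (π (1, j)) + embedData π s₁ (π (1, j)) + b • mask π (π (1, j)) = 0 ↔ _
      simp [embedData_apply, mask_apply]
    · have h3 : dataPart π (u + embedData π s₁ + b • (trapPair Q π .comp).ℓ) =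
          dataPart π u + s₁ - fun _ => b := by
        rw [CSSCode.sub_eq_add']
        ext j
        change u (π (0, j)) + embedData π s₁ (π (0, j)) + b • mask π (π (0, j)) = _
        simp [embedData_apply, mask_apply, dataPart]
      rw [h3]
  have h3 : ((Real.sqrt (Nat.card (trapPair Q π .comp).A) : ℝ) : ℂ)⁻¹ =
      ((Real.sqrt (Nat.card (dualCode Q.C)) : ℝ) : ℂ)⁻¹ * ((Real.sqrt 2 : ℂ) ^ m)⁻¹ := by
    rw [← mul_inv]
    congr 1
    change ((Real.sqrt (Nat.card (trapSub Q π 1)) : ℝ) : ℂ) = _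
    rw [card_trapSub, Nat.cast_mul, Real.sqrt_mul (Nat.cast_nonneg _), Nat.cast_pow,
      Nat.cast_ofNat, ← Complex.ofReal_pow, ← Complex.ofReal_mul]
    congr 2
    rw [Real.sqrt_eq_rpow, Real.sqrt_eq_rpow, ← Real.rpow_natCast_mul (by norm_num), mul_comm,
      Real.rpow_mul_natCast (by norm_num)]
  simp only [h2, h1, h3, CSSCode.encode, Matrix.of_apply]
  by_cases ht : ∀ j, u (π (1, j)) = 0
  · by_cases hd : (dataPart π u + s₁ - fun _ => b) ∈ dualCode Q.C
    · rw [if_pos hd, if_pos ht, if_pos ⟨ht, hd⟩]; ring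
    · rw [if_neg hd]; simp [hd]
  · rw [if_neg ht]; simp [ht]

theorem permuteQubits_mul_withTraps_encode :
    permuteQubits π * withTraps Q.encode = (trapPair Q π .comp).enc := by
  have h := permuteQubits_mul_withTraps Q π 0 0
  have h0 : embedData π (0 : Fin m → ZMod 2) = 0 := by
    ext p; simp [embedData]
  rwa [h0, pauli_zero, pauli_zero, Matrix.one_mul, Matrix.one_mul] at h

theorem encBlock_eq (x z : Block m) :
    encBlock Q π x z = pauli x z * (trapPair Q π .comp).enc := by
  rw [encBlock, pauliX_mul_pauliZ, Matrix.mul_assoc, permuteQubits_mul_withTraps_encode]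

variable {Q} (δ : Q.Decoder)

theorem decBlock_eq (x z : Block m) (s : (Fin m → ZMod 2) × (Fin m → ZMod 2)) :
    decBlock δ π x z s = if δ.corr s.1 = s.1 ∧ δ.corr s.2 = s.2 then
      (trapPair Q π .comp).enc.conjTranspose *
        ((pauli (embedData π s.1) (embedData π s.2)).conjTranspose * (pauli x z).conjTranspose)
      else 0 := by
  rw [decBlock, CSSCode.Decoder.decodeKraus, pauliX_mul_pauliZ, pauliX_mul_pauliZ]
  split_ifs
  · rw [Matrix.conjTranspose_mul, Matrix.conjTranspose_conjTranspose,
      Matrix.conjTranspose_conjTranspose, permuteQubits_inv, ← Matrix.conjTranspose_mul,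
      permuteQubits_mul_withTraps, Matrix.conjTranspose_mul, Matrix.mul_assoc]
  · have h : withTraps (0 : Matrix (Fin m → ZMod 2) (ZMod 2) ℂ) = 0 := by
      ext u b; simp [withTraps]
    rw [Matrix.conjTranspose_zero, h]
    simp

/-! ### Verified decryption of one wire under a Pauli attack -/

/-- Whether verified decryption of a wire accepts after the attack `X^a Z^b`. -/
def Passes (B : Option MeasBasis) (a b : Block m) : Prop :=
  match B with
  | none => (∀ j, a (π (1, j)) = 0) ∧ ∀ j, b (π (2, j)) = 0
  | some B => ∀ j, a (π (trapGroup B, j)) = 0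

/-- The logical `X`-error that remains after decoding. -/
def errX (a : Block m) : ZMod 2 := δ.classicalDecode (dataPart π a)

/-- The logical `Z`-error that remains after decoding; it is irrelevant on measured wires. -/
def errZ (B : Option MeasBasis) (b : Block m) : ZMod 2 :=
  if B.isSome then 0 else δ.classicalDecode (dataPart π b)

/-- The version of the code that holds a wire at the end of homomorphic evaluation. -/
def finalBasis : Option MeasBasis → MeasBasis
  | none => .comp
  | some B => B

/-- The logical operation on one wire at the end of a circuit: the Pauli `X^x Z^z`, the projection
onto the outcome if the wire is measured, and the error `X^e Z^f`. -/
def logicalOp (B : Option MeasBasis) (e f x z a : ZMod 2) : Mat (ZMod 2) :=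
  pauli e f * ((if B.isSome then proj (a + e) else 1) * pauli x z)

/-- Branch by branch, decrypting an unmeasured wire after a Pauli attack yields a multiple of the
logical operation. Only the branch of the syndrome of the attack contributes. -/
theorem decBlock_attack (a b : Block m) (φ ψ α : ZMod 2)
    (s : (Fin m → ZMod 2) × (Fin m → ZMod 2)) : ∃ c : ℂ,
    decBlock δ π (φ • mask π) (ψ • mask π) s * (pauli a b * (trapPair Q π .comp).enc) =
      c • logicalOp none (errX π δ a) (errZ π δ none b) φ ψ α ∧
    c * star c = open scoped Classical in if Passes π none a b ∧
      s = (δ.corr (dataPart π a), δ.corr (dataPart π b)) then 1 else 0 := by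
  classical
  set P := trapPair Q π .comp with hP
  have hA : ∀ u, (∀ v ∈ P.B, u ⬝ᵥ v = 0) ↔ (∀ j, u (π (1, j)) = 0) ∧ dataPart π u ∈ Q.C :=
    fun u => perp_trapSub Q π .comp u
  have hB : ∀ u, (∀ v ∈ P.A, u ⬝ᵥ v = 0) ↔ (∀ j, u (π (2, j)) = 0) ∧ dataPart π u ∈ Q.C :=
    fun u => perp_trapSub Q π .had u
  -- Up to a phase, undoing pad and correction leaves the Pauli with labels `a'`, `b'`.
  set a' := embedData π s.1 + (φ • mask π + a) with ha'
  set b' := embedData π s.2 + (ψ • mask π + b) with hb'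
  have hphase : ∃ c : ℂ, c * star c = 1 ∧
      ((pauli (embedData π s.1) (embedData π s.2)).conjTranspose *
      (pauli (φ • mask π) (ψ • mask π)).conjTranspose) * pauli a b = c • pauli a' b' := by
    rw [pauli_conjTranspose, pauli_conjTranspose, Matrix.smul_mul, Matrix.smul_mul, Matrix.mul_smul,
      Matrix.smul_mul, Matrix.mul_assoc, pauli_mul, Matrix.mul_smul, pauli_mul, smul_smul,
        smul_smul,
      smul_smul]
    refine ⟨_, ?_, rfl⟩
    simp only [star_mul']
    rw [mul_mul_mul_comm, χ_mul_star, mul_one, mul_mul_mul_comm, χ_mul_star, mul_one,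
      mul_mul_mul_comm, χ_mul_star, χ_mul_star, mul_one]
  obtain ⟨c, hc, hcp⟩ := hphase
  have hda : dataPart π a' = dataPart π a + s.1 + φ • (fun _ => 1) := by
    have : dataPart π a' = dataPart π (embedData π s.1) + (φ • dataPart π (mask π) +
      dataPart π a) := rfl
    rw [this, dataPart_embedData, dataPart_mask]; abel
  have hdb : dataPart π b' = dataPart π b + s.2 + ψ • (fun _ => 1) := by
    have : dataPart π b' = dataPart π (embedData π s.2) + (ψ • dataPart π (mask π) +
      dataPart π b) := rfl
    rw [this, dataPart_embedData, dataPart_mask]; abel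
  have hta : ∀ j, a' (π (1, j)) = a (π (1, j)) := fun j => by
    change embedData π s.1 (π (1, j)) + (φ • mask π (π (1, j)) + a (π (1, j))) = _
    simp [embedData_apply, mask_apply]
  have htb : ∀ j, b' (π (2, j)) = b (π (2, j)) := fun j => by
    change embedData π s.2 (π (2, j)) + (ψ • mask π (π (2, j)) + b (π (2, j))) = _
    simp [embedData_apply, mask_apply]
  have hsum : ∀ (w t : Fin m → ZMod 2) (φ : ZMod 2),
      ∑ j, (w + t + φ • (fun _ => 1 : Fin m → ZMod 2)) j = ∑ j, (w - t) j + φ := by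
    intro w t φ
    rw [CSSCode.sub_eq_add']
    simp [Finset.sum_add_distrib, Q.length_odd]
  have hmem : ∀ (w t : Fin m → ZMod 2) (φ : ZMod 2),
      w + t + φ • (fun _ => 1 : Fin m → ZMod 2) ∈ Q.C ↔ w + t ∈ Q.C := fun w t φ =>
    Q.C.add_mem_iff_left (Q.C.smul_mem φ Q.one_mem)
  rw [decBlock_eq]
  by_cases hfix : δ.corr s.1 = s.1 ∧ δ.corr s.2 = s.2
  · have hop : (if δ.corr s.1 = s.1 ∧ δ.corr s.2 = s.2 then
        P.enc.conjTranspose * ((pauli (embedData π s.1) (embedData π s.2)).conjTranspose *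
          (pauli (φ • mask π) (ψ • mask π)).conjTranspose) else 0) * (pauli a b * P.enc) =
        c • (P.enc.conjTranspose * (pauli a' b' * P.enc)) := by
      rw [if_pos hfix, Matrix.mul_assoc, ← Matrix.mul_assoc _ (pauli a b), hcp, Matrix.smul_mul,
        Matrix.mul_smul]
    rw [hop]
    by_cases hgood : Passes π none a b ∧ s = (δ.corr (dataPart π a), δ.corr (dataPart π b))
    · obtain ⟨⟨h1, h2⟩, rfl⟩ := hgood
      refine ⟨c * χ (errZ π δ none b) φ, ?_, ?_⟩
      · rw [P.enc_conj_pauli_enc, logicalOp, Option.isSome_none, if_neg (by simp), Matrix.one_mul,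
          pauli_mul, smul_smul, mul_assoc, χ_mul_self, mul_one]
        · change c • pauli (a' ⬝ᵥ mask π) (b' ⬝ᵥ mask π) = _
          rw [dot_mask, dot_mask, hda, hdb, hsum, hsum]
          rfl
        · rw [hA, hda, hmem]
          exact ⟨fun j => (hta j).trans (h1 j), δ.add_corr_mem _⟩
        · rw [hB, hdb, hmem]
          exact ⟨fun j => (htb j).trans (h2 j), δ.add_corr_mem _⟩
      · rw [if_pos ⟨⟨h1, h2⟩, rfl⟩, star_mul', mul_mul_mul_comm, hc, χ_mul_star, one_mul]
    · refine ⟨0, ?_, by rw [if_neg hgood]; simp⟩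
      rw [P.enc_conj_pauli_enc_eq_zero, smul_zero, zero_smul]
      rw [hA, hB, hda, hdb, hmem, hmem]
      rintro ⟨⟨h1, h2⟩, h3, h4⟩
      refine hgood ⟨⟨fun j => (hta j).symm.trans (h1 j), fun j => (htb j).symm.trans (h3 j)⟩, ?_⟩
      rw [δ.corr_eq_of_add_mem h2, δ.corr_eq_of_add_mem h4, hfix.1, hfix.2]
  · refine ⟨0, ?_, ?_⟩
    · rw [if_neg hfix]; simp
    · rw [if_neg]
      · simp
      · rintro ⟨_, rfl⟩
        exact hfix ⟨δ.corr_corr _, δ.corr_corr _⟩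

/-- Branch by branch, reading a measured wire after a Pauli attack yields a multiple of the logical
operation. The branches that contribute are the code words with the right logical value, shifted by
the attack. -/
theorem single_attack (B : MeasBasis) (a b : Block m) (φ ψ α : ZMod 2) (w : Block m) : ∃ c : ℂ,
    (if decodeAt δ (trapGroup B) π (φ • mask π) w = some α then Matrix.single α w (1 : ℂ) else 0) *
        (pauli a b * (trapPair Q π B).enc) =
      c • logicalOp (some B) (errX π δ a) 0 φ ψ α ∧
    c * star c = open scoped Classical in if Passes π (some B) a b then
      (trapPair Q π B).enc (w + a) (α + errX π δ a + φ) *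
        star ((trapPair Q π B).enc (w + a) (α + errX π δ a + φ)) else 0 := by
  classical
  set P := trapPair Q π B with hP
  set β₀ := α + errX π δ a + φ with hβ₀
  have hL : logicalOp (some B) (errX π δ a) 0 φ ψ α =
      χ ψ β₀ • (Matrix.single α β₀ 1 : Mat (ZMod 2)) := by
    ext u v
    rw [logicalOp, pauli_mul_apply, χ_zero_left, one_mul, Option.isSome_some, if_pos rfl,
      proj_mul_pauli, pauli_mul_apply, proj, Matrix.single_apply, Matrix.smul_apply,
      Matrix.single_apply, smul_eq_mul, ← hβ₀]
    by_cases h : α = u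
    · subst h
      rw [← hβ₀]
      simp
    · rw [if_neg, if_neg]
      · simp
      · exact fun h' => h h'.1
      · rintro ⟨h', _⟩
        rw [hβ₀] at h'
        exact h (by simpa using h')
  -- If the branch decodes to `α` and meets the shifted code word for `β`, then `β = β₀`.
  have hkey : ∀ β, w + a + β • P.ℓ ∈ P.A →
      (decodeAt δ (trapGroup B) π (φ • mask π) w = some α ↔ Passes π (some B) a b ∧ β = β₀) := by
    rintro β ⟨h1, h2⟩
    have h1' : ∀ j, (φ • mask π + w) (π (trapGroup B, j)) = a (π (trapGroup B, j)) := by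
      intro j
      have := h1 j
      change w (π (trapGroup B, j)) + a (π (trapGroup B, j)) +
        β • mask π (π (trapGroup B, j)) = 0 at this
      rw [mask_apply, if_neg (trapGroup_ne_zero B), smul_zero, add_zero, add_eq_iff, zero_add]
        at this
      rw [← this, Pi.add_apply, Pi.smul_apply, mask_apply, if_neg (trapGroup_ne_zero B), smul_zero,
        zero_add]
    have h2' : δ.classicalDecode (dataPart π (φ • mask π + w)) = errX π δ a + (β + φ) := by
      set c := dataPart π (w + a + β • P.ℓ) with hcdef
      have e1 : dataPart π (φ • mask π + w) =
          dataPart π a + (c + (β + φ) • (fun _ => 1)) := by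
        rw [hcdef]
        ext j
        change φ • mask π (π (0, j)) + w (π (0, j)) = a (π (0, j)) + (w (π (0, j)) + a (π (0, j)) +
          β • mask π (π (0, j)) + (β + φ) • 1)
        rw [mask_apply, if_pos rfl]
        simp only [smul_eq_mul, mul_one]
        linear_combination (-1 : ZMod 2) * add_self (a (π (0, j))) - add_self β
      rw [e1, δ.classicalDecode_add _ (Q.C.add_mem (Q.dual_le h2) (Q.C.smul_mem _ Q.one_mem))]
      congr 1
      rw [show ∑ j, (c + (β + φ) • (fun _ => 1 : Fin m → ZMod 2)) j = ∑ j, c j + (β + φ) by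
        simp [Finset.sum_add_distrib, Q.length_odd], Q.parity_dual h2, zero_add]
    rw [decodeAt]
    simp only [h1']
    change (if ∀ j, a (π (trapGroup B, j)) = 0 then
      some (δ.classicalDecode (dataPart π (φ • mask π + w))) else none) = some α ↔
        (∀ j, a (π (trapGroup B, j)) = 0) ∧ β = β₀
    rw [h2']
    split_ifs with h
    · rw [Option.some.injEq, and_iff_right h, hβ₀]
      constructor
      · rintro rfl
        linear_combination -add_self (errX π δ a) - add_self φ
      · rintro rfl
        linear_combination add_self (errX π δ a) + add_self φ
    · simp [h]
  by_cases hd : decodeAt δ (trapGroup B) π (φ • mask π) w = some α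
  · refine ⟨χ b (w + a) * P.enc (w + a) β₀ * χ ψ β₀, ?_, ?_⟩
    · rw [if_pos hd, hL, smul_smul, mul_assoc _ (χ ψ β₀), χ_mul_self, mul_one, ← Matrix.mul_assoc,
        single_mul_pauli, Matrix.smul_mul, mul_smul]
      congr 1
      ext u β
      rw [Matrix.mul_apply, Finset.sum_eq_single (w + a)]
      · rw [Matrix.smul_apply, Matrix.single_apply, Matrix.single_apply, smul_eq_mul]
        by_cases hβ : β = β₀
        · subst hβ
          split_ifs <;> simp_all
        · have h0 : P.enc (w + a) β = 0 := by
            rw [CSSPair.enc_apply, if_neg]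
            exact fun h => hβ ((hkey β h).1 hd).2
          rw [h0, mul_zero, if_neg (fun h : α = u ∧ β₀ = β => hβ h.2.symm), mul_zero]
      · intro v _ hv
        rw [Matrix.single_apply, if_neg (fun h => hv h.2.symm), zero_mul]
      · simp
    · rw [star_mul', star_mul', mul_mul_mul_comm, χ_mul_star, mul_one, mul_mul_mul_comm,
        χ_mul_star, one_mul]
      by_cases hm : w + a + β₀ • P.ℓ ∈ P.A
      · rw [if_pos ((hkey β₀ hm).1 hd).1]
      · have h0 : P.enc (w + a) β₀ = 0 := by rw [CSSPair.enc_apply, if_neg hm]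
        rw [h0]; simp
  · refine ⟨0, by rw [if_neg hd]; simp, ?_⟩
    split_ifs with hp
    · have h0 : P.enc (w + a) β₀ = 0 := by
        rw [CSSPair.enc_apply, if_neg]
        exact fun h => hd ((hkey β₀ h).2 ⟨hp, rfl⟩)
      rw [h0]
    · simp

/-- Verified decryption of one wire after a Pauli attack: all branches are multiples of one logical
operation, with total weight one if the traps pass and zero otherwise. -/
theorem wireOp_attack (B : Option MeasBasis) (a b : Block m) (φ ψ α : ZMod 2) :
    ∃ c : Branch m → ℂ,
    (∀ τ, wireOp δ π B (φ • mask π) (ψ • mask π) none α τ *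
        (pauli a b * (trapPair Q π (finalBasis B)).enc) =
      c τ • logicalOp B (errX π δ a) (errZ π δ B b) φ ψ α) ∧
    ∑ τ, c τ * star (c τ) = open scoped Classical in if Passes π B a b then 1 else 0 := by
  classical
  match B with
  | none =>
    choose c hc1 hc2 using decBlock_attack π δ a b φ ψ α
    refine ⟨Sum.elim c 0, ?_, ?_⟩
    · rintro (s | w)
      · exact hc1 s
      · change 0 * _ = (0 : ℂ) • _
        simp
    · rw [Fintype.sum_sum_type]
      simp only [Sum.elim_inl, Sum.elim_inr, hc2, Pi.zero_apply, zero_mul, Finset.sum_const_zero,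
        add_zero]
      split_ifs with h
      · simp [h]
      · simp [h]
  | some B =>
    choose c hc1 hc2 using single_attack π δ B a b φ ψ α
    refine ⟨Sum.elim 0 c, ?_, ?_⟩
    · rintro (s | w)
      · have h : wireOp δ π (some B) (φ • mask π) (ψ • mask π) none α (Sum.inl s) = 0 := by
          simp only [wireOp]
          split_ifs <;> rfl
        rw [h, Sum.elim_inl, Pi.zero_apply]
        simp
      · exact hc1 w
    · rw [Fintype.sum_sum_type]
      simp only [Sum.elim_inl, Sum.elim_inr, hc2, Pi.zero_apply, zero_mul, Finset.sum_const_zero,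
        zero_add]
      split_ifs with h
      · exact CSSPair.sum_star_enc _ _ _
      · simp

end Traps

/-! ### Verified decryption under a Pauli attack -/

section Attack

variable {n m : ℕ} {Q : CSSCode m}

theorem onLeft_apply {α β ρ : Type} (Φ : Mat α →ₗ[ℂ] Mat β) (M : Mat (α × ρ)) (p q : β × ρ) :
    onLeft Φ M p q = Φ (Matrix.of fun a a' => M (a, p.2) (a', q.2)) p.1 q.1 := rfl

theorem trace_traceOut (s : Finset (Fin n)) (M : Mat (Fin n → ZMod 2)) :
    (traceOut s M).trace = M.trace := by
  have h : ∑ t : {i // i ∉ s} → ZMod 2,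
      (Matrix.of fun (u : {i // i ∈ s} → ZMod 2) (v : Fin n → ZMod 2) =>
        if (∀ i, v i.1 = u i) ∧ (∀ i, v i.1 = t i) then (1 : ℂ) else 0).conjTranspose *
      (Matrix.of fun (u : {i // i ∈ s} → ZMod 2) (v : Fin n → ZMod 2) =>
        if (∀ i, v i.1 = u i) ∧ (∀ i, v i.1 = t i) then (1 : ℂ) else 0) = 1 := by
    ext v v'
    rw [Matrix.sum_apply, Finset.sum_eq_single (fun i => v i.1), Matrix.mul_apply,
      Finset.sum_eq_single (fun i => v i.1), Matrix.one_apply]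
    · rw [Matrix.conjTranspose_apply, Matrix.of_apply, Matrix.of_apply, if_pos ⟨fun _ => rfl,
        fun _ => rfl⟩,
        star_one, one_mul]
      congr 1
      rw [eq_iff_iff]
      constructor
      · rintro ⟨h1, h2⟩
        ext i
        by_cases hi : i ∈ s
        · exact (h1 ⟨i, hi⟩).symm
        · exact (h2 ⟨i, hi⟩).symm
      · rintro rfl
        exact ⟨fun _ => rfl, fun _ => rfl⟩
    · intro u _ hu
      rw [Matrix.conjTranspose_apply, Matrix.of_apply, if_neg, star_zero, zero_mul]
      exact fun h => hu (funext fun i => (h.1 i).symm)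
    · simp
    · intro t _ ht
      rw [Matrix.mul_apply]
      refine Finset.sum_eq_zero fun u _ => ?_
      rw [Matrix.conjTranspose_apply, Matrix.of_apply, if_neg, star_zero, zero_mul]
      exact fun h => ht (funext fun i => (h.2 i).symm)
    · simp
  rw [traceOut, krausMap_apply, Matrix.trace_sum]
  simp only [trace_conj]
  rw [← Matrix.trace_sum, ← Finset.sum_mul, h, Matrix.one_mul]

/-- The channel of a circuit whose outcomes are recorded with errors `e`, followed by the Pauli
error `X^e Z^f` at the end. -/
def noisyChannel (c : Circuit n) (e f : Fin n → ZMod 2) : Mat (Fin n → ZMod 2) →ₗ[ℂ] Mat c.Out :=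
  traceOut c.out ∘ₗ conj (pauli e f) ∘ₗ runNoisy e c.gates 0

theorem noisyChannel_zero (c : Circuit n) : noisyChannel c 0 0 = c.channel := by
  rw [noisyChannel, pauli_zero, conj_one, LinearMap.id_comp, runNoisy_zero]
  rfl

theorem trace_noisyChannel (c : Circuit n) (e f : Fin n → ZMod 2) (M : Mat (Fin n → ZMod 2)) :
    (noisyChannel c e f M).trace = M.trace := by
  rw [noisyChannel, LinearMap.comp_apply, LinearMap.comp_apply, trace_traceOut,
    trace_conj_of_isometry (pauli_isometry _ _), trace_runNoisy e c.wf]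

theorem trace_channel (c : Circuit n) (M : Mat (Fin n → ZMod 2)) :
    (c.channel M).trace = M.trace := by
  rw [← noisyChannel_zero, trace_noisyChannel]

variable (Q) (π : Equiv.Perm (Fin 3 × Fin m))

theorem unitaryPart_mul_tensor_enc {s : Finset (Fin n)} {gs : List (Gate n)} (hs : WellFormed s gs)
    (e : Fin n → Matrix (Block m) (ZMod 2) ℂ) (he : ∀ i, i ∉ s → e i = (trapPair Q π .comp).enc) :
    unitaryPart (Block m) gs * tensor e = tensor (fun i => match basisOf gs i with
      | some .had => (trapPair Q π .had).enc
      | _ => e i) * unitaryPart (ZMod 2) gs := by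
  induction gs generalizing s e with
  | nil => simp [unitaryPart, basisOf]
  | cons g gs ih =>
    match g with
    | Gate.X b i => exact ih hs.2 e he
    | Gate.Z b i => exact ih hs.2 e he
    | Gate.CNOT i j =>
      have h := (trapPair Q π .comp).cnot_mul_tensor_enc hs.1 (he i hs.2.1) (he j hs.2.2.1)
      have h' : unitaryPart (Block m) (Gate.CNOT i j :: gs) * tensor e =
          unitaryPart (Block m) gs * (tensor e * (cnot i j : Mat (Fin n → ZMod 2))) := by
        exact (Matrix.mul_assoc _ _ _).trans (congrArg _ h)
      rw [h', ← Matrix.mul_assoc, ih hs.2.2.2 e he, Matrix.mul_assoc]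
      rfl
    | Gate.meas .comp i =>
      have hb := basisOf_eq_none hs.2 (Finset.mem_insert_self i s)
      rw [unitaryPart, ih hs.2 e fun l hl => he l fun h => hl (Finset.mem_insert_of_mem h)]
      congr 1
      refine congrArg tensor (funext fun l => ?_)
      rcases eq_or_ne l i with rfl | hl
      · rw [hb]; simp [basisOf]
      · simp [basisOf, hl]
    | Gate.meas .had i =>
      have hb := basisOf_eq_none hs.2 (Finset.mem_insert_self i s)
      have h1 : applyAt i (had (Block m)) * tensor e =
          tensor (Function.update e i (trapPair Q π .had).enc) * applyAt i (had (ZMod 2)) := by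
        rw [applyAt_mul_tensor, tensor_mul_applyAt, he i hs.1, CSSPair.had_mul_enc, trapPair_swap]
        simp
      rw [unitaryPart, Matrix.mul_assoc, h1, ← Matrix.mul_assoc, ih hs.2, unitaryPart,
        Matrix.mul_assoc]
      · congr 1
        refine congrArg tensor (funext fun l => ?_)
        rcases eq_or_ne l i with rfl | hl
        · rw [hb]; simp [basisOf]
        · simp [basisOf, hl]
      · intro l hl
        rw [Finset.mem_insert, not_or] at hl
        rw [Function.update_of_ne hl.1, he l hl.2]

/-- The encoding of all qubits, without one-time pad. -/
def encAll (n : ℕ) : Matrix (Fin n → Block m) (Fin n → ZMod 2) ℂ :=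
  tensor fun _ => (trapPair Q π .comp).enc

theorem unitaryPart_mul_encAll (c : Circuit n) :
    unitaryPart (Block m) c.gates * encAll Q π n =
      tensor (fun i => (trapPair Q π (finalBasis (basisOf c.gates i))).enc) *
        unitaryPart (ZMod 2) c.gates := by
  rw [encAll, unitaryPart_mul_tensor_enc Q π c.wf _ fun _ _ => rfl]
  congr 1
  refine congrArg tensor (funext fun i => ?_)
  rcases basisOf c.gates i with _ | B
  · rfl
  · cases B <;> rfl

variable {Q} (δ : Q.Decoder)

theorem frame_mask (α : Fin n → ZMod 2) (gs : List (Gate n)) :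
    frame (mask π) α gs 0 (0 : (Fin n → Block m) × (Fin n → Block m)) =
      (fun i => (frame (1 : ZMod 2) α gs 0 0).1 i • mask π,
        fun i => (frame (1 : ZMod 2) α gs 0 0).2 i • mask π) := by
  have h := frame_map (LinearMap.toSpanSingleton (ZMod 2) (Block m) (mask π)).toAddMonoidHom
    1 α gs 0 0
  have h0 : (⇑(LinearMap.toSpanSingleton (ZMod 2) (Block m) (mask π)).toAddMonoidHom ∘
      (0 : Fin n → ZMod 2)) = 0 := by
    ext i : 1
    simp
  have h1 : (LinearMap.toSpanSingleton (ZMod 2) (Block m) (mask π)).toAddMonoidHom 1 = mask π := by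
    simp
  rw [Prod.fst_zero, Prod.snd_zero, h0, h1] at h
  exact h

/-- The remaining logical errors after the Pauli attack `X^a Z^b`, on all wires. -/
def errXs (a : Fin n → Block m) : Fin n → ZMod 2 := fun i => errX π δ (a i)

/-- The remaining logical `Z`-errors on all wires. -/
def errZs (c : Circuit n) (b : Fin n → Block m) : Fin n → ZMod 2 :=
  fun i => errZ π δ (basisOf c.gates i) (b i)

/-- Whether verified decryption accepts after the Pauli attack `X^a Z^b`. -/
def PassesAll (c : Circuit n) (q : (Fin n → Block m) × (Fin n → Block m)) : Prop :=
  ∀ i, Passes π (basisOf c.gates i) (q.1 i) (q.2 i)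

open scoped Classical in
/-- Verified decryption after homomorphic evaluation and a Pauli attack: it accepts if and only if
the attack passes the traps, and then the circuit is applied up to the remaining logical errors. -/
theorem verDecAcc_attack (c : Circuit n) (q : (Fin n → Block m) × (Fin n → Block m)) :
    verDecAcc δ (π, 0) c ∘ₗ conj (pauli q.1 q.2 * (unitaryPart (Block m) c.gates * encAll Q π n)) =
      if PassesAll π c q then noisyChannel c (errXs π δ q.1) (errZs π δ c q.2) else 0 := by
  set e := errXs π δ q.1 with he
  set f := errZs π δ c q.2 with hf
  have hterm : ∀ α : Fin n → ZMod 2, ∑ t : Fin n → Branch m,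
      conj (tensor fun i => wireOp δ π (basisOf c.gates i)
        ((frame (mask π) α c.gates 0 (0 : (Fin n → Block m) × (Fin n → Block m))).1 i)
        ((frame (mask π) α c.gates 0 (0 : (Fin n → Block m) × (Fin n → Block m))).2 i)
        none (α i) (t i)) ∘ₗ
        conj (pauli q.1 q.2 * (unitaryPart (Block m) c.gates * encAll Q π n)) =
      (if PassesAll π c q then (1 : ℂ) else 0) • (conj (pauli e f) ∘ₗ
        conj (projAll (basisOf c.gates) (α + e) * (pauli (frame 1 α c.gates 0 0).1
          (frame 1 α c.gates 0 0).2 * unitaryPart (ZMod 2) c.gates))) := by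
    intro α
    rw [frame_mask]
    set x := (frame (1 : ZMod 2) α c.gates 0 0).1
    set z := (frame (1 : ZMod 2) α c.gates 0 0).2
    choose k hk1 hk2 using fun i => wireOp_attack π δ (basisOf c.gates i) (q.1 i) (q.2 i)
      (x i) (z i) (α i)
    have h1 : ∀ t : Fin n → Branch m, (tensor fun i => wireOp δ π (basisOf c.gates i)
        (x i • mask π) (z i • mask π) none (α i) (t i)) *
        (pauli q.1 q.2 * (unitaryPart (Block m) c.gates * encAll Q π n)) =
        (∏ i, k i (t i)) • (pauli e f * (projAll (basisOf c.gates) (α + e) *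
          (pauli x z * unitaryPart (ZMod 2) c.gates))) := by
      intro t
      rw [unitaryPart_mul_encAll, ← Matrix.mul_assoc (pauli q.1 q.2), ← Matrix.mul_assoc,
        ← tensor_pauli, tensor_mul, tensor_mul]
      rw [show (fun i => wireOp δ π (basisOf c.gates i) (x i • mask π) (z i • mask π) none (α i)
          (t i) * (pauli (q.1 i) (q.2 i) * (trapPair Q π (finalBasis (basisOf c.gates i))).enc)) =
          _ from funext fun i => hk1 i (t i), tensor_smul, Matrix.smul_mul]
      congr 1
      rw [← Matrix.mul_assoc _ (pauli x z), ← Matrix.mul_assoc (pauli e f), ← tensor_pauli,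
        ← tensor_pauli, projAll, tensor_mul, tensor_mul]
      rfl
    simp only [← conj_mul, h1]
    simp only [conj_smul]
    rw [← Finset.sum_smul]
    congr 1
    simp only [star_prod, ← Finset.prod_mul_distrib]
    rw [← Fintype.piFinset_univ, ← Finset.prod_univ_sum (fun _ => Finset.univ)
      fun i τ => k i τ * star (k i τ)]
    simp only [hk2]
    rw [Finset.prod_ite_zero]
    simp only [Finset.mem_univ, true_implies, Finset.prod_const_one, PassesAll]
    congr
  rw [verDecAcc_eq, LinearMap.comp_assoc, sum_comp_left]
  simp only [sum_comp_left]
  have h2 := Finset.sum_congr (rfl : outcomes c.gates = outcomes c.gates) fun α _ => hterm α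
  have h3 := runNoisy_comp_pauli e c.wf 0 0
  rw [Prod.fst_zero, Prod.snd_zero, pauli_zero, conj_one, LinearMap.comp_id] at h3
  rw [← Finset.smul_sum, ← comp_sum_right, ← h3] at h2
  refine (congrArg (fun F => traceOut c.out ∘ₗ F) h2).trans ?_
  split_ifs
  · rw [one_smul]; rfl
  · rw [zero_smul, LinearMap.comp_zero]

theorem enc_eq_conj (x z : Fin n → Block m) :
    (tensor fun i => encBlock Q π (x i) (z i)) = pauli x z * encAll Q π n := by
  rw [encAll, ← tensor_pauli, tensor_mul]
  simp only [encBlock_eq]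

theorem encAll_isometry : (encAll Q π n).conjTranspose * encAll Q π n = 1 := by
  rw [encAll, tensor_conjTranspose, tensor_mul]
  simp only [CSSPair.enc_isometry, tensor_one]

theorem trace_enc (x z : Fin n → Block m) (M : Mat (Fin n → ZMod 2)) :
    (conj (tensor fun i => encBlock Q π (x i) (z i)) M).trace = M.trace := by
  rw [enc_eq_conj, conj_mul, LinearMap.comp_apply, trace_conj_of_isometry (pauli_isometry _ _),
    trace_conj_of_isometry (encAll_isometry _)]

theorem trace_evalGates {s : Finset (Fin n)} {gs : List (Gate n)} (hs : WellFormed s gs)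
    (M : Mat (Fin n → Block m)) : (evalGates gs M).trace = M.trace := by
  have h := evalGates_eq_unitaryPart (m := m) (Matrix.traceLinearMap _ ℂ ℂ) hs fun i _ => by
    ext M : 1
    rw [LinearMap.comp_apply, krausMap_apply, map_sum]
    exact sum_trace_proj i M
  have h1 := LinearMap.congr_fun h M
  rw [LinearMap.comp_apply, LinearMap.comp_apply, Matrix.traceLinearMap_apply,
    Matrix.traceLinearMap_apply, trace_conj_of_isometry (unitaryPart_isometry hs)] at h1
  exact h1

theorem errXs_zero_of_corrects {dc : ℕ} (hδ : δ.Corrects dc) {a : Fin n → Block m}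
    (ha : ∀ i, hammingNorm (dataPart π (a i)) ≤ dc) : errXs π δ a = 0 :=
  funext fun i => hδ.classicalDecode_eq_zero (ha i)

theorem errZs_zero_of_corrects {dc : ℕ} (hδ : δ.Corrects dc) (c : Circuit n) {b : Fin n → Block m}
    (hb : ∀ i, basisOf c.gates i = none → hammingNorm (dataPart π (b i)) ≤ dc) :
    errZs π δ c b = 0 := by
  ext i
  rw [errZs, errZ]
  split_ifs with h
  · rfl
  · exact hδ.classicalDecode_eq_zero (hb i (by simpa using h))

/-- Honest evaluation is always accepted, and verified decryption yields the channel of the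
circuit. -/
theorem verDecAcc_honest {dc : ℕ} (hδ : δ.Corrects dc) (p : (Fin n → Block m) × (Fin n → Block m))
    (c : Circuit n) :
    verDecAcc δ (π, p) c ∘ₗ evalGates c.gates ∘ₗ
      conj (tensor fun i => encBlock Q π (p.1 i) (p.2 i)) = c.channel := by
  rw [← LinearMap.comp_assoc, evalGates_eq_unitaryPart _ c.wf fun i hi =>
    verDecAcc_dephase δ _ c i hi,
    LinearMap.comp_assoc, ← conj_mul, enc_eq_conj, ← Matrix.mul_assoc]
  obtain ⟨ph, hph, hU⟩ := unitaryPart_mul_pauli (G := Block m) c.wf p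
  rw [hU, Matrix.smul_mul, conj_smul, hph, one_smul, Matrix.mul_assoc, conj_mul,
    ← LinearMap.comp_assoc, verDecAcc_comp_pauli]
  have h := verDecAcc_attack π δ c 0
  rw [Prod.fst_zero, Prod.snd_zero, pauli_zero, Matrix.one_mul] at h
  have hp : PassesAll π c (0 : (Fin n → Block m) × (Fin n → Block m)) := by
    intro i
    rcases basisOf c.gates i with _ | B
    · exact ⟨fun _ => rfl, fun _ => rfl⟩
    · exact fun _ => rfl
  have h0 : ∀ i, hammingNorm (dataPart π ((0 : Fin n → Block m) i)) ≤ dc := fun i => by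
    have : dataPart π ((0 : Fin n → Block m) i) = 0 := rfl
    rw [this, hammingNorm_zero]
    exact Nat.zero_le _
  rw [h, if_pos hp, errXs_zero_of_corrects π δ hδ h0, errZs_zero_of_corrects π δ hδ c fun i _ =>
    h0 i,
    noisyChannel_zero]

end Attack

/-! ### Perfect correctness -/

theorem isCorrect {n m dc : ℕ} {Q : CSSCode m} {δ : Q.Decoder} (hδ : δ.Corrects dc)
    (Ω : (c : Circuit n) → Mat c.Out) : (TC n δ Ω).IsCorrect := by
  rintro ⟨π, p⟩ c M
  set K : ℂ := (Fintype.card (TCKey n m) : ℂ)⁻¹ with hK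
  have h1 : ∀ l : Unit, (TC n δ Ω).eval c l
      (Matrix.kronecker ((TC n δ Ω).enc (π, p) M) ((TC n δ Ω).keyGen (π, p))) =
      K • evalGates c.gates (conj (tensor fun i => encBlock Q π (p.1 i) (p.2 i)) M) := by
    intro l
    change evalGates c.gates (conj _ _) = _
    rw [← map_smul]
    congr 1
    ext y y'
    rw [conj_apply, Matrix.mul_apply]
    simp only [Matrix.mul_apply, Matrix.of_apply, Fintype.sum_prod_type, Matrix.conjTranspose_apply]
    simp [Matrix.kronecker, Matrix.kroneckerMap_apply, TC, hK, mul_comm]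
  have h2 : verDecAcc δ (π, p) c
      (evalGates c.gates (conj (tensor fun i =>
        encBlock Q π (p.1 i) (p.2 i)) M)) = c.channel M := by
    rw [← verDecAcc_honest π δ hδ p c]; rfl
  have h3 : (evalGates c.gates
      (conj (tensor fun i => encBlock Q π (p.1 i) (p.2 i)) M)).trace = M.trace := by
    rw [trace_evalGates c.wf, trace_enc]
  have htr : ((TC n δ Ω).keyGen (π, p)).trace = K := by
    simp [TC, hK, Matrix.trace_smul]
  constructor
  · rw [Fintype.sum_unique, h1, htr]
    change verDecAcc δ (π, p) c (K • _) = K • c.channel M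
    rw [map_smul, h2]
  · rw [Fintype.sum_unique, h1]
    change (Matrix.traceLinearMap _ ℂ ℂ - Matrix.traceLinearMap _ ℂ ℂ ∘ₗ
      verDecAcc δ (π, p) c).smulRight (Ω c) (K • _) = 0
    rw [LinearMap.smulRight_apply, LinearMap.sub_apply, LinearMap.comp_apply, map_smul, map_smul,
      map_smul, h2, Matrix.traceLinearMap_apply, Matrix.traceLinearMap_apply, trace_channel, h3,
      sub_self, zero_smul]

/-! ### The traps catch errors of large weight -/

section Counting

variable {T : Type} [Fintype T] [DecidableEq T]

/-- The permutations that map no element of `F` into `A`. -/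
def avoiding (F A : Finset T) : Finset (Equiv.Perm T) :=
  Finset.univ.filter fun π => ∀ p ∈ F, π p ∉ A

theorem mem_avoiding (F A : Finset T) (π : Equiv.Perm T) :
    π ∈ avoiding F A ↔ ∀ p ∈ F, π p ∉ A := by simp [avoiding]

/-- Double counting of the pairs of a permutation avoiding `A` and a point outside `A` that is not
hit either. By symmetry under transpositions, each point outside `A` is avoided equally often. -/
theorem card_avoiding_insert (F A : Finset T) (a : T) (ha : a ∉ A) :
    Aᶜ.card * (avoiding F (insert a A)).card + F.card * (avoiding F A).card =
      Aᶜ.card * (avoiding F A).card := by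
  have h1 : ∀ π ∈ avoiding F A, (Aᶜ.filter fun c => π.symm c ∉ F).card + F.card = Aᶜ.card := by
    intro π hπ
    rw [mem_avoiding] at hπ
    rw [← Finset.card_filter_add_card_filter_not (s := Aᶜ) (fun c => π.symm c ∉ F)]
    congr 1
    rw [← Finset.card_map π.toEmbedding]
    congr 1
    ext c
    simp only [Finset.mem_map_equiv, Finset.mem_filter, Finset.mem_compl, not_not]
    refine ⟨fun h => ⟨?_, h⟩, fun h => h.2⟩
    simpa using hπ _ h
  have h2 : ∀ c ∈ Aᶜ, ((avoiding F A).filter fun π => π.symm c ∉ F).card =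
      (avoiding F (insert a A)).card := by
    intro c hc
    rw [Finset.mem_compl] at hc
    refine Finset.card_bij' (fun π _ => π.trans (Equiv.swap a c))
      (fun π _ => π.trans (Equiv.swap a c)) ?_ ?_ ?_ ?_
    · intro π hπ
      rw [Finset.mem_filter, mem_avoiding] at hπ
      rw [mem_avoiding]
      intro p hp
      have hpc : π p ≠ c := fun h => hπ.2 (by rw [← h]; simpa using hp)
      have hA := hπ.1 p hp
      rw [Equiv.trans_apply]
      by_cases hpa : π p = a
      · rw [hpa, Equiv.swap_apply_left, Finset.mem_insert, not_or]
        exact ⟨fun h => hpc (hpa.trans h.symm), hc⟩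
      · rw [Equiv.swap_apply_of_ne_of_ne hpa hpc, Finset.mem_insert, not_or]
        exact ⟨hpa, hA⟩
    · intro π hπ
      rw [mem_avoiding] at hπ
      rw [Finset.mem_filter, mem_avoiding]
      refine ⟨fun p hp => ?_, fun h => ?_⟩
      · have h := hπ p hp
        rw [Finset.mem_insert, not_or] at h
        rw [Equiv.trans_apply]
        by_cases hpc : π p = c
        · rw [hpc, Equiv.swap_apply_right]; exact ha
        · rw [Equiv.swap_apply_of_ne_of_ne h.1 hpc]; exact h.2
      · rw [Equiv.symm_trans_apply, Equiv.symm_swap, Equiv.swap_apply_right] at h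
        have h' := hπ _ h
        simp at h'
    · intro π _
      ext p; simp
    · intro π _
      ext p; simp
  have h3 := Finset.sum_card_bipartiteAbove_eq_sum_card_bipartiteBelow
    (s := avoiding F A) (t := Aᶜ) (fun (π : Equiv.Perm T) c => π.symm c ∉ F)
  simp only [Finset.bipartiteAbove, Finset.bipartiteBelow] at h3
  rw [Finset.sum_congr rfl h2, Finset.sum_const, smul_eq_mul] at h3
  rw [← h3, mul_comm F.card, ← smul_eq_mul (_ : ℕ) F.card, ← Finset.sum_const,
    ← Finset.sum_add_distrib, Finset.sum_congr rfl h1, Finset.sum_const, smul_eq_mul, mul_comm]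

/-- If `F` makes up a third of all positions, then a random permutation keeps `F` disjoint from `A`
with probability at most `(2/3) ^ |A|`. -/
theorem card_avoiding_le (F A : Finset T) (hF : 3 * F.card = Fintype.card T) :
    ((avoiding F A).card : ℝ) ≤ (2 / 3) ^ A.card * Fintype.card (Equiv.Perm T) := by
  induction A using Finset.induction_on with
  | empty =>
    rw [Finset.card_empty, pow_zero, one_mul]
    exact_mod_cast Finset.card_le_univ _
  | insert a A ha ih =>
    rw [Finset.card_insert_of_notMem ha, pow_succ]
    have h1 := card_avoiding_insert F A a ha
    have hpos : 0 < Aᶜ.card := Finset.card_pos.2 ⟨a, Finset.mem_compl.2 ha⟩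
    have hle : Aᶜ.card ≤ 3 * F.card := hF ▸ Finset.card_le_univ _
    have h2 : (Aᶜ.card : ℝ) * (avoiding F (insert a A)).card + F.card * (avoiding F A).card =
        Aᶜ.card * (avoiding F A).card := by exact_mod_cast h1
    have h3 : (Aᶜ.card : ℝ) ≤ 3 * F.card := by exact_mod_cast hle
    have h4 : (0 : ℝ) < Aᶜ.card := by exact_mod_cast hpos
    have h5 : ((avoiding F (insert a A)).card : ℝ) ≤ 2 / 3 * (avoiding F A).card := by
      refine le_of_mul_le_mul_left ?_ h4
      have h6 := mul_le_mul_of_nonneg_right h3 (Nat.cast_nonneg (α := ℝ) (avoiding F A).card)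
      linarith
    linarith

end Counting

section Weight

variable {n m : ℕ}

open scoped Classical in
/-- A random permutation spreads every block error of weight `t` over the traps: it misses all
traps of a given group with probability at most `(2/3) ^ t`. -/
theorem card_trap_le (a : Block m) (g : Fin 3) {t : ℕ} (ht : t ≤ hammingNorm a) :
    ((Finset.univ.filter fun π : Equiv.Perm (Fin 3 × Fin m) => ∀ j, a (π (g, j)) = 0).card : ℝ) ≤
      (2 / 3) ^ t * Fintype.card (Equiv.Perm (Fin 3 × Fin m)) := by
  have h := card_avoiding_le (Finset.univ.map ⟨fun j : Fin m => (g, j), Prod.mk_right_injective g⟩)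
    (Finset.univ.filter fun p => a p ≠ 0) (by simp)
  have h1 : (Finset.univ.filter fun π : Equiv.Perm (Fin 3 × Fin m) => ∀ j, a (π (g, j)) = 0) =
      avoiding (Finset.univ.map ⟨fun j : Fin m => (g, j), Prod.mk_right_injective g⟩)
        (Finset.univ.filter fun p => a p ≠ 0) := by
    ext π
    simp [mem_avoiding]
  rw [h1]
  refine h.trans (mul_le_mul_of_nonneg_right ?_ (Nat.cast_nonneg _))
  exact pow_le_pow_of_le_one (by norm_num) (by norm_num) ht

theorem hammingNorm_dataPart_le (π : Equiv.Perm (Fin 3 × Fin m)) (a : Block m) :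
    hammingNorm (dataPart π a) ≤ hammingNorm a := by
  refine Finset.card_le_card_of_injOn (fun j => π (0, j)) (fun j hj => ?_) ?_
  · simp only [Finset.coe_filter, Finset.mem_univ, true_and, Set.mem_ofPred_eq] at hj ⊢
    exact hj
  · intro j _ j' _ h
    exact congrArg Prod.snd (π.injective h)

/-- The Paulis that decoding corrects on every wire, whatever the permutation: low weight of the
`X`-part, and of the `Z`-part where the wire is not measured. After homomorphic evaluation a
measured wire is read in the computational basis, so that its `Z`-part is irrelevant. -/
def Harmless (dc : ℕ) (c : Circuit n) (q : (Fin n → Block m) × (Fin n → Block m)) : Prop :=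
  ∀ i, hammingNorm (q.1 i) ≤ dc ∧ (basisOf c.gates i = none → hammingNorm (q.2 i) ≤ dc)

open scoped Classical in
/-- A Pauli that is too heavy for the decoder on some wire passes the traps with probability at most
`(2/3) ^ dc`: its heavy part meets a group of traps that is checked on this wire. -/
theorem card_passesAll_le {dc : ℕ} (c : Circuit n) (q : (Fin n → Block m) × (Fin n → Block m))
    (hq : ¬Harmless dc c q) :
    ((Finset.univ.filter fun π : Equiv.Perm (Fin 3 × Fin m) => PassesAll π c q).card : ℝ) ≤
      (2 / 3) ^ dc * Fintype.card (Equiv.Perm (Fin 3 × Fin m)) := by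
  have key : ∀ (a : Block m) (g : Fin 3), dc < hammingNorm a →
      (∀ π : Equiv.Perm (Fin 3 × Fin m), PassesAll π c q → ∀ j, a (π (g, j)) = 0) →
      ((Finset.univ.filter fun π : Equiv.Perm (Fin 3 × Fin m) => PassesAll π c q).card : ℝ) ≤
        (2 / 3) ^ dc * Fintype.card (Equiv.Perm (Fin 3 × Fin m)) := by
    intro a g ha h
    refine le_trans ?_ (card_trap_le a g ha.le)
    exact_mod_cast Finset.card_le_card (Finset.monotone_filter_right _ fun π _ => h π)
  rw [Harmless] at hq
  push Not at hq
  obtain ⟨i, hi⟩ := hq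
  rcases hb : basisOf c.gates i with _ | B
  · by_cases h : hammingNorm (q.1 i) ≤ dc
    · refine key (q.2 i) 2 (hi h).2 fun π hπ => ?_
      have := hπ i
      rw [hb] at this
      exact this.2
    · refine key (q.1 i) 1 (not_le.1 h) fun π hπ => ?_
      have := hπ i
      rw [hb] at this
      exact this.1
  · by_cases h : hammingNorm (q.1 i) ≤ dc
    · rw [hb] at hi
      exact absurd (hi h).1 (by simp)
    · refine key (q.1 i) (trapGroup B) (not_le.1 h) fun π hπ => ?_
      have := hπ i
      rw [hb] at this
      exact this

end Weight

/-! ### Twirling: averaging over the one-time pad turns an attack into a mixture of Paulis -/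

section Twirl

variable {G : Type} [AddCommGroup G] [Fintype G] [DecidableEq G] [SignPairing G]

/-- The coefficient of the Pauli `X^q.1 Z^q.2` in the expansion of an operator. -/
def pauliCoeff (A : Mat G) (q : G × G) : ℂ :=
  (Fintype.card G : ℂ)⁻¹ * ∑ v, χ q.2 v * A (v + q.1) v

theorem sum_pauliCoeff (A : Mat G) : ∑ q : G × G, pauliCoeff A q • pauli q.1 q.2 = A := by
  ext u v
  rw [Matrix.sum_apply, Fintype.sum_prod_type, Finset.sum_eq_single (u + v)]
  · have h : ∀ z, (pauliCoeff A (u + v, z) • pauli (u + v) z) u v =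
        ∑ w, (Fintype.card G : ℂ)⁻¹ * A (w + (u + v)) w * χ (w + v) z := by
      intro z
      rw [Matrix.smul_apply, pauli_apply, if_pos (by rw [add_comm v, add_add_cancel]), pauliCoeff,
        smul_eq_mul, Finset.mul_sum, Finset.sum_mul]
      refine Finset.sum_congr rfl fun w _ => ?_
      rw [χ_comm (w + v), χ_add_right]
      ring
    rw [Finset.sum_congr rfl fun z _ => h z, Finset.sum_comm]
    simp only [← Finset.mul_sum, sum_χ]
    rw [Finset.sum_eq_single v]
    · rw [if_pos (add_self v), add_comm v, add_add_cancel, mul_right_comm,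
        inv_mul_cancel₀ card_ne_zero', one_mul]
    · intro w _ hw
      rw [if_neg (fun h => hw (by rwa [add_eq_iff, zero_add] at h)), mul_zero]
    · simp
  · intro x _ hx
    refine Finset.sum_eq_zero fun z _ => ?_
    rw [Matrix.smul_apply, pauli_apply, if_neg, smul_zero]
    intro h
    exact hx (by rw [h, add_comm v, add_add_cancel])
  · simp

/-- The sign by which the Paulis with labels `q` and `l` commute. -/
def commSign (q l : G × G) : ℂ := χ q.2 l.1 * χ l.2 q.1

theorem star_commSign (q l : G × G) : star (commSign q l) = commSign q l := by
  rw [commSign, star_mul', star_χ, star_χ]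

/-- The commutation signs of different Paulis are orthogonal characters of the group of keys. -/
theorem sum_commSign (q q' : G × G) :
    ∑ l, commSign q l * commSign q' l = if q = q' then (Fintype.card (G × G) : ℂ) else 0 := by
  have h : ∀ l : G × G, commSign q l * commSign q' l =
      χ (q.2 + q'.2) l.1 * χ (q.1 + q'.1) l.2 := by
    intro l
    rw [commSign, commSign, χ_add_left, χ_add_left, χ_comm q.1, χ_comm q'.1]
    ring
  rw [Finset.sum_congr rfl fun l _ => h l, Fintype.sum_prod_type]
  simp only [← Finset.mul_sum, ← Finset.sum_mul, sum_χ]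
  rw [Fintype.card_prod, Nat.cast_mul]
  simp only [Prod.ext_iff, add_eq_iff, zero_add]
  by_cases h1 : q.1 = q'.1 <;> by_cases h2 : q.2 = q'.2 <;> simp [h1, h2]

/-- `U` is a Clifford operator: conjugation with `U` maps the Pauli with label `p` to the one with
label `L p`, up to a phase. -/
structure IsCliffordWith (U : Mat G) (L : G × G → G × G) : Prop where
  isometry : U.conjTranspose * U = 1
  injective : Function.Injective L
  mul_pauli : ∀ p, ∃ c : ℂ, c * star c = 1 ∧
    U * pauli p.1 p.2 = c • (pauli (L p).1 (L p).2 * U)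

variable {X F : Type} [Fintype X] [AddCommGroup F] [Module ℂ F]

/-- Encryption with key `p`, an arbitrary operator `A`, and key-dependent decryption. Expanding
`A` in Paulis, the pad turns into the sign of commutation with each Pauli, and averaging over the
keys removes the cross terms. `L` tracks the key through the evaluation `U`. -/
theorem sum_twirl {U : Mat G} {L : G × G → G × G} (hU : IsCliffordWith U L)
    {D : G × G → Mat G →ₗ[ℂ] F} {D₀ : Mat G →ₗ[ℂ] F}
    (hD : ∀ p, D p ∘ₗ conj (pauli (L p).1 (L p).2) = D₀)
    (V : Matrix G X ℂ) (A A' : Mat G) (M : Mat X) :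
    ∑ p, D p (A * conj (pauli p.1 p.2 * V) M * A'.conjTranspose) =
      (Fintype.card (G × G) : ℂ) • ∑ q : G × G,
        (pauliCoeff (A * U.conjTranspose) q * star (pauliCoeff (A' * U.conjTranspose) q)) •
          D₀ (conj (pauli q.1 q.2 * (U * V)) M) := by
  have expand : ∀ (B : Mat G) (p : G × G) (c : ℂ),
      U * pauli p.1 p.2 = c • (pauli (L p).1 (L p).2 * U) →
      B * (pauli p.1 p.2 * V) = c • (pauli (L p).1 (L p).2 * ∑ q : G × G,
        (pauliCoeff (B * U.conjTranspose) q * commSign q (L p)) •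
          (pauli q.1 q.2 * (U * V))) := by
    intro B p c hc
    have h1 : B * (pauli p.1 p.2 * V) = B * U.conjTranspose * (U * pauli p.1 p.2 * V) := by
      rw [Matrix.mul_assoc B, ← Matrix.mul_assoc _ (U * _), ← Matrix.mul_assoc _ U,
        hU.isometry,
        Matrix.one_mul]
    rw [h1, hc]
    conv_lhs => rw [← sum_pauliCoeff (B * U.conjTranspose)]
    rw [Matrix.smul_mul, Matrix.mul_smul, Matrix.sum_mul, Matrix.mul_sum]
    congr 1
    refine Finset.sum_congr rfl fun q _ => ?_
    rw [Matrix.smul_mul, Matrix.mul_smul, ← Matrix.mul_assoc, ← Matrix.mul_assoc, pauli_mul_comm,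
      Matrix.smul_mul, Matrix.smul_mul, smul_smul, commSign, ← Matrix.mul_assoc (pauli _ _),
      Matrix.mul_assoc _ U V]
  set B : G × G → Matrix G X ℂ := fun q => pauli q.1 q.2 * (U * V)
  set a : G × G → ℂ := pauliCoeff (A * U.conjTranspose)
  set a' : G × G → ℂ := pauliCoeff (A' * U.conjTranspose)
  have term : ∀ p, D p (A * conj (pauli p.1 p.2 * V) M * A'.conjTranspose) =
      ∑ q, ∑ q', (a q * star (a' q') * (commSign q (L p) * commSign q' (L p))) •
        D₀ (B q * M * (B q').conjTranspose) := by
    intro p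
    obtain ⟨c, hc, hcU⟩ := hU.mul_pauli p
    have h1 : A * conj (pauli p.1 p.2 * V) M * A'.conjTranspose =
        A * (pauli p.1 p.2 * V) * M * (A' * (pauli p.1 p.2 * V)).conjTranspose := by
      rw [conj_apply, Matrix.conjTranspose_mul A']
      simp only [Matrix.mul_assoc]
    have h2 : A * conj (pauli p.1 p.2 * V) M * A'.conjTranspose =
        conj (pauli (L p).1 (L p).2) ((∑ q, (a q * commSign q (L p)) • B q) * M *
          (∑ q, (a' q * commSign q (L p)) • B q).conjTranspose) := by
      rw [h1, expand A p c hcU, expand A' p c hcU, Matrix.conjTranspose_smul,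
        Matrix.conjTranspose_mul, Matrix.mul_smul, Matrix.smul_mul, Matrix.smul_mul, smul_smul,
        mul_comm (star c), hc, one_smul, conj_apply]
      simp only [Matrix.mul_assoc]
      rfl
    rw [h2, ← LinearMap.comp_apply, hD, Matrix.conjTranspose_sum, Matrix.sum_mul, Matrix.sum_mul,
      map_sum]
    refine Finset.sum_congr rfl fun q _ => ?_
    rw [Matrix.mul_sum, map_sum]
    refine Finset.sum_congr rfl fun q' _ => ?_
    rw [Matrix.conjTranspose_smul, Matrix.smul_mul, Matrix.smul_mul, Matrix.mul_smul, smul_smul,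
      map_smul, star_mul', star_commSign]
    congr 1
    ring
  have hLsum : ∀ q q', ∑ p, commSign q (L p) * commSign q' (L p) =
      if q = q' then (Fintype.card (G × G) : ℂ) else 0 := by
    intro q q'
    rw [← sum_commSign]
    exact (Equiv.ofBijective L (Finite.injective_iff_bijective.1 hU.injective)).sum_comp
      fun l => commSign q l * commSign q' l
  rw [Finset.sum_congr rfl fun p _ => term p, Finset.sum_comm, Finset.smul_sum]
  refine Finset.sum_congr rfl fun q _ => ?_
  rw [Finset.sum_comm]
  simp only [← Finset.sum_smul, ← Finset.mul_sum, hLsum]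
  rw [Finset.sum_eq_single q]
  · rw [if_pos rfl, mul_comm, mul_smul]
    rfl
  · intro q' _ hq
    rw [if_neg (Ne.symm hq), mul_zero, zero_smul]
  · simp

variable {R R' K : Type} [Fintype R] [Fintype R'] [Fintype K]

/-- The operator on the ciphertext that belongs to one entry of a Kraus operator on the side
register. -/
def sideBlock (A : Matrix (G × R') (G × R) ℂ) (s : R') (r : R) : Mat G :=
  Matrix.of fun y y' => A (y, s) (y', r)

/-- The Kraus operators on the side register that accompany the Pauli attack with label `q`, if
the attack `A` is applied and `U` is the evaluation of the claimed circuit. -/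
def attackKraus (U : Mat G) (A : Matrix (G × R') (G × R) ℂ) (q : G × G) : Matrix R' R ℂ :=
  Matrix.of fun s r => pauliCoeff (sideBlock A s r * U.conjTranspose) q

/-- An attack with Kraus operators `A k` on ciphertext and side register, in the middle of
encryption and decryption with a random key, acts on the ciphertext as a random Pauli. -/
theorem sum_attack {U : Mat G} {L : G × G → G × G} (hU : IsCliffordWith U L)
    {D : G × G → Mat G →ₗ[ℂ] F} {D₀ : Mat G →ₗ[ℂ] F}
    (hD : ∀ p, D p ∘ₗ conj (pauli (L p).1 (L p).2) = D₀)
    (V : Matrix G X ℂ) (A : K → Matrix (G × R') (G × R) ℂ) (σ : R → R → Mat X) (s s' : R') :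
    ∑ p : G × G, D p (Matrix.of fun y y' => krausMap A (Matrix.of fun t t' =>
        conj (pauli p.1 p.2 * V) (σ t.2 t'.2) t.1 t'.1) (y, s) (y', s')) =
      (Fintype.card (G × G) : ℂ) • ∑ q : G × G, D₀ (conj (pauli q.1 q.2 * (U * V))
        (∑ k, ∑ r, ∑ r', (attackKraus U (A k) q s r * star (attackKraus U (A k) q s' r')) •
          σ r r')) := by
  have h : ∀ p : G × G, (Matrix.of fun y y' => krausMap A (Matrix.of fun t t' =>
      conj (pauli p.1 p.2 * V) (σ t.2 t'.2) t.1 t'.1) (y, s) (y', s')) =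
      ∑ k, ∑ r, ∑ r', sideBlock (A k) s r * conj (pauli p.1 p.2 * V) (σ r r') *
        (sideBlock (A k) s' r').conjTranspose := by
    intro p
    ext y y'
    rw [Matrix.of_apply, krausMap_apply]
    simp only [Matrix.sum_apply]
    refine Finset.sum_congr rfl fun k _ => ?_
    rw [conj_apply, Matrix.mul_apply, Fintype.sum_prod_type_right]
    conv_rhs => rw [Finset.sum_comm]
    refine Finset.sum_congr rfl fun r' _ => ?_
    simp only [Matrix.mul_apply (M := sideBlock _ _ _ * _)]
    conv_rhs => rw [Finset.sum_comm]
    refine Finset.sum_congr rfl fun y₂ _ => ?_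
    rw [← Finset.sum_mul, Matrix.mul_apply, Fintype.sum_prod_type_right]
    simp only [Matrix.mul_apply]
    rfl
  simp only [h, map_sum, map_smul]
  rw [Finset.sum_comm]
  simp only [Finset.smul_sum]
  conv_rhs => rw [Finset.sum_comm]
  refine Finset.sum_congr rfl fun k _ => ?_
  rw [Finset.sum_comm]
  conv_rhs => rw [Finset.sum_comm]
  refine Finset.sum_congr rfl fun r _ => ?_
  rw [Finset.sum_comm]
  conv_rhs => rw [Finset.sum_comm]
  refine Finset.sum_congr rfl fun r' _ => ?_
  rw [sum_twirl hU hD, Finset.smul_sum]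
  rfl

end Twirl

/-! ### Positivity -/

section Positivity

open scoped ComplexOrder MatrixOrder

variable {α β γ ρ : Type} [Fintype α] [Fintype β] [Fintype γ] [Fintype ρ]

theorem posSemidef_conj (K : Matrix β α ℂ) {M : Mat α} (hM : M.PosSemidef) :
    (conj K M).PosSemidef := hM.mul_mul_conjTranspose_same K

theorem posSemidef_krausMap {ι : Type} [Fintype ι] (K : ι → Matrix β α ℂ) {M : Mat α}
    (hM : M.PosSemidef) : (krausMap K M).PosSemidef := by
  rw [krausMap_apply]
  exact Matrix.posSemidef_sum _ fun i _ => posSemidef_conj _ hM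

theorem re_trace_nonneg {M : Mat α} (hM : M.PosSemidef) : 0 ≤ M.trace.re :=
  (Complex.le_def.1 hM.trace_nonneg).1

theorem re_trace_mul_nonneg {A M : Mat α} (hA : A.PosSemidef) (hM : M.PosSemidef) :
    0 ≤ (A * M).trace.re := by
  classical
  obtain ⟨B, rfl⟩ := CStarAlgebra.nonneg_iff_eq_star_mul_self.1 hA.nonneg
  rw [Matrix.star_eq_conjTranspose, ← trace_conj]
  exact re_trace_nonneg (posSemidef_conj B hM)

/-- Maps that preserve positivity in the presence of any side register. -/
def PreservesPos (Φ : Mat α →ₗ[ℂ] Mat β) : Prop :=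
  ∀ (r : ℕ) (M : Mat (α × Fin r)), M.PosSemidef → (onLeft Φ M).PosSemidef

theorem onLeft_conj [DecidableEq ρ] (K : Matrix β α ℂ) (M : Mat (α × ρ)) :
    onLeft (conj K) M = conj (Matrix.kronecker K (1 : Mat ρ)) M := by
  ext p q
  rw [onLeft_apply, conj_apply, conj_apply, Matrix.mul_apply, Matrix.mul_apply,
    Fintype.sum_prod_type]
  refine Finset.sum_congr rfl fun a' _ => ?_
  rw [Finset.sum_eq_single q.2]
  · rw [Matrix.conjTranspose_apply, Matrix.conjTranspose_apply, Matrix.mul_apply, Matrix.mul_apply,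
      Fintype.sum_prod_type]
    simp [Matrix.kronecker, Matrix.one_apply]
  · intro s _ hs
    rw [Matrix.conjTranspose_apply]
    simp [Matrix.kronecker, Ne.symm hs]
  · simp

theorem preservesPos_conj (K : Matrix β α ℂ) : PreservesPos (conj K) := fun r M hM => by
  rw [onLeft_conj]
  exact posSemidef_conj _ hM

theorem PreservesPos.comp {Φ : Mat β →ₗ[ℂ] Mat γ} {Ψ : Mat α →ₗ[ℂ] Mat β} (hΦ : PreservesPos Φ)
    (hΨ : PreservesPos Ψ) : PreservesPos (Φ ∘ₗ Ψ) := fun r M hM => hΦ r _ (hΨ r M hM)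

theorem PreservesPos.sum {ι : Type} {s : Finset ι} {Φ : ι → Mat α →ₗ[ℂ] Mat β}
    (h : ∀ i, PreservesPos (Φ i)) : PreservesPos (∑ i ∈ s, Φ i) := fun r M hM => by
  have h1 : onLeft (∑ i ∈ s, Φ i) M = ∑ i ∈ s, onLeft (Φ i) M := by
    ext p q
    rw [onLeft_apply, LinearMap.sum_apply, Matrix.sum_apply, Matrix.sum_apply]
    rfl
  rw [h1]
  exact Matrix.posSemidef_sum _ fun i _ => h i r M hM

theorem trace_onLeft {Φ : Mat α →ₗ[ℂ] Mat β} (hΦ : ∀ M, (Φ M).trace = M.trace)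
    (M : Mat (α × ρ)) : (onLeft Φ M).trace = M.trace := by
  simp only [Matrix.trace, Matrix.diag_apply, Fintype.sum_prod_type_right, onLeft_apply]
  refine Finset.sum_congr rfl fun s _ => ?_
  exact hΦ (Matrix.of fun a a' => M (a, s) (a', s))

variable {n : ℕ}

theorem preservesPos_runNoisy (e : Fin n → ZMod 2) (gs : List (Gate n)) (r : Fin n → ZMod 2) :
    PreservesPos (runNoisy e gs r) := by
  induction gs generalizing r with
  | nil => exact fun r M hM => hM
  | cons g gs ih =>
    match g with
    | Gate.X b i => exact (ih _).comp (preservesPos_conj _)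
    | Gate.Z b i => exact (ih _).comp (preservesPos_conj _)
    | Gate.CNOT i j => exact (ih _).comp (preservesPos_conj _)
    | Gate.meas B i => exact PreservesPos.sum fun a => (ih _).comp (preservesPos_conj _)

theorem preservesPos_noisyChannel (c : Circuit n) (e f : Fin n → ZMod 2) :
    PreservesPos (noisyChannel c e f) :=
  (PreservesPos.sum fun _ => preservesPos_conj _).comp
    ((preservesPos_conj _).comp (preservesPos_runNoisy _ _ _))

end Positivity

/-! ### The state after an attack -/

section AttackState

variable {G : Type} [AddCommGroup G] [Fintype G] [DecidableEq G] [SignPairing G]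
  {X R R' K O : Type} [Fintype X] [Fintype R] [Fintype R'] [Fintype K] [Fintype O]

/-- The unnormalised state of plaintext and side register, given that the attack acts on the
ciphertext as the Pauli with label `q`. -/
def attackState (U : Mat G) (A : K → Matrix (G × R') (G × R) ℂ) (ρ : Mat (X × R)) (q : G × G) :
    Mat (X × R') :=
  Matrix.of fun t t' => ∑ k, ∑ r, ∑ r', (attackKraus U (A k) q t.2 r *
    star (attackKraus U (A k) q t'.2 r')) * ρ (t.1, r) (t'.1, r')

open scoped ComplexOrder in
theorem posSemidef_attackState (U : Mat G) (A : K → Matrix (G × R') (G × R) ℂ) {ρ : Mat (X × R)}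
    (hρ : ρ.PosSemidef) (q : G × G) : (attackState U A ρ q).PosSemidef := by
  classical
  have h : attackState U A ρ q =
      ∑ k, conj (Matrix.kronecker (1 : Mat X) (attackKraus U (A k) q)) ρ := by
    ext t t'
    rw [attackState, Matrix.of_apply, Matrix.sum_apply]
    refine Finset.sum_congr rfl fun k _ => ?_
    rw [conj_apply, Matrix.mul_apply, Fintype.sum_prod_type, Finset.sum_eq_single t'.1]
    · rw [Finset.sum_comm]
      refine Finset.sum_congr rfl fun r' _ => ?_
      rw [Matrix.mul_apply, Fintype.sum_prod_type, Finset.sum_eq_single t.1, Finset.sum_mul]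
      · refine Finset.sum_congr rfl fun r _ => ?_
        simp [Matrix.kronecker]
        ring
      · intro x _ hx
        simp [Matrix.kronecker, Ne.symm hx]
      · simp
    · intro x _ hx
      simp [Matrix.kronecker, Ne.symm hx]
    · simp
  rw [h]
  exact Matrix.posSemidef_sum _ fun k _ => posSemidef_conj _ hρ

variable {U : Mat G} {L : G × G → G × G}

theorem sum_onLeft_attack (hU : IsCliffordWith U L)
    {D : G × G → Mat G →ₗ[ℂ] Mat O} {D₀ : Mat G →ₗ[ℂ] Mat O}
    (hD : ∀ p, D p ∘ₗ conj (pauli (L p).1 (L p).2) = D₀)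
    (V : Matrix G X ℂ) (A : K → Matrix (G × R') (G × R) ℂ) (ρ : Mat (X × R)) :
    ∑ p : G × G, onLeft (D p) (krausMap A (onLeft (conj (pauli p.1 p.2 * V)) ρ)) =
      (Fintype.card (G × G) : ℂ) • ∑ q : G × G,
        onLeft (D₀ ∘ₗ conj (pauli q.1 q.2 * (U * V))) (attackState U A ρ q) := by
  ext t t'
  have h := congrFun (congrFun (sum_attack hU hD V A
    (fun r r' => Matrix.of fun x x' => ρ (x, r) (x', r')) t.2 t'.2) t.1) t'.1
  rw [Matrix.sum_apply] at h ⊢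
  refine h.trans ?_
  rw [Matrix.smul_apply, Matrix.smul_apply, Matrix.sum_apply, Matrix.sum_apply]
  congr 1
  refine Finset.sum_congr rfl fun q _ => ?_
  rw [onLeft_apply, LinearMap.comp_apply]
  refine congrFun (congrFun (congrArg _ (congrArg _ ?_)) t.1) t'.1
  ext x x'
  simp [attackState, Matrix.sum_apply]

/-- The attack leaves a plaintext that is kept aside in the same state as an encrypted one before
the Pauli error. -/
theorem sum_attack_swapped (hU : IsCliffordWith U L)
    {D : G × G → Mat G →ₗ[ℂ] Mat O} {D₀ : Mat G →ₗ[ℂ] Mat O}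
    (hD : ∀ p, D p ∘ₗ conj (pauli (L p).1 (L p).2) = D₀)
    (V : Matrix G X ℂ) (A : K → Matrix (G × R') (G × R) ℂ) (ρ : Mat (X × R)) (τ : Mat X) :
    ∑ p : G × G, (Matrix.of fun t t' : X × R' => Matrix.trace (D p (Matrix.of fun y y' =>
        onLeft (krausMap A) (Matrix.of fun a a' : (G × R) × X =>
          conj (pauli p.1 p.2 * V) τ a.1.1 a'.1.1 * ρ (a.2, a.1.2) (a'.2, a'.1.2))
        ((y, t.2), t.1) ((y', t'.2), t'.1)))) =
      (Fintype.card (G × G) : ℂ) • ∑ q : G × G,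
        (D₀ (conj (pauli q.1 q.2 * (U * V)) τ)).trace • attackState U A ρ q := by
  ext t t'
  have h := congrArg Matrix.trace (sum_attack hU hD V A
    (fun r r' => ρ (t.1, r) (t'.1, r') • τ) t.2 t'.2)
  rw [Matrix.trace_sum] at h
  rw [Matrix.sum_apply]
  refine Eq.trans ?_ (h.trans ?_)
  · refine Finset.sum_congr rfl fun p _ => ?_
    rw [Matrix.of_apply]
    refine congrArg Matrix.trace (congrArg (D p) (Matrix.ext fun y y' => ?_))
    rw [Matrix.of_apply, Matrix.of_apply, onLeft_apply]
    refine congrFun (congrFun (congrArg (krausMap A) (Matrix.ext fun a a' => ?_)) (y, t.2)) (y',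
      t'.2)
    rw [Matrix.of_apply, Matrix.of_apply, Matrix.of_apply, map_smul, Matrix.smul_apply, smul_eq_mul,
      mul_comm]
  · rw [Matrix.trace_smul, Matrix.trace_sum, Matrix.smul_apply, Matrix.sum_apply]
    congr 1
    refine Finset.sum_congr rfl fun q _ => ?_
    simp only [smul_smul, ← Finset.sum_smul, map_smul, Matrix.trace_smul, Matrix.smul_apply]
    rw [smul_eq_mul, smul_eq_mul, mul_comm]
    rfl

theorem sum_trace_attackState [DecidableEq X] (hU : IsCliffordWith U L)
    {V : Matrix G X ℂ} (hV : V.conjTranspose * V = 1)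
    (A : K → Matrix (G × R') (G × R) ℂ) (ρ : Mat (X × R)) :
    ∑ p : G × G, (krausMap A (onLeft (conj (pauli p.1 p.2 * V)) ρ)).trace =
      (Fintype.card (G × G) : ℂ) * ∑ q : G × G, (attackState U A ρ q).trace := by
  have hiso : ∀ {W : Matrix G X ℂ} (x z : G), W.conjTranspose * W = 1 → ∀ M : Mat X,
      (conj (pauli x z * W) M).trace = M.trace := by
    intro W x z hW M
    rw [conj_mul, LinearMap.comp_apply, trace_conj_of_isometry (pauli_isometry _ _),
      trace_conj_of_isometry hW]
  have hUV : (U * V).conjTranspose * (U * V) = 1 := by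
    rw [Matrix.conjTranspose_mul, Matrix.mul_assoc, ← Matrix.mul_assoc _ U, hU.isometry,
      Matrix.one_mul, hV]
  have hD : ∀ p : G × G, Matrix.traceLinearMap G ℂ ℂ ∘ₗ conj (pauli (L p).1 (L p).2) =
      Matrix.traceLinearMap G ℂ ℂ := by
    intro p
    ext M : 1
    exact trace_conj_of_isometry (pauli_isometry _ _) M
  have h := fun s : R' => sum_attack (F := ℂ) hU hD V A
    (fun r r' => Matrix.of fun x x' => ρ (x, r) (x', r')) s s
  have h' := Finset.sum_congr (rfl : (Finset.univ : Finset R') = Finset.univ) fun s _ => h s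
  rw [Finset.sum_comm, ← Finset.smul_sum, smul_eq_mul,
    Finset.sum_comm (s := (Finset.univ : Finset R'))] at h'
  refine Eq.trans ?_ (h'.trans ?_)
  · refine Finset.sum_congr rfl fun p _ => ?_
    rw [Matrix.trace, Fintype.sum_prod_type_right]
    rfl
  · congr 1
    refine Finset.sum_congr rfl fun q _ => ?_
    rw [Matrix.trace, Fintype.sum_prod_type_right]
    refine Finset.sum_congr rfl fun s _ => ?_
    rw [Matrix.traceLinearMap_apply, hiso _ _ hUV]
    refine Finset.sum_congr rfl fun x _ => ?_
    simp [attackState, Matrix.sum_apply]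

end AttackState

/-! ### The verification game -/

section Game

variable {n m : ℕ} {Q : CSSCode m} (δ : Q.Decoder) (Ω : (c : Circuit n) → Mat c.Out)

/-- Erasing the plaintext and replacing it with the fixed state. -/
def discard (c : Circuit n) : Mat (Fin n → ZMod 2) →ₗ[ℂ] Mat c.Out :=
  (Matrix.traceLinearMap _ ℂ ℂ).smulRight (Ω c)

theorem trace_discard {c : Circuit n} (hΩ : (Ω c).trace = 1) (M : Mat (Fin n → ZMod 2)) :
    (discard Ω c M).trace = M.trace := by
  rw [discard, LinearMap.smulRight_apply, Matrix.trace_smul, hΩ, smul_eq_mul, mul_one]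
  rfl

open scoped Classical in
/-- What verified decryption with flag `flag` does to the plaintext if the attack is the Pauli with
label `q`. -/
def attackedMap (π : Equiv.Perm (Fin 3 × Fin m)) (c : Circuit n)
    (q : (Fin n → Block m) × (Fin n → Block m)) (flag : Bool) :
    Mat (Fin n → ZMod 2) →ₗ[ℂ] Mat c.Out :=
  if PassesAll π c q then
    if flag then noisyChannel c (errXs π δ q.1) (errZs π δ c q.2) else 0
  else if flag then 0 else discard Ω c

open scoped Classical in
/-- What happens to the plaintext that is kept aside, under the same circumstances. -/
def keptMap (π : Equiv.Perm (Fin 3 × Fin m)) (c : Circuit n)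
    (q : (Fin n → Block m) × (Fin n → Block m)) (flag : Bool) :
    Mat (Fin n → ZMod 2) →ₗ[ℂ] Mat c.Out :=
  if PassesAll π c q then if flag then c.channel else 0
  else if flag then 0 else discard Ω c

theorem isCliffordWith_unitaryPart (c : Circuit n) :
    IsCliffordWith (unitaryPart (Block m) c.gates) (lin c.gates) where
  isometry := unitaryPart_isometry c.wf
  injective := lin_injective c.gates ⟨∅, c.wf⟩
  mul_pauli := unitaryPart_mul_pauli c.wf

theorem verDec_comp_pauli (π : Equiv.Perm (Fin 3 × Fin m)) (c : Circuit n) (flag : Bool)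
    (p : (Fin n → Block m) × (Fin n → Block m)) :
    (TC n δ Ω).verDec (π, p) c () flag ∘ₗ
      conj (pauli (lin c.gates p).1 (lin c.gates p).2) = (TC n δ Ω).verDec (π, 0) c () flag := by
  cases flag
  · have h : ∀ M, verDecAcc δ (π, p) c (conj (pauli (lin c.gates p).1 (lin c.gates p).2) M) =
        verDecAcc δ (π, 0) c M := fun M => by
      rw [← verDecAcc_comp_pauli δ π p c]; rfl
    ext M : 1
    change (Matrix.traceLinearMap _ ℂ ℂ - Matrix.traceLinearMap _ ℂ ℂ ∘ₗ
      verDecAcc δ (π, p) c).smulRight (Ω c) (conj _ M) = (Matrix.traceLinearMap _ ℂ ℂ -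
        Matrix.traceLinearMap _ ℂ ℂ ∘ₗ verDecAcc δ (π, 0) c).smulRight (Ω c) M
    simp only [LinearMap.smulRight_apply, LinearMap.sub_apply, LinearMap.comp_apply, h,
      Matrix.traceLinearMap_apply, trace_conj_of_isometry (pauli_isometry _ _)]
  · exact verDecAcc_comp_pauli δ π p c

/-- A Pauli attack is accepted or rejected with certainty, whatever the plaintext. -/
theorem verDec_attack (π : Equiv.Perm (Fin 3 × Fin m)) (c : Circuit n) (flag : Bool)
    (q : (Fin n → Block m) × (Fin n → Block m)) :
    (TC n δ Ω).verDec (π, 0) c () flag ∘ₗ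
      conj (pauli q.1 q.2 * (unitaryPart (Block m) c.gates * encAll Q π n)) =
      attackedMap δ Ω π c q flag := by
  have hacc := verDecAcc_attack π δ c q
  cases flag
  · have htr : ∀ M, (conj (pauli q.1 q.2 * (unitaryPart (Block m) c.gates * encAll Q π n)) M).trace
        = M.trace := fun M => by
      rw [conj_mul, conj_mul, LinearMap.comp_apply, LinearMap.comp_apply,
        trace_conj_of_isometry (pauli_isometry _ _),
        trace_conj_of_isometry (unitaryPart_isometry c.wf),
        trace_conj_of_isometry (encAll_isometry π)]
    ext M : 1
    have h := LinearMap.congr_fun hacc M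
    rw [LinearMap.comp_apply] at h
    change (Matrix.traceLinearMap _ ℂ ℂ - Matrix.traceLinearMap _ ℂ ℂ ∘ₗ
      verDecAcc δ (π, 0) c).smulRight (Ω c) (conj _ M) = _
    rw [LinearMap.smulRight_apply, LinearMap.sub_apply, LinearMap.comp_apply, h,
      Matrix.traceLinearMap_apply, Matrix.traceLinearMap_apply, htr]
    by_cases h1 : PassesAll π c q
    · simp only [attackedMap, if_pos h1, trace_noisyChannel, sub_self, zero_smul]
      rfl
    · simp only [attackedMap, if_neg h1, LinearMap.zero_apply, Matrix.trace_zero, sub_zero]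
      rfl
  · refine hacc.trans ?_
    rw [attackedMap]
    rfl

variable (A : Adversary Unit (Fin n → ZMod 2) (Fin n → Block m) (Circuit n) Unit Circuit.Out)

/-- The joint state of plaintext and side register that the adversary prepares. -/
def initialState : Mat ((Fin n → ZMod 2) × Fin A.r) := A.A₁ 1

theorem A₁_keyGen (k : TCKey n m) :
    A.A₁ ((TC n δ Ω).keyGen k) = (Fintype.card (TCKey n m) : ℂ)⁻¹ • initialState A :=
  map_smul A.A₁ _ _

variable {K : Type} [Fintype K]

theorem inv_card_key_mul :
    (Fintype.card (TCKey n m) : ℂ)⁻¹ *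
      Fintype.card ((Fin n → Block m) × (Fin n → Block m)) =
      (Fintype.card (Equiv.Perm (Fin 3 × Fin m)) : ℂ)⁻¹ := by
  have h : Fintype.card (TCKey n m) = Fintype.card (Equiv.Perm (Fin 3 × Fin m)) *
    Fintype.card ((Fin n → Block m) × (Fin n → Block m)) := Fintype.card_prod _ _
  rw [h, Nat.cast_mul, mul_inv, mul_assoc,
    inv_mul_cancel₀ (Nat.cast_ne_zero.2 Fintype.card_ne_zero),
    mul_one]

/-- If the plaintext is encrypted, then averaging over the one-time pad leaves a sum over Paulis. -/
theorem sum_finalState₀ (c : Circuit n)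
    {B : K → Matrix ((Fin n → Block m) × Fin (A.r' c)) ((Fin n → Block m) × Fin A.r) ℂ}
    (hB : A.A₂ c () = krausMap B) (flag : Bool) :
    ∑ k, finalState₀ (TC n δ Ω) A k c () flag =
      (Fintype.card (Equiv.Perm (Fin 3 × Fin m)) : ℂ)⁻¹ • ∑ π, ∑ q,
        onLeft (attackedMap δ Ω π c q flag)
          (attackState (unitaryPart (Block m) c.gates) B (initialState A) q) := by
  rw [← inv_card_key_mul, mul_smul, Finset.smul_sum, Finset.smul_sum, Fintype.sum_prod_type]
  refine Finset.sum_congr rfl fun π _ => ?_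
  have h := sum_onLeft_attack (isCliffordWith_unitaryPart c)
    (verDec_comp_pauli δ Ω π c flag) (encAll Q π n) B (initialState A)
  simp only [verDec_attack] at h
  rw [← h, Finset.smul_sum]
  refine Finset.sum_congr rfl fun p _ => ?_
  rw [finalState₀, A₁_keyGen, map_smul, map_smul, map_smul, hB, ← enc_eq_conj]
  rfl

theorem trace_proj {G : Type} [Fintype G] [DecidableEq G] (w : G) : (proj w).trace = 1 := by
  rw [proj, Matrix.trace_single_eq_same]

theorem finalState₁_eq (k : TCKey n m) (c : Circuit n) (flag : Bool) :
    finalState₁ (TC n δ Ω) A k c () flag = onLeft (if flag then c.channel else discard Ω c)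
      (verifiedState (TC n δ Ω) A k c () flag) := by
  cases flag
  · have h : finalState₁ (TC n δ Ω) A k c () false = Matrix.of fun p q => Ω c p.1 q.1 *
        ∑ o, onLeft c.channel (verifiedState (TC n δ Ω) A k c () false) (o, p.2) (o, q.2) := rfl
    rw [h]
    generalize verifiedState (TC n δ Ω) A k c () false = V
    ext t t'
    have h1 : ∑ o, onLeft c.channel V (o, t.2) (o, t'.2) =
        (Matrix.of fun a a' => V (a, t.2) (a', t'.2)).trace :=
      trace_channel c (Matrix.of fun a a' => V (a, t.2) (a', t'.2))
    rw [Matrix.of_apply, h1, mul_comm]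
    rfl
  · rfl

/-- Whether the plaintext is encrypted or kept aside, the same Paulis occur with the same
(unnormalised) states of plaintext and side register; only their effects on the plaintext differ. -/
theorem sum_finalState₁ {c : Circuit n} (hΩ : (Ω c).trace = 1)
    {B : K → Matrix ((Fin n → Block m) × Fin (A.r' c)) ((Fin n → Block m) × Fin A.r) ℂ}
    (hB : A.A₂ c () = krausMap B) (flag : Bool) :
    ∑ k, finalState₁ (TC n δ Ω) A k c () flag =
      (Fintype.card (Equiv.Perm (Fin 3 × Fin m)) : ℂ)⁻¹ • ∑ π, ∑ q,
        onLeft (keptMap Ω π c q flag)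
          (attackState (unitaryPart (Block m) c.gates) B (initialState A) q) := by
  have hver : ∑ k, verifiedState (TC n δ Ω) A k c () flag =
      (Fintype.card (Equiv.Perm (Fin 3 × Fin m)) : ℂ)⁻¹ • ∑ π, ∑ q,
        (attackedMap δ Ω π c q flag (proj 0)).trace •
          attackState (unitaryPart (Block m) c.gates) B (initialState A) q := by
    rw [← inv_card_key_mul, mul_smul, Finset.smul_sum, Finset.smul_sum, Fintype.sum_prod_type]
    refine Finset.sum_congr rfl fun π _ => ?_
    have h := sum_attack_swapped (isCliffordWith_unitaryPart c)
      (verDec_comp_pauli δ Ω π c flag) (encAll Q π n) B (initialState A) (proj 0)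
    simp only [← LinearMap.comp_apply, verDec_attack] at h
    rw [← h, Finset.smul_sum]
    refine Finset.sum_congr rfl fun p _ => ?_
    have hs : swappedState (TC n δ Ω) A (π, p) = (Fintype.card (TCKey n m) : ℂ)⁻¹ •
        Matrix.of fun a a' : ((Fin n → Block m) × Fin A.r) × (Fin n → ZMod 2) =>
          conj (pauli p.1 p.2 * encAll Q π n) (proj 0) a.1.1 a'.1.1 *
            initialState A (a.2, a.1.2) (a'.2, a'.1.2) := by
      ext a a'
      rw [swappedState, A₁_keyGen, ← enc_eq_conj]
      exact mul_left_comm _ _ _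
    have hlin : ∀ (a : ℂ) (S : Mat (((Fin n → Block m) × Fin A.r) × (Fin n → ZMod 2)))
        (D : Mat (Fin n → Block m) →ₗ[ℂ] Mat c.Out),
        (Matrix.of fun t t' : (Fin n → ZMod 2) × Fin (A.r' c) => Matrix.trace (D (Matrix.of
          fun y y' => onLeft (krausMap B) (a • S) ((y, t.2), t.1) ((y', t'.2), t'.1)))) =
        a • Matrix.of fun t t' : (Fin n → ZMod 2) × Fin (A.r' c) => Matrix.trace (D (Matrix.of
          fun y y' => onLeft (krausMap B) S ((y, t.2), t.1) ((y', t'.2), t'.1))) := by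
      intro a S D
      ext t t'
      rw [Matrix.smul_apply, Matrix.of_apply, Matrix.of_apply, ← Matrix.trace_smul, ← map_smul,
        map_smul (onLeft (krausMap B))]
      rfl
    rw [verifiedState, hs, hB]
    exact hlin _ _ _
  simp only [finalState₁_eq, ← map_sum, hver, map_smul]
  congr 1
  simp only [map_sum]
  refine Finset.sum_congr rfl fun π _ => Finset.sum_congr rfl fun q _ => ?_
  rw [map_smul, attackedMap, keptMap]
  have h0 : ∀ M : Mat ((Fin n → ZMod 2) × Fin (A.r' c)),
      onLeft (0 : Mat (Fin n → ZMod 2) →ₗ[ℂ] Mat c.Out) M = 0 := fun M => rfl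
  split_ifs
  · rw [trace_noisyChannel, trace_proj, one_smul]
  · simp [h0]
  · simp [h0]
  · rw [trace_discard Ω hΩ, trace_proj, one_smul]

/-- The claimed circuit and the Pauli as which the attack acts have a joint probability
distribution. It does not depend on the secret permutation, so that any permutation can be used to
compute its total mass. -/
theorem hasSum_trace_attackState
    {k : Circuit n → ℕ} {B : (c : Circuit n) → Fin (k c) →
      Matrix ((Fin n → Block m) × Fin (A.r' c)) ((Fin n → Block m) × Fin A.r) ℂ}
    (hB : ∀ c, A.A₂ c () = krausMap (B c)) (Q : CSSCode m) :
    HasSum (fun c => ∑ q, (attackState (unitaryPart (Block m) c.gates) (B c) (initialState A)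
      q).trace.re) 1 := by
  obtain ⟨N, hN, hNe⟩ : ∃ N : ℂ, N ≠ 0 ∧
      (Fintype.card ((Fin n → Block m) × (Fin n → Block m)) : ℂ) = N :=
    ⟨_, Nat.cast_ne_zero.2 Fintype.card_ne_zero, rfl⟩
  have hρ : (initialState A).trace = 1 := by
    rw [initialState, A.A₁_channel.2]; simp
  have h1 : ∀ p : (Fin n → Block m) × (Fin n → Block m),
      HasSum (fun c => (A.A₂ c () (onLeft (conj (pauli p.1 p.2 * encAll Q 1 n))
        (initialState A))).trace) 1 := by
    intro p
    have htr : (onLeft (conj (pauli p.1 p.2 * encAll Q 1 n)) (initialState A)).trace = 1 := by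
      rw [← hρ]
      refine trace_onLeft (fun M => ?_) _
      rw [← enc_eq_conj, trace_enc]
    generalize onLeft (conj (pauli p.1 p.2 * encAll Q 1 n)) (initialState A) = σ at htr ⊢
    have h := A.A₂_tp σ
    rw [htr, ← (Equiv.prodPUnit (Circuit n)).symm.hasSum_iff] at h
    exact h
  have h2 := (hasSum_sum (s := Finset.univ) fun p _ => h1 p).mul_left N⁻¹
  have h3 : ∀ c, N⁻¹ * ∑ p : (Fin n → Block m) × (Fin n → Block m),
      (A.A₂ c () (onLeft (conj (pauli p.1 p.2 * encAll Q 1 n)) (initialState A))).trace =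
      ∑ q, (attackState (unitaryPart (Block m) c.gates) (B c) (initialState A) q).trace := by
    intro c
    rw [hB, sum_trace_attackState (isCliffordWith_unitaryPart c) (encAll_isometry (Q := Q) 1),
      hNe,
      inv_mul_cancel_left₀ hN]
  simp only [h3] at h2
  rw [Finset.sum_const, Finset.card_univ, nsmul_eq_mul, hNe, mul_one,
    inv_mul_cancel₀ hN] at h2
  simpa using Complex.hasSum_re h2

end Game

/-! ### The winning probability -/

section Guess

open scoped ComplexOrder

variable {α : Type} [Fintype α] {E₀ E₁ : Mat α}

theorem re_trace_guess_eq [DecidableEq α] (h : E₀ + E₁ = 1) (M : Mat α) :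
    (E₀ * M).trace.re + (E₁ * M).trace.re = M.trace.re := by
  rw [← Complex.add_re, ← Matrix.trace_add, ← Matrix.add_mul, h, Matrix.one_mul]

theorem re_trace_guess_le [DecidableEq α] (h : E₀ + E₁ = 1) (h₀ : E₀.PosSemidef)
    (h₁ : E₁.PosSemidef) {M M' : Mat α} (hM : M.PosSemidef) (hM' : M'.PosSemidef) :
    (E₀ * M).trace.re + (E₁ * M').trace.re ≤ M.trace.re + M'.trace.re := by
  rw [← re_trace_guess_eq h M, ← re_trace_guess_eq h M']
  linarith [re_trace_mul_nonneg h₁ hM, re_trace_mul_nonneg h₀ hM']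

theorem re_trace_mul_average {I J : Type} [Fintype I] [Fintype J] (E : Mat α) (N : ℕ)
    (M : I → J → Mat α) :
    (E * ((N : ℂ)⁻¹ • ∑ i, ∑ j, M i j)).trace.re =
      (N : ℝ)⁻¹ * ∑ i, ∑ j, (E * M i j).trace.re := by
  rw [Matrix.mul_smul, Matrix.trace_smul, smul_eq_mul, ← Complex.ofReal_natCast,
    ← Complex.ofReal_inv, Complex.re_ofReal_mul]
  simp only [Matrix.mul_sum, Matrix.trace_sum, Complex.re_sum]

end Guess

section Game

variable {n m : ℕ} {Q : CSSCode m} (δ : Q.Decoder) (Ω : (c : Circuit n) → Mat c.Out)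
  (A : Adversary Unit (Fin n → ZMod 2) (Fin n → Block m) (Circuit n) Unit Circuit.Out)

/-- The contribution to the winning probability if `π` is the secret permutation and the attack
acts as the Pauli with label `q`, leaving plaintext and side register in the state `ρ`. -/
def pauliWin (c : Circuit n) (ρ : Mat ((Fin n → ZMod 2) × Fin (A.r' c)))
    (π : Equiv.Perm (Fin 3 × Fin m)) (q : (Fin n → Block m) × (Fin n → Block m)) : ℝ :=
  ∑ flag : Bool, (1 / 2 * (A.A₃ c flag false * onLeft (attackedMap δ Ω π c q flag) ρ).trace.re +
    1 / 2 * (A.A₃ c flag true * onLeft (keptMap Ω π c q flag) ρ).trace.re)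

open scoped ComplexOrder in
theorem preservesPos_discard {c : Circuit n} (hΩ : (Ω c).PosSemidef) :
    PreservesPos (discard Ω c) := by
  obtain ⟨B, hB⟩ : ∃ B : Mat c.Out, Ω c = B.conjTranspose * B := by
    open scoped MatrixOrder in exact CStarAlgebra.nonneg_iff_eq_star_mul_self.1 hΩ.nonneg
  -- Erasing is the transfer of every basis state to every basis state.
  have h : discard Ω c = conj B.conjTranspose ∘ₗ ∑ o : c.Out, ∑ x,
      conj (Matrix.single o x (1 : ℂ)) := by
    ext M : 1
    have h1 : (∑ o : c.Out, ∑ x, conj (Matrix.single o x (1 : ℂ))) M = M.trace • 1 := by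
      rw [LinearMap.sum_apply, Matrix.smul_one_eq_diagonal]
      ext u v
      simp only [LinearMap.sum_apply, conj_apply, Matrix.conjTranspose_single, star_one,
        Matrix.single_mul_mul_single, one_mul, mul_one, Matrix.sum_apply, Matrix.single_apply]
      by_cases huv : u = v
      · subst huv
        simp [Matrix.trace]
      · rw [Matrix.diagonal_apply_ne _ huv]
        refine Finset.sum_eq_zero fun o _ => Finset.sum_eq_zero fun x _ => if_neg ?_
        exact fun h => huv (h.1.symm.trans h.2)
    rw [LinearMap.comp_apply, h1, conj_apply, Matrix.conjTranspose_conjTranspose, Matrix.mul_smul,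
      Matrix.mul_one, Matrix.smul_mul, ← hB]
    rfl
  rw [h]
  exact (preservesPos_conj _).comp
    (PreservesPos.sum fun _ => PreservesPos.sum fun _ => preservesPos_conj _)

open scoped ComplexOrder in
theorem preservesPos_channel (c : Circuit n) : PreservesPos c.channel :=
  noisyChannel_zero c ▸ preservesPos_noisyChannel c 0 0

open scoped ComplexOrder in
theorem pauliWin_nonneg {c : Circuit n} (hΩ : (Ω c).PosSemidef)
    {ρ : Mat ((Fin n → ZMod 2) × Fin (A.r' c))} (hρ : ρ.PosSemidef)
    (π : Equiv.Perm (Fin 3 × Fin m)) (q : (Fin n → Block m) × (Fin n → Block m)) :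
    0 ≤ pauliWin δ Ω A c ρ π q := by
  have h0 : PreservesPos (0 : Mat (Fin n → ZMod 2) →ₗ[ℂ] Mat c.Out) :=
    fun _ _ _ => Matrix.PosSemidef.zero
  have h1 : ∀ flag, PreservesPos (attackedMap δ Ω π c q flag) := fun flag => by
    rw [attackedMap]
    split_ifs
    exacts [preservesPos_noisyChannel _ _ _, h0, h0, preservesPos_discard Ω hΩ]
  have h2 : ∀ flag, PreservesPos (keptMap Ω π c q flag) := fun flag => by
    rw [keptMap]
    split_ifs
    exacts [preservesPos_channel c, h0, h0, preservesPos_discard Ω hΩ]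
  refine Finset.sum_nonneg fun flag _ => add_nonneg (mul_nonneg (by norm_num) ?_)
    (mul_nonneg (by norm_num) ?_)
  · exact re_trace_mul_nonneg (A.A₃_pos c flag false) (h1 flag _ ρ hρ)
  · exact re_trace_mul_nonneg (A.A₃_pos c flag true) (h2 flag _ ρ hρ)

open scoped Classical ComplexOrder in
/-- Only a Pauli that passes the traps and is too heavy to be corrected gives the adversary an
advantage: otherwise the real and the ideal plaintext agree. -/
theorem pauliWin_le {dc : ℕ} (hδ : δ.Corrects dc) {c : Circuit n} (hΩ : (Ω c).trace = 1)
    {ρ : Mat ((Fin n → ZMod 2) × Fin (A.r' c))} (hρ : ρ.PosSemidef)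
    (π : Equiv.Perm (Fin 3 × Fin m)) (q : (Fin n → Block m) × (Fin n → Block m)) :
    pauliWin δ Ω A c ρ π q ≤ 1 / 2 * ρ.trace.re +
      if PassesAll π c q ∧ ¬Harmless dc c q then 1 / 2 * ρ.trace.re else 0 := by
  have h0 : onLeft (0 : Mat (Fin n → ZMod 2) →ₗ[ℂ] Mat c.Out) ρ = 0 := rfl
  rw [pauliWin, Fintype.sum_bool]
  by_cases hp : PassesAll π c q
  · simp only [attackedMap, keptMap, if_pos hp, if_true, Bool.false_eq_true, if_false, h0,
      Matrix.trace_zero, Complex.zero_re, mul_zero, add_zero]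
    by_cases hq : Harmless dc c q
    · rw [if_neg fun h => h.2 hq,
        errXs_zero_of_corrects π δ hδ fun i => (hammingNorm_dataPart_le π _).trans (hq i).1,
        errZs_zero_of_corrects π δ hδ c fun i hi =>
          (hammingNorm_dataPart_le π _).trans ((hq i).2 hi), noisyChannel_zero]
      have h := re_trace_guess_eq (A.A₃_sum c true) (onLeft c.channel ρ)
      rw [trace_onLeft (trace_channel c)] at h
      linarith
    · rw [if_pos ⟨hp, hq⟩]
      have h := re_trace_guess_le (A.A₃_sum c true) (A.A₃_pos c true false) (A.A₃_pos c true true)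
        (preservesPos_noisyChannel c (errXs π δ q.1) (errZs π δ c q.2) _ ρ hρ)
        (preservesPos_channel c _ ρ hρ)
      rw [trace_onLeft (trace_channel c), trace_onLeft (trace_noisyChannel c _ _)] at h
      linarith
  · rw [if_neg fun h => hp h.1]
    simp only [attackedMap, keptMap, if_neg hp, if_true, Bool.false_eq_true, if_false, h0,
      Matrix.trace_zero, Complex.zero_re, mul_zero, zero_add]
    have h := re_trace_guess_eq (A.A₃_sum c false) (onLeft (discard Ω c) ρ)
    rw [trace_onLeft (trace_discard Ω hΩ)] at h
    linarith

open scoped ComplexOrder in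
/-- For a fixed Pauli, the contributions of all secret permutations: if the Pauli is heavy, then
only few permutations let it pass. -/
theorem sum_pauliWin_le {dc : ℕ} (hδ : δ.Corrects dc) {c : Circuit n} (hΩ : (Ω c).trace = 1)
    {ρ : Mat ((Fin n → ZMod 2) × Fin (A.r' c))} (hρ : ρ.PosSemidef)
    (q : (Fin n → Block m) × (Fin n → Block m)) :
    ∑ π, pauliWin δ Ω A c ρ π q ≤ Fintype.card (Equiv.Perm (Fin 3 × Fin m)) *
      ((1 / 2 + 1 / 2 * (2 / 3 : ℝ) ^ dc) * ρ.trace.re) := by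
  classical
  have ht := re_trace_nonneg hρ
  refine (Finset.sum_le_sum fun π _ => pauliWin_le δ Ω A hδ hΩ hρ π q).trans ?_
  rw [Finset.sum_add_distrib, Finset.sum_const, Finset.card_univ, nsmul_eq_mul]
  have h : (∑ π : Equiv.Perm (Fin 3 × Fin m),
      if PassesAll π c q ∧ ¬Harmless dc c q then 1 / 2 * ρ.trace.re else 0) ≤
      (2 / 3 : ℝ) ^ dc * Fintype.card (Equiv.Perm (Fin 3 × Fin m)) * (1 / 2 * ρ.trace.re) := by
    by_cases hq : Harmless dc c q
    · simp only [hq, not_true, and_false, if_false, Finset.sum_const_zero]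
      positivity
    · simp only [hq, not_false_iff, and_true]
      rw [← Finset.sum_filter, Finset.sum_const, nsmul_eq_mul]
      refine mul_le_mul_of_nonneg_right (le_trans (le_of_eq ?_) (card_passesAll_le c q hq))
        (by positivity)
      congr
  linarith

open scoped ComplexOrder in
theorem posSemidef_initialState : (initialState A).PosSemidef := by
  obtain ⟨r, K, hK⟩ := A.A₁_channel.1
  rw [initialState, hK]
  exact posSemidef_krausMap K Matrix.PosSemidef.one

/-- The probability that the adversary claims the circuit `c` and wins. -/
def winWith (c : Circuit n) : ℝ :=
  ∑ k : TCKey n m, ∑ flag : Bool,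
    ((1 / 2 : ℝ) * (Matrix.trace
        (A.A₃ c flag false * finalState₀ (TC n δ Ω) A k c () flag)).re +
      (1 / 2 : ℝ) * (Matrix.trace
        (A.A₃ c flag true * finalState₁ (TC n δ Ω) A k c () flag)).re)

/-- The winning probability with a given claimed circuit is the average of the contributions of the
secret permutations, summed over the Paulis. -/
theorem winWith_eq {c : Circuit n} (hΩ : (Ω c).trace = 1) {K : Type} [Fintype K]
    {B : K → Matrix ((Fin n → Block m) × Fin (A.r' c)) ((Fin n → Block m) × Fin A.r) ℂ}
    (hB : A.A₂ c () = krausMap B) :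
    winWith δ Ω A c =
      (Fintype.card (Equiv.Perm (Fin 3 × Fin m)) : ℝ)⁻¹ * ∑ π, ∑ q, pauliWin δ Ω A c
        (attackState (unitaryPart (Block m) c.gates) B (initialState A) q) π q := by
  have h1 : ∀ flag guess : Bool, ∀ S : TCKey n m → Mat (c.Out × Fin (A.r' c)),
      ∑ k, (1 / 2 : ℝ) * (Matrix.trace (A.A₃ c flag guess * S k)).re =
        1 / 2 * (A.A₃ c flag guess * ∑ k, S k).trace.re := by
    intro flag guess S
    rw [← Finset.mul_sum, Matrix.mul_sum, Matrix.trace_sum, Complex.re_sum]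
  rw [winWith, Finset.sum_comm]
  simp only [Finset.sum_add_distrib (s := (Finset.univ : Finset (TCKey n m))), h1,
    sum_finalState₀ δ Ω A c hB, sum_finalState₁ δ Ω A hΩ hB, re_trace_mul_average]
  simp only [mul_left_comm (1 / 2 : ℝ), ← mul_add, Finset.mul_sum (a := (1 / 2 : ℝ)),
    ← Finset.sum_add_distrib]
  rw [← Finset.mul_sum, Finset.sum_comm]
  congr 1
  refine Finset.sum_congr rfl fun π _ => Finset.sum_comm.trans ?_
  simp only [pauliWin, mul_add]

/-- The winning probability of every adversary exceeds `1/2` by at most half the probability that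
a heavy Pauli passes the traps. -/
theorem winProb_le {dc : ℕ} (hδ : δ.Corrects dc) (hΩ : ∀ c, IsState (Ω c)) :
    winProb (TC n δ Ω) A ≤ 1 / 2 + 1 / 2 * (2 / 3 : ℝ) ^ dc := by
  choose k B hB using fun c => A.A₂_cp c ()
  have hρ := fun c q => posSemidef_attackState (unitaryPart (Block m) c.gates) (B c)
    (posSemidef_initialState A) q
  have hsum := (hasSum_trace_attackState A hB Q).mul_left (1 / 2 + 1 / 2 * (2 / 3 : ℝ) ^ dc)
  rw [mul_one] at hsum
  have hwin : winProb (TC n δ Ω) A = ∑' c, winWith δ Ω A c :=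
    (Equiv.prodPUnit (Circuit n)).tsum_eq (winWith δ Ω A)
  rw [hwin, ← hsum.tsum_eq]
  have hle : ∀ c, winWith δ Ω A c ≤ (1 / 2 + 1 / 2 * (2 / 3 : ℝ) ^ dc) *
      ∑ q, (attackState (unitaryPart (Block m) c.gates) (B c) (initialState A) q).trace.re := by
    intro c
    rw [winWith_eq δ Ω A (hΩ c).2 (hB c), Finset.sum_comm]
    refine (mul_le_mul_of_nonneg_left (Finset.sum_le_sum fun q _ =>
      sum_pauliWin_le δ Ω A hδ (hΩ c).2 (hρ c q) q) (by positivity)).trans (le_of_eq ?_)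
    rw [← Finset.mul_sum, ← Finset.mul_sum,
      inv_mul_cancel_left₀ (Nat.cast_ne_zero.2 Fintype.card_ne_zero)]
  have hnn : ∀ c, 0 ≤ winWith δ Ω A c := by
    intro c
    rw [winWith_eq δ Ω A (hΩ c).2 (hB c)]
    exact mul_nonneg (by positivity) <| Finset.sum_nonneg fun π _ => Finset.sum_nonneg fun q _ =>
      pauliWin_nonneg δ Ω A (hΩ c).1 (hρ c q) π q
  exact (Summable.of_nonneg_of_le hnn hle hsum.summable).tsum_le_tsum hle hsum.summable

theorem negligible_half_pow : Negligible fun κ => 1 / 2 * (2 / 3 : ℝ) ^ κ := by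
  intro k
  have h := (tendsto_pow_const_mul_const_pow_of_abs_lt_one k
    (r := (2 / 3 : ℝ)) (by rw [abs_lt]; constructor <;> norm_num)).const_mul (1 / 2)
  rw [mul_zero] at h
  exact h.congr fun κ => by ring

end Game

end TrapCode

end

theorem mainTheorem3 :
    (∀ (n m dc : ℕ) (Q : TrapCode.CSSCode m) (δ : Q.Decoder)
        (Ω : (c : TrapCode.Circuit n) → TrapCode.Mat c.Out),
      Q.distance = 2 * dc + 1 → δ.Corrects dc → (∀ c, TrapCode.IsState (Ω c)) →
        (TrapCode.TC n δ Ω).IsCorrect ∧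
        ∀ A : TrapCode.Adversary Unit (Fin n → ZMod 2) (Fin n → TrapCode.Block m)
            (TrapCode.Circuit n) Unit TrapCode.Circuit.Out,
          TrapCode.winProb (TrapCode.TC n δ Ω) A ≤ 1 / 2 + 1 / 2 * (2 / 3 : ℝ) ^ dc) ∧
    (∀ (n m dc : ℕ → ℕ) (Q : (κ : ℕ) → TrapCode.CSSCode (m κ)) (δ : (κ : ℕ) → (Q κ).Decoder)
        (Ω : (κ : ℕ) → (c : TrapCode.Circuit (n κ)) → TrapCode.Mat c.Out),
      (∀ κ, (Q κ).distance = 2 * dc κ + 1) → (∀ κ, (δ κ).Corrects (dc κ)) →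
      (∀ κ c, TrapCode.IsState (Ω κ c)) → (∀ κ, κ ≤ dc κ) →
        TrapCode.IsIndVer fun κ => TrapCode.TC (n κ) (δ κ) (Ω κ)) := by
  refine ⟨fun n m dc Q δ Ω _ hδ hΩ => ⟨TrapCode.isCorrect hδ Ω, fun A =>
    TrapCode.winProb_le δ Ω A hδ hΩ⟩, ?_⟩
  intro n m dc Q δ Ω _ hδ hΩ hdc A
  refine ⟨_, TrapCode.negligible_half_pow, fun κ => ?_⟩
  refine (TrapCode.winProb_le (δ κ) (Ω κ) (A κ) (hδ κ) (hΩ κ)).trans ?_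
  have h : (2 / 3 : ℝ) ^ dc κ ≤ (2 / 3 : ℝ) ^ κ :=
    pow_le_pow_of_le_one (by norm_num) (by norm_num) (hdc κ)
  linarith
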